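/- Fix a mass $m\in\mathbb{R}$ and let $\eta=\mathrm{diag}(1,-1,-1,-1)$; indices $\mu,\nu,\dots\in\{0,1,2,3\}$ are raised with $\eta$ and repeated indices are summed. Let $\mathcal W$ be the complex algebra of Wick polynomials in the free fields $h_{\mu\nu}=h_{\nu\mu}$, $v_\mu$ (Bose) and $u_\mu,\tilde u_\mu$ (Fermi) of mass $m$ and their derivatives: the free graded-commutative algebra on the derivatives of these fields modulo the Klein--Gordon equations $(\partial^2+m^2)f=0$, with its derivations $\partial_\mu$. The ghost number is $gh(u_\mu)=1$, $gh(\tilde u_\mu)=-1$, $gh(h_{\mu\nu})=gh(v_\mu)=0$. Let $d_Q$ be the graded derivation, $d_Q(MN)=(d_QM)N+(-1)^{gh(M)}M\,d_QN$, commuting with $\partial_\mu$, with $$d_Qh_{\mu\nu}=-\tfrac i2\left(\partial_\mu u_\nu+\partial_\nu u_\mu-\eta_{\mu\nu}\partial_\rho u^\rho\right),\quad d_Qu_\mu=0,\quad d_Q\tilde u_\mu=i\left(\partial^\nu h_{\mu\nu}+m v_\mu\right),\quad d_Qv_\mu=-\tfrac{im}{2}u_\mu .$$ Two elements of $\mathcal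 W$ are called equivalent if their difference is of the form $d_QB+\partial_\mu B^\mu$ with $gh(B)=-1$, $gh(B^\mu)=0$. Write $h_{\mu\nu}=H_{\mu\nu}+\frac12\eta_{\mu\nu}\Phi$ with $H_{\mu\nu}$ symmetric and traceless, so that $h:=h^\mu{}_\mu=2\Phi$. (1) The coupling $$\begin{aligned}T^{(a)}={}&-2H^{\mu\nu}(\partial_\mu H_{\rho\sigma})(\partial_\nu H^{\rho\sigma})-4H^{\mu\nu}(\partial^\alpha H^{\rho}{}_{\mu})(\partial_\rho H_{\alpha\nu})+2\Phi(\partial^\mu H^{\rho\sigma})(\partial_\rho H_{\mu\sigma})\\&+4\Phi H^{\rho\sigma}(\partial_\rho\partial^\nu H_{\nu\sigma})+\Phi^2(\partial_\mu\partial_\nu H^{\mu\nu})+(\partial^\mu\Phi)(\partial^\nu\Phi)H_{\mu\nu}+4H^{\mu\nu}u^\rho(\partial_\mu\partial_\nu\tilde u_\rho)\\&+4(\partial_\mu H^{\mu\nu})u^\rho(\partial_\nu\tilde u_\rho)+4(\partial_\mu H^{\mu\nu})u^\rho(\partial_\rho\tilde u_\nu)+2(\partial^\mu\Phi)u^\rho(\partial_\rho\tilde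 u_\mu)+4H^{\mu\nu}(\partial_\mu v_\rho)(\partial_\nu v^\rho)\\&-4m(\partial_\mu v_\nu)u^\mu\tilde u^\nu+m^2\left(\tfrac23H^{\mu\nu}H_{\mu\rho}H_\nu{}^\rho+\tfrac12H^{\mu\nu}H_{\mu\nu}\Phi-\tfrac34\Phi^3-\Phi u^\mu\tilde u_\mu+\Phi v^\mu v_\mu\right)\end{aligned}$$ is equivalent to $$\begin{aligned}T={}&h^{\mu\nu}(\partial_\mu h)(\partial_\nu h)-2h^{\mu\nu}(\partial_\mu h_{\rho\sigma})(\partial_\nu h^{\rho\sigma})-4h_{\mu\nu}(\partial_\rho h^{\mu\sigma})(\partial_\sigma h^{\nu\rho})-2h^{\mu\nu}(\partial_\rho h_{\mu\nu})(\partial^\rho h)\\&+4h^{\mu\nu}(\partial_\sigma h_{\mu\rho})(\partial^\sigma h_\nu{}^\rho)+4(\partial_\mu h^{\mu\nu})u^\rho(\partial_\rho\tilde u_\nu)-4h^{\mu\nu}(\partial_\mu u^\rho)(\partial_\nu\tilde u_\rho)+4h^{\mu\nu}(\partial_\mu v_\rho)(\partial_\nu v^\rho)\\&-4m(\partial_\mu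 v_\nu)u^\mu\tilde u^\nu+m^2\left(-\tfrac43h^{\mu\nu}h_{\mu\rho}h_\nu{}^\rho+h^{\mu\nu}h_{\mu\nu}h-\tfrac16h^3\right).\end{aligned}$$ (2) $d_QT=i\,\partial^\mu T^{(a)}_\mu$ with $$\begin{aligned}T^{(a)}_\mu={}&u^\nu\big[-(\partial_\mu h)(\partial_\nu h)+2(\partial_\mu h_{\rho\sigma})(\partial_\nu h^{\rho\sigma})-4(\partial_\rho h^{\rho\sigma})(\partial_\nu h_{\mu\sigma})+4(\partial_\nu h^{\rho\sigma})(\partial_\rho h_{\mu\sigma})-4(\partial_\mu v_\rho)(\partial_\nu v^\rho)\big]\\&+u_\mu\big[\tfrac12(\partial_\nu h)(\partial^\nu h)-(\partial_\nu h_{\rho\sigma})(\partial^\nu h^{\rho\sigma})-2(\partial_\rho h_{\nu\sigma})(\partial^\sigma h^{\nu\rho})+2(\partial_\nu v_\rho)(\partial^\nu v^\rho)\big]\\&+(\partial^\rho u^\nu)\big[4h_{\rho\sigma}(\partial^\sigma h_{\mu\nu})+4h_{\mu\sigma}(\partial_\nu h^\sigma{}_\rho)+2h_{\nu\rho}(\partial_\mu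 h)-4h_{\rho\sigma}(\partial_\mu h^\sigma{}_\nu)\big]\\&-4(\partial^\rho u_\mu)h^{\nu\sigma}(\partial_\nu h_{\rho\sigma})+(\partial^\rho u_\rho)\big[-h(\partial_\mu h)+2h^{\nu\sigma}(\partial_\mu h_{\nu\sigma})\big]\\&+2\big[u^\nu(\partial_\mu u^\rho)(\partial_\nu\tilde u_\rho)+u^\nu(\partial_\nu u^\rho)(\partial_\mu\tilde u_\rho)-u_\mu(\partial^\nu u^\rho)(\partial_\nu\tilde u_\rho)\big]+m^2u_\mu\left(h^{\nu\rho}h_{\nu\rho}-\tfrac12h^2\right).\end{aligned}$$ (3) Let $T_{\mathrm{grav}}$ be the part of $T$ without $u,\tilde u,v$, evaluated on smooth symmetric classical fields $h_{\mu\nu}$ on $\mathbb{R}^4$ (not subject to any field equation). Let $L_E=-\frac{2}{\kappa^2}\sqrt{-g}\,(R-2\Lambda)$ be the Einstein--Hilbert Lagrangian with $\Lambda=m^2/2$, for the metric with $\sqrt{-g}\,g^{\mu\nu}=\eta^{\mu\nu}+\kappa h^{\mu\nu}$, where $R=g^{\mu\nu}R_{\mu\nu}$ and $R_{\mu\nu}=\partial_\alpha\Gamma^\alpha_{\mu\nu}-\partial_\nu\Gamma^\alpha_{\mu\alpha}+\Gamma^\alpha_{\alpha\beta}\Gamma^\beta_{\mu\nu}-\Gamma^\alpha_{\nu\beta}\Gamma^\beta_{\alpha\mu}$.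 Then, at every point, $L_E$ has an expansion in powers of $\kappa$ from order $\kappa^{-2}$ to order $\kappa$ with remainder $O(\kappa^2)$ as $\kappa\to0$, and $-4$ times its coefficient of $\kappa$ equals $T_{\mathrm{grav}}+\partial_\mu B^\mu$, where $B^\mu$ are polynomials (the same for all fields) in $h_{\alpha\beta}$ and $\partial_\gamma h_{\alpha\beta}$. -/

import Mathlib

open scoped ContDiff Topology

noncomputable section

namespace MassiveGravity

/-! ### Minkowski space and index contraction -/

/-- The diagonal entries `1, -1, -1, -1` of the Minkowski metric. -/
def mink : Fin 4 → ℝ := ![1, -1, -1, -1]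

/-- The Minkowski metric `η_{μν}` (numerically equal to its inverse `η^{μν}`). -/
def eta : Matrix (Fin 4) (Fin 4) ℝ := Matrix.diagonal mink

section Contraction

variable {A : Type*} [AddCommGroup A] [Module ℝ A]

/-- Contraction of one pair of indices: for `f μ` standing for an expression in which the index `μ`
occurs twice, both times as a lower index, this is `f^μ_μ = ∑_μ η^{μμ} f_{μμ}`. All tensors below
carry lower indices, and each repeated index is contracted in this way. -/
def ctr (f : Fin 4 → A) : A := ∑ μ, mink μ • f μ

/-- Contraction of two pairs of indices. -/
def ctr2 (f : Fin 4 → Fin 4 → A) : A := ctr fun μ => ctr fun ν => f μ ν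

/-- Contraction of three pairs of indices. -/
def ctr3 (f : Fin 4 → Fin 4 → Fin 4 → A) : A := ctr fun μ => ctr2 fun ν ρ => f μ ν ρ

/-- Contraction of four pairs of indices. -/
def ctr4 (f : Fin 4 → Fin 4 → Fin 4 → Fin 4 → A) : A := ctr fun μ => ctr3 fun ν ρ σ => f μ ν ρ σ

end Contraction

/-! ### The algebra of Wick polynomials -/

/-- The components of the basic free fields: the graviton field `h_{μν}`, the Fermi ghosts
`u_μ` and `ũ_μ` (here `ut`), and the Bose ghost `v_μ`. -/
inductive Field : Type
  | h (μ ν : Fin 4)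
  | u (μ : Fin 4)
  | ut (μ : Fin 4)
  | v (μ : Fin 4)

/-- The Fermi fields are `u` and `ũ`. -/
def Field.IsFermi : Field → Prop
  | .h _ _ => False
  | .u _ => True
  | .ut _ => True
  | .v _ => False

/-- The ghost number of a field: `1` for `u`, `-1` for `ũ`, and `0` for the Bose fields. -/
def Field.gh : Field → ℤ
  | .h _ _ => 0
  | .u _ => 1
  | .ut _ => -1
  | .v _ => 0

/-- `(f, {μ₁, …, μₖ})` stands for the derivative `∂_{μ₁} ⋯ ∂_{μₖ} f` of the field component `f`. -/
abbrev Jet : Type := Field × Multiset (Fin 4)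

/-- The relations between derivatives of the free fields of mass `m` inside Wick products:
`h_{μν}` is symmetric, each field obeys the Klein-Gordon equation `∂^μ ∂_μ f + m² f = 0`, and
factors in a Wick product commute, except that two Fermi factors anticommute. -/
inductive WickRel (m : ℝ) : FreeAlgebra ℂ Jet → FreeAlgebra ℂ Jet → Prop
  | symm (μ ν : Fin 4) (α : Multiset (Fin 4)) :
      WickRel m (FreeAlgebra.ι ℂ (Field.h μ ν, α)) (FreeAlgebra.ι ℂ (Field.h ν μ, α))
  | kleinGordon (f : Field) (α : Multiset (Fin 4)) :
      WickRel m
        (∑ μ, (mink μ : ℂ) • FreeAlgebra.ι ℂ (f, μ ::ₘ μ ::ₘ α)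
          + ((m : ℂ) ^ 2) • FreeAlgebra.ι ℂ (f, α)) 0
  | comm (a b : Jet) (hab : ¬ (a.1.IsFermi ∧ b.1.IsFermi)) :
      WickRel m (FreeAlgebra.ι ℂ a * FreeAlgebra.ι ℂ b) (FreeAlgebra.ι ℂ b * FreeAlgebra.ι ℂ a)
  | anticomm (a b : Jet) (ha : a.1.IsFermi) (hb : b.1.IsFermi) :
      WickRel m (FreeAlgebra.ι ℂ a * FreeAlgebra.ι ℂ b)
        (-(FreeAlgebra.ι ℂ b * FreeAlgebra.ι ℂ a))

/-- The algebra of Wick polynomials in the free fields `h, u, ũ, v` of mass `m` and their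
derivatives (at a generic point of Minkowski space), with the Wick product as multiplication:
the free graded-commutative algebra on the derivatives of the fields, modulo the Klein-Gordon
equation. -/
def Wick (m : ℝ) : Type := RingQuot (WickRel m)

instance (m : ℝ) : Ring (Wick m) := inferInstanceAs (Ring (RingQuot (WickRel m)))

instance (m : ℝ) : Algebra ℂ (Wick m) := inferInstanceAs (Algebra ℂ (RingQuot (WickRel m)))

/-- The quotient map onto the Wick algebra. -/
def Wick.mk (m : ℝ) : FreeAlgebra ℂ Jet →ₐ[ℂ] Wick m := RingQuot.mkAlgHom ℂ (WickRel m)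

theorem Wick.mk_rel {m : ℝ} {x y : FreeAlgebra ℂ Jet} (h : WickRel m x y) :
    Wick.mk m x = Wick.mk m y :=
  RingQuot.mkAlgHom_rel ℂ h

/-- The algebra homomorphism on the Wick algebra with given values on the derivatives of the fields,
provided these values satisfy the relations. -/
def Wick.lift (m : ℝ) {B : Type} [Ring B] [Algebra ℂ B] (F : Jet → B)
    (hF : ∀ ⦃x y⦄, WickRel m x y → FreeAlgebra.lift ℂ F x = FreeAlgebra.lift ℂ F y) :
    Wick m →ₐ[ℂ] B :=
  RingQuot.liftAlgHom ℂ ⟨FreeAlgebra.lift ℂ F, hF⟩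

/-- The derivative `∂_{α} f` of a field component, as an element of the Wick algebra. -/
def jet (m : ℝ) (f : Field) (α : Multiset (Fin 4)) : Wick m :=
  Wick.mk m (FreeAlgebra.ι ℂ (f, α))

section Relations

variable {m : ℝ}

theorem jet_symm (μ ν : Fin 4) (α : Multiset (Fin 4)) :
    jet m (.h μ ν) α = jet m (.h ν μ) α :=
  Wick.mk_rel (WickRel.symm μ ν α)

theorem jet_kleinGordon (f : Field) (α : Multiset (Fin 4)) :
    ∑ μ, (mink μ : ℂ) • jet m f (μ ::ₘ μ ::ₘ α) + ((m : ℂ) ^ 2) • jet m f α = 0 := by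
  have h := Wick.mk_rel (WickRel.kleinGordon (m := m) f α)
  simp only [map_add, map_sum, map_smul, map_zero] at h
  exact h

theorem jet_comm (a b : Jet) (hab : ¬ (a.1.IsFermi ∧ b.1.IsFermi)) :
    jet m a.1 a.2 * jet m b.1 b.2 = jet m b.1 b.2 * jet m a.1 a.2 := by
  have h := Wick.mk_rel (WickRel.comm (m := m) a b hab)
  simp only [map_mul] at h
  exact h

theorem jet_anticomm (a b : Jet) (ha : a.1.IsFermi) (hb : b.1.IsFermi) :
    jet m a.1 a.2 * jet m b.1 b.2 = -(jet m b.1 b.2 * jet m a.1 a.2) := by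
  have h := Wick.mk_rel (WickRel.anticomm (m := m) a b ha hb)
  simp only [map_mul, map_neg] at h
  exact h

end Relations

/-! #### The derivations `∂_μ`

A derivation `D` is encoded by the algebra homomorphism `w ↦ (w, D w; 0, w)` into upper triangular
matrices. -/

/-- The homomorphism `w ↦ (w, ∂_μ w; 0, w)`, determined by `∂_μ (∂_α f) = ∂_μ ∂_α f`. -/
def partialHom (m : ℝ) (μ : Fin 4) : Wick m →ₐ[ℂ] Matrix (Fin 2) (Fin 2) (Wick m) :=
  Wick.lift m (fun a : Jet =>
      !![jet m a.1 a.2, jet m a.1 (μ ::ₘ a.2); 0, jet m a.1 a.2]) <| by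
    intro x y hxy
    induction hxy with
    | symm ρ σ α => simp [jet_symm ρ σ]
    | kleinGordon f α =>
      have h1 := jet_kleinGordon (m := m) f α
      have h2 := jet_kleinGordon (m := m) f (μ ::ₘ α)
      have h3 : ∀ ρ : Fin 4, μ ::ₘ ρ ::ₘ ρ ::ₘ α = ρ ::ₘ ρ ::ₘ μ ::ₘ α := fun ρ => by
        rw [Multiset.cons_swap μ ρ, Multiset.cons_swap μ ρ]
      simp only [map_add, map_sum, map_smul, map_zero, FreeAlgebra.lift_ι_apply]
      ext i j
      fin_cases i <;> fin_cases j
      · simpa [Matrix.sum_apply] using h1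
      · simpa [Matrix.sum_apply, h3] using h2
      · simp [Matrix.sum_apply]
      · simpa [Matrix.sum_apply] using h1
    | comm a b hab =>
      have h1 := jet_comm (m := m) a b hab
      have h2 := jet_comm (m := m) (a.1, μ ::ₘ a.2) b hab
      have h3 := jet_comm (m := m) a (b.1, μ ::ₘ b.2) hab
      simp only at h2 h3
      simp [h1, h2, h3, add_comm]
    | anticomm a b ha hb =>
      have h1 := jet_anticomm (m := m) a b ha hb
      have h2 := jet_anticomm (m := m) (a.1, μ ::ₘ a.2) b ha hb
      have h3 := jet_anticomm (m := m) a (b.1, μ ::ₘ b.2) ha hb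
      simp only at h2 h3
      simp [h1, h2, h3, add_comm]

/-- The derivation `∂_μ` of the algebra of Wick polynomials. -/
def pd (m : ℝ) (μ : Fin 4) : Wick m →ₗ[ℂ] Wick m :=
  (Matrix.entryLinearMap ℂ (Wick m) 0 1).comp (partialHom m μ).toLinearMap

/-! #### The gauge variation `d_Q`

The gauge variation is a graded derivation, `d_Q (M N) = (d_Q M) N + (-1)^{gh M} M (d_Q N)`; it is
encoded by the algebra homomorphism `w ↦ ((-1)^{gh w} w, d_Q w; 0, w)`. -/

/-- The sign `(-1)^{gh f}`. -/
def Field.sign (f : Field) : ℂ := (Int.negOnePow f.gh : ℤˣ)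

/-- The gauge variation of the derivative `∂_α f` of a basic field:
`d_Q h_{μν} = -(i/2) (∂_μ u_ν + ∂_ν u_μ - η_{μν} ∂^ρ u_ρ)`, `d_Q u_μ = 0`,
`d_Q ũ_μ = i (∂^ν h_{μν} + m v_μ)`, `d_Q v_μ = -(i m/2) u_μ`, all differentiated by `∂_α`. -/
def dQJet (m : ℝ) : Field → Multiset (Fin 4) → Wick m
  | .h μ ν, α => (-(Complex.I / 2)) • (jet m (.u ν) (μ ::ₘ α) + jet m (.u μ) (ν ::ₘ α)
      - eta μ ν • ctr fun ρ => jet m (.u ρ) (ρ ::ₘ α))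
  | .u _, _ => 0
  | .ut μ, α => Complex.I • ((ctr fun ν => jet m (.h μ ν) (ν ::ₘ α)) + m • jet m (.v μ) α)
  | .v μ, α => (-(Complex.I / 2)) • m • jet m (.u μ) α

section GaugeVariation

variable {m : ℝ}

/-- The linear combinations of (derivatives of) Fermi, respectively Bose, fields. -/
def linearFields (m : ℝ) (P : Field → Prop) : Submodule ℂ (Wick m) :=
  Submodule.span ℂ {w | ∃ f α, P f ∧ w = jet m f α}

theorem jet_mem {P : Field → Prop} {f : Field} (hf : P f) (α : Multiset (Fin 4)) :
    jet m f α ∈ linearFields m P :=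
  Submodule.subset_span ⟨f, α, hf, rfl⟩

theorem real_smul_mem {P : Field → Prop} {w : Wick m} (c : ℝ) (hw : w ∈ linearFields m P) :
    c • w ∈ linearFields m P := by
  rw [← algebraMap_smul ℂ c w]
  exact Submodule.smul_mem _ _ hw

theorem ctr_mem {P : Field → Prop} {w : Fin 4 → Wick m} (hw : ∀ μ, w μ ∈ linearFields m P) :
    ctr w ∈ linearFields m P :=
  Submodule.sum_mem _ fun μ _ => real_smul_mem _ (hw μ)

theorem dQJet_mem_bose {f : Field} (hf : f.IsFermi) (α : Multiset (Fin 4)) :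
    dQJet m f α ∈ linearFields m fun g => ¬ g.IsFermi := by
  cases f with
  | h μ ν => exact hf.elim
  | u μ => exact Submodule.zero_mem _
  | ut μ =>
    exact Submodule.smul_mem _ _ (Submodule.add_mem _
      (ctr_mem fun ν => jet_mem (by simp [Field.IsFermi]) _)
      (real_smul_mem _ (jet_mem (by simp [Field.IsFermi]) _)))
  | v μ => exact hf.elim

theorem dQJet_mem_fermi {f : Field} (hf : ¬ f.IsFermi) (α : Multiset (Fin 4)) :
    dQJet m f α ∈ linearFields m Field.IsFermi := by
  have hu : ∀ ρ β, jet m (.u ρ) β ∈ linearFields m Field.IsFermi := fun ρ β =>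
    jet_mem (f := .u ρ) (by simp [Field.IsFermi]) β
  cases f with
  | h μ ν =>
    exact Submodule.smul_mem _ _ (Submodule.sub_mem _ (Submodule.add_mem _ (hu _ _) (hu _ _))
      (real_smul_mem _ (ctr_mem fun ρ => hu _ _)))
  | u μ => exact (hf trivial).elim
  | ut μ => exact (hf trivial).elim
  | v μ => exact Submodule.smul_mem _ _ (real_smul_mem _ (hu _ _))

theorem bose_comm {w : Wick m} (hw : w ∈ linearFields m fun g => ¬ g.IsFermi) (b : Jet) :
    w * jet m b.1 b.2 = jet m b.1 b.2 * w := by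
  induction hw using Submodule.span_induction with
  | mem x hx =>
    obtain ⟨f, α, hf, rfl⟩ := hx
    exact jet_comm (f, α) b fun h => hf h.1
  | zero => simp
  | add x y _ _ hx hy => rw [add_mul, mul_add, hx, hy]
  | smul c x _ hx => rw [smul_mul_assoc, mul_smul_comm, hx]

theorem comm_bose {w : Wick m} (hw : w ∈ linearFields m Field.IsFermi) (b : Jet)
    (hb : ¬ b.1.IsFermi) : w * jet m b.1 b.2 = jet m b.1 b.2 * w := by
  induction hw using Submodule.span_induction with
  | mem x hx =>
    obtain ⟨f, α, hf, rfl⟩ := hx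
    exact jet_comm (f, α) b fun h => hb h.2
  | zero => simp
  | add x y _ _ hx hy => rw [add_mul, mul_add, hx, hy]
  | smul c x _ hx => rw [smul_mul_assoc, mul_smul_comm, hx]

theorem fermi_anticomm {w : Wick m} (hw : w ∈ linearFields m Field.IsFermi) (b : Jet)
    (hb : b.1.IsFermi) : w * jet m b.1 b.2 = -(jet m b.1 b.2 * w) := by
  induction hw using Submodule.span_induction with
  | mem x hx =>
    obtain ⟨f, α, hf, rfl⟩ := hx
    exact jet_anticomm (f, α) b hf hb
  | zero => simp
  | add x y _ _ hx hy => rw [add_mul, mul_add, hx, hy, neg_add]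
  | smul c x _ hx => rw [smul_mul_assoc, mul_smul_comm, hx, smul_neg]

theorem sign_fermi {f : Field} (hf : f.IsFermi) : f.sign = -1 := by
  cases f <;> simp_all [Field.IsFermi, Field.sign, Field.gh]

theorem sign_bose {f : Field} (hf : ¬ f.IsFermi) : f.sign = 1 := by
  cases f <;> simp_all [Field.IsFermi, Field.sign, Field.gh]

theorem jet_kleinGordon_ctr (f : Field) (α : Multiset (Fin 4)) :
    (ctr fun μ => jet m f (μ ::ₘ μ ::ₘ α)) = -(m ^ 2 • jet m f α) := by
  have h := jet_kleinGordon (m := m) f α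
  rw [eq_neg_iff_add_eq_zero, ← h, ctr]
  congr 1
  rw [← algebraMap_smul ℂ (m ^ 2) (jet m f α)]
  simp

theorem ctr_ctr_comm (w : Fin 4 → Fin 4 → Wick m) :
    (ctr fun μ => ctr fun ν => w μ ν) = ctr fun ν => ctr fun μ => w μ ν := by
  simp only [ctr, Finset.smul_sum]
  rw [Finset.sum_comm]
  exact Finset.sum_congr rfl fun ν _ => Finset.sum_congr rfl fun μ _ => smul_comm _ _ _

theorem dQJet_kleinGordon (f : Field) (α : Multiset (Fin 4)) :
    (ctr fun μ => dQJet m f (μ ::ₘ μ ::ₘ α)) = -(m ^ 2 • dQJet m f α) := by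
  have hk : ∀ (f : Field) (ρ : Fin 4), (ctr fun μ => jet m f (ρ ::ₘ μ ::ₘ μ ::ₘ α)) =
      -(m ^ 2 • jet m f (ρ ::ₘ α)) := fun f ρ => by
    rw [← jet_kleinGordon_ctr]
    congr 1
    funext μ
    rw [Multiset.cons_swap ρ μ, Multiset.cons_swap ρ μ]
  have hadd : ∀ w z : Fin 4 → Wick m, (ctr fun μ => w μ + z μ) = ctr w + ctr z := fun w z => by
    simp [ctr, Finset.sum_add_distrib]
  have hsub : ∀ w z : Fin 4 → Wick m, (ctr fun μ => w μ - z μ) = ctr w - ctr z := fun w z => by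
    simp [ctr, Finset.sum_sub_distrib, smul_sub]
  have hC : ∀ (c : ℂ) (w : Fin 4 → Wick m), (ctr fun μ => c • w μ) = c • ctr w := fun c w => by
    simp only [ctr, Finset.smul_sum, smul_comm c]
  have hR : ∀ (c : ℝ) (w : Fin 4 → Wick m), (ctr fun μ => c • w μ) = c • ctr w := fun c w => by
    simp only [ctr, Finset.smul_sum, smul_comm c]
  have hneg : ∀ w : Fin 4 → Wick m, (ctr fun μ => -w μ) = -ctr w := fun w => by
    simp [ctr]
  have hz : (ctr fun _ : Fin 4 => (0 : Wick m)) = 0 := by simp [ctr]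
  cases f with
  | h μ ν =>
    simp only [dQJet, hC, hadd, hsub, hR]
    rw [ctr_ctr_comm]
    simp only [hk, hneg, hR]
    simp only [smul_sub, smul_add, smul_neg, smul_comm (m ^ 2)]
    abel
  | u μ => simp [dQJet, hz]
  | ut μ =>
    simp only [dQJet, hC, hadd, hR]
    rw [ctr_ctr_comm]
    simp only [hk, jet_kleinGordon_ctr, hneg, hR]
    simp only [smul_add, smul_neg, smul_comm (m ^ 2)]
    abel
  | v μ =>
    simp only [dQJet, hC, hR, jet_kleinGordon_ctr]
    simp only [smul_neg, smul_comm (m ^ 2)]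

end GaugeVariation

/-- The homomorphism `w ↦ ((-1)^{gh w} w, d_Q w; 0, w)`, determined by the values of `d_Q` on the
derivatives of the basic fields. -/
def dQHom (m : ℝ) : Wick m →ₐ[ℂ] Matrix (Fin 2) (Fin 2) (Wick m) :=
  Wick.lift m (fun a : Jet =>
      !![a.1.sign • jet m a.1 a.2, dQJet m a.1 a.2; 0, jet m a.1 a.2]) <| by
    intro x y hxy
    induction hxy with
    | symm ρ σ α =>
      have h1 : (Field.h ρ σ).sign = (Field.h σ ρ).sign := rfl
      have h2 : dQJet m (.h ρ σ) α = dQJet m (.h σ ρ) α := by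
        have h3 : eta ρ σ = eta σ ρ := by
          rw [eta, ← Matrix.transpose_apply (Matrix.diagonal mink), Matrix.diagonal_transpose]
        simp only [dQJet, h3, add_comm]
      simp [jet_symm ρ σ, h1, h2]
    | kleinGordon f α =>
      have h1 := jet_kleinGordon (m := m) f α
      have h2 := dQJet_kleinGordon (m := m) f α
      rw [eq_neg_iff_add_eq_zero, ctr, ← algebraMap_smul ℂ (m ^ 2) (dQJet m f α)] at h2
      simp only [map_add, map_sum, map_smul, map_zero, FreeAlgebra.lift_ι_apply]
      ext i j
      fin_cases i <;> fin_cases j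
      · have h3 := congrArg (fun w => f.sign • w) h1
        simp only [smul_add, Finset.smul_sum, smul_zero] at h3
        simpa [Matrix.sum_apply, smul_comm f.sign] using h3
      · simpa [Matrix.sum_apply] using h2
      · simp [Matrix.sum_apply]
      · simpa [Matrix.sum_apply] using h1
    | comm a b hab =>
      have h1 := jet_comm (m := m) a b hab
      simp only [map_mul, FreeAlgebra.lift_ι_apply, Matrix.mul_fin_two]
      by_cases ha : a.1.IsFermi
      · have hb : ¬ b.1.IsFermi := fun hb => hab ⟨ha, hb⟩
        have h2 := bose_comm (dQJet_mem_bose (m := m) ha a.2) b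
        have h3 := fermi_anticomm (dQJet_mem_fermi (m := m) hb b.2) a ha
        simp [sign_fermi ha, sign_bose hb, h1, h2, h3, add_comm]
      · by_cases hb : b.1.IsFermi
        · have h2 := fermi_anticomm (dQJet_mem_fermi (m := m) ha a.2) b hb
          have h3 := bose_comm (dQJet_mem_bose (m := m) hb b.2) a
          simp [sign_fermi hb, sign_bose ha, h1, h2, h3, add_comm]
        · have h2 := comm_bose (dQJet_mem_fermi (m := m) ha a.2) b hb
          have h3 := comm_bose (dQJet_mem_fermi (m := m) hb b.2) a ha
          simp [sign_bose hb, sign_bose ha, h1, h2, h3, add_comm]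
    | anticomm a b ha hb =>
      have h1 := jet_anticomm (m := m) a b ha hb
      have h2 := bose_comm (dQJet_mem_bose (m := m) ha a.2) b
      have h3 := bose_comm (dQJet_mem_bose (m := m) hb b.2) a
      simp [sign_fermi hb, sign_fermi ha, h1, h2, h3, add_comm]

/-- The gauge variation `d_Q` on the algebra of Wick polynomials. -/
def dQ (m : ℝ) : Wick m →ₗ[ℂ] Wick m :=
  (Matrix.entryLinearMap ℂ (Wick m) 0 1).comp (dQHom m).toLinearMap

section Leibniz

variable {m : ℝ}

theorem Wick.lift_jet {B : Type} [Ring B] [Algebra ℂ B] (F : Jet → B)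
    (hF : ∀ ⦃x y⦄, WickRel m x y → FreeAlgebra.lift ℂ F x = FreeAlgebra.lift ℂ F y)
    (f : Field) (α : Multiset (Fin 4)) : Wick.lift m F hF (jet m f α) = F (f, α) := by
  have h : Wick.lift m F hF (jet m f α) = FreeAlgebra.lift ℂ F (FreeAlgebra.ι ℂ (f, α)) :=
    RingQuot.liftAlgHom_mkAlgHom_apply ℂ _ _ _
  rw [h, FreeAlgebra.lift_ι_apply]

/-- Induction over Wick polynomials. -/
theorem Wick.induction {P : Wick m → Prop} (hc : ∀ c : ℂ, P (algebraMap ℂ (Wick m) c))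
    (hj : ∀ f α, P (jet m f α)) (hm : ∀ x y, P x → P y → P (x * y))
    (ha : ∀ x y, P x → P y → P (x + y)) (w : Wick m) : P w := by
  obtain ⟨x, rfl⟩ : ∃ x, Wick.mk m x = w := RingQuot.mkAlgHom_surjective ℂ (WickRel m) w
  induction x using FreeAlgebra.induction with
  | grade0 c => rw [AlgHom.commutes]; exact hc c
  | grade1 a => exact hj a.1 a.2
  | mul a b iha ihb => rw [map_mul]; exact hm _ _ iha ihb
  | add a b iha ihb => rw [map_add]; exact ha _ _ iha ihb

theorem pd_jet (μ : Fin 4) (f : Field) (α : Multiset (Fin 4)) :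
    pd m μ (jet m f α) = jet m f (μ ::ₘ α) := by
  simp [pd, partialHom, Wick.lift_jet]

theorem partialHom_diag (μ : Fin 4) (w : Wick m) :
    partialHom m μ w 0 0 = w ∧ partialHom m μ w 1 0 = 0 ∧ partialHom m μ w 1 1 = w := by
  induction w using Wick.induction with
  | hc c => simp [Matrix.algebraMap_matrix_apply]
  | hj f α => simp [partialHom, Wick.lift_jet]
  | hm x y hx hy => simp [Matrix.mul_apply, hx, hy]
  | ha x y hx hy => simp [hx, hy]

/-- The Leibniz rule for `∂_μ`. -/
theorem pd_mul (μ : Fin 4) (x y : Wick m) : pd m μ (x * y) = pd m μ x * y + x * pd m μ y := by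
  simp [pd, Matrix.mul_apply, partialHom_diag, add_comm]

theorem dQ_jet (f : Field) (α : Multiset (Fin 4)) : dQ m (jet m f α) = dQJet m f α := by
  simp [dQ, dQHom, Wick.lift_jet]

theorem dQHom_diag (w : Wick m) : dQHom m w 1 0 = 0 ∧ dQHom m w 1 1 = w := by
  induction w using Wick.induction with
  | hc c => simp [Matrix.algebraMap_matrix_apply]
  | hj f α => simp [dQHom, Wick.lift_jet]
  | hm x y hx hy => simp [Matrix.mul_apply, hx, hy]
  | ha x y hx hy => simp [hx, hy]

/-- The graded Leibniz rule for `d_Q`, for a single field factor on the left. -/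
theorem dQ_jet_mul (f : Field) (α : Multiset (Fin 4)) (y : Wick m) :
    dQ m (jet m f α * y) = dQJet m f α * y + f.sign • (jet m f α * dQ m y) := by
  have h : dQHom m (jet m f α) 0 0 = f.sign • jet m f α := by simp [dQHom, Wick.lift_jet]
  have h' : dQHom m (jet m f α) 0 1 = dQJet m f α := by simp [dQHom, Wick.lift_jet]
  simp [dQ, Matrix.mul_apply, dQHom_diag, h, h', add_comm]

end Leibniz

/-! #### Trivial couplings -/

/-- The Wick polynomials of ghost number `k`: the linear span of the Wick monomials in which the
number of factors `u` minus the number of factors `ũ` is `k`. -/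
def ghostNumber (m : ℝ) (k : ℤ) : Submodule ℂ (Wick m) :=
  Submodule.span ℂ {w | ∃ l : List Jet, (l.map fun a => a.1.gh).sum = k ∧
    w = (l.map fun a => jet m a.1 a.2).prod}

/-- A trivial coupling is a Wick polynomial `d_Q B + ∂_μ B^μ` with `B` of ghost number `-1` and
`B^μ` of ghost number `0`. -/
def IsTrivialCoupling (m : ℝ) (T : Wick m) : Prop :=
  ∃ B ∈ ghostNumber m (-1), ∃ B' : Fin 4 → Wick m, (∀ μ, B' μ ∈ ghostNumber m 0) ∧
    T = dQ m B + ∑ μ, pd m μ (B' μ)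

/-- Two couplings are equivalent if their difference is a trivial coupling. -/
def EquivalentCouplings (m : ℝ) (S T : Wick m) : Prop := IsTrivialCoupling m (S - T)

/-! ### The couplings

The expressions are written for arbitrary elements of a real algebra `A` with operations `∂_μ`, so
that they can be evaluated both on Wick polynomials and on classical fields. -/

section Couplings

variable {A : Type*} [Ring A] [Algebra ℝ A]

/-- The coupling `T^{(a)}` in terms of a tensor `H_{μν}`, a scalar `Φ` and the ghosts `u, ũ, v`. -/
def couplingHΦ (m : ℝ) (D : Fin 4 → A → A) (H : Fin 4 → Fin 4 → A) (Φ : A)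
    (u ut v : Fin 4 → A) : A :=
  - (2 : ℝ) • (ctr4 fun μ ν ρ σ => H μ ν * D μ (H ρ σ) * D ν (H ρ σ))
  - (4 : ℝ) • (ctr4 fun μ ν ρ α => H μ ν * D α (H ρ μ) * D ρ (H α ν))
  + (2 : ℝ) • (ctr3 fun μ ρ σ => Φ * D μ (H ρ σ) * D ρ (H μ σ))
  + (4 : ℝ) • (ctr3 fun ρ σ ν => Φ * H ρ σ * D ρ (D ν (H ν σ)))
  + (ctr2 fun μ ν => Φ ^ 2 * D μ (D ν (H μ ν)))
  + (ctr2 fun μ ν => D μ Φ * D ν Φ * H μ ν)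
  + (4 : ℝ) • (ctr3 fun μ ν ρ => H μ ν * u ρ * D μ (D ν (ut ρ)))
  + (4 : ℝ) • (ctr3 fun μ ν ρ => D μ (H μ ν) * u ρ * D ν (ut ρ))
  + (4 : ℝ) • (ctr3 fun μ ν ρ => D μ (H μ ν) * u ρ * D ρ (ut ν))
  + (2 : ℝ) • (ctr2 fun μ ρ => D μ Φ * u ρ * D ρ (ut μ))
  + (4 : ℝ) • (ctr3 fun μ ν ρ => H μ ν * D μ (v ρ) * D ν (v ρ))
  - (4 * m) • (ctr2 fun μ ν => D μ (v ν) * u μ * ut ν)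
  + m ^ 2 •
    ((2 / 3 : ℝ) • (ctr3 fun μ ν ρ => H μ ν * H μ ρ * H ν ρ)
      + (1 / 2 : ℝ) • (ctr2 fun μ ν => H μ ν * H μ ν * Φ)
      - (3 / 4 : ℝ) • Φ ^ 3
      - (ctr fun μ => Φ * u μ * ut μ)
      + (ctr fun μ => Φ * v μ * v μ))

/-- The trace `h = h^μ_μ`. -/
def tr (h : Fin 4 → Fin 4 → A) : A := ctr fun μ => h μ μ

/-- The coupling `T` in terms of `h_{μν}` and the ghosts `u, ũ, v`. -/
def coupling (m : ℝ) (D : Fin 4 → A → A) (h : Fin 4 → Fin 4 → A) (u ut v : Fin 4 → A) : A :=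
  (ctr2 fun μ ν => h μ ν * D μ (tr h) * D ν (tr h))
  - (2 : ℝ) • (ctr4 fun μ ν ρ σ => h μ ν * D μ (h ρ σ) * D ν (h ρ σ))
  - (4 : ℝ) • (ctr4 fun μ ν ρ σ => h μ ν * D ρ (h μ σ) * D σ (h ν ρ))
  - (2 : ℝ) • (ctr3 fun μ ν ρ => h μ ν * D ρ (h μ ν) * D ρ (tr h))
  + (4 : ℝ) • (ctr4 fun μ ν ρ σ => h μ ν * D σ (h μ ρ) * D σ (h ν ρ))
  + (4 : ℝ) • (ctr3 fun μ ν ρ => D μ (h μ ν) * u ρ * D ρ (ut ν))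
  - (4 : ℝ) • (ctr3 fun μ ν ρ => h μ ν * D μ (u ρ) * D ν (ut ρ))
  + (4 : ℝ) • (ctr3 fun μ ν ρ => h μ ν * D μ (v ρ) * D ν (v ρ))
  - (4 * m) • (ctr2 fun μ ν => D μ (v ν) * u μ * ut ν)
  + m ^ 2 •
    (- (4 / 3 : ℝ) • (ctr3 fun μ ν ρ => h μ ν * h μ ρ * h ν ρ)
      + (ctr2 fun μ ν => h μ ν * h μ ν * tr h)
      - (1 / 6 : ℝ) • tr h ^ 3)

/-- The current `T^{(a)}_μ` (lower index). -/
def current (m : ℝ) (D : Fin 4 → A → A) (h : Fin 4 → Fin 4 → A) (u ut v : Fin 4 → A)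
    (μ : Fin 4) : A :=
  (ctr fun ν => u ν *
    (- (D μ (tr h) * D ν (tr h))
      + (2 : ℝ) • (ctr2 fun ρ σ => D μ (h ρ σ) * D ν (h ρ σ))
      - (4 : ℝ) • (ctr2 fun ρ σ => D ρ (h ρ σ) * D ν (h μ σ))
      + (4 : ℝ) • (ctr2 fun ρ σ => D ν (h ρ σ) * D ρ (h μ σ))
      - (4 : ℝ) • (ctr fun ρ => D μ (v ρ) * D ν (v ρ))))
  + u μ *
    ((1 / 2 : ℝ) • (ctr fun ν => D ν (tr h) * D ν (tr h))
      - (ctr3 fun ν ρ σ => D ν (h ρ σ) * D ν (h ρ σ))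
      - (2 : ℝ) • (ctr3 fun ν ρ σ => D ρ (h ν σ) * D σ (h ν ρ))
      + (2 : ℝ) • (ctr2 fun ν ρ => D ν (v ρ) * D ν (v ρ)))
  + (ctr2 fun ρ ν => D ρ (u ν) *
    ((4 : ℝ) • (ctr fun σ => h ρ σ * D σ (h μ ν))
      + (4 : ℝ) • (ctr fun σ => h μ σ * D ν (h σ ρ))
      + (2 : ℝ) • (h ν ρ * D μ (tr h))
      - (4 : ℝ) • (ctr fun σ => h ρ σ * D μ (h σ ν))))
  - (4 : ℝ) • (ctr3 fun ρ ν σ => D ρ (u μ) * h ν σ * D ν (h ρ σ))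
  + (ctr fun ρ => D ρ (u ρ)) *
    (- (tr h * D μ (tr h)) + (2 : ℝ) • (ctr2 fun ν σ => h ν σ * D μ (h ν σ)))
  + (2 : ℝ) •
    ((ctr2 fun ν ρ => u ν * D μ (u ρ) * D ν (ut ρ))
      + (ctr2 fun ν ρ => u ν * D ν (u ρ) * D μ (ut ρ))
      - (ctr2 fun ν ρ => u μ * D ν (u ρ) * D ν (ut ρ)))
  + m ^ 2 • (u μ * ((ctr2 fun ν ρ => h ν ρ * h ν ρ) - (1 / 2 : ℝ) • tr h ^ 2))

end Couplings

/-! #### The quantum fields -/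

/-- The field `h_{μν}`. -/
def hField (m : ℝ) (μ ν : Fin 4) : Wick m := jet m (.h μ ν) 0

/-- The ghost field `u_μ`. -/
def uField (m : ℝ) (μ : Fin 4) : Wick m := jet m (.u μ) 0

/-- The ghost field `ũ_μ`. -/
def utField (m : ℝ) (μ : Fin 4) : Wick m := jet m (.ut μ) 0

/-- The ghost field `v_μ`. -/
def vField (m : ℝ) (μ : Fin 4) : Wick m := jet m (.v μ) 0

/-- The scalar field `Φ`, half the trace of `h_{μν}`. -/
def ΦField (m : ℝ) : Wick m := (1 / 2 : ℝ) • tr (hField m)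

/-- The traceless field `H_{μν} = h_{μν} - ½ η_{μν} Φ`. -/
def HField (m : ℝ) (μ ν : Fin 4) : Wick m := hField m μ ν - (1 / 2 * eta μ ν) • ΦField m

/-- The derivations `∂_μ` as plain functions. -/
def wickD (m : ℝ) (μ : Fin 4) (w : Wick m) : Wick m := pd m μ w

/-! ### The Einstein-Hilbert Lagrangian -/

/-- Coordinates on Minkowski space. -/
abbrev Spacetime : Type := Fin 4 → ℝ

/-- The partial derivative `∂_μ f` of a classical field. -/
def classD (μ : Fin 4) (f : Spacetime → ℝ) : Spacetime → ℝ :=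
  fun x => fderiv ℝ f x (Pi.single μ 1)

/-- The Christoffel symbols `Γ^α_{μν}` of a metric `g_{μν}(x)`. -/
def christoffel (g : Spacetime → Matrix (Fin 4) (Fin 4) ℝ) (α μ ν : Fin 4) : Spacetime → ℝ :=
  fun x => (1 / 2) * ∑ β, (g x)⁻¹ α β *
    (classD μ (fun y => g y β ν) x + classD ν (fun y => g y β μ) x
      - classD β (fun y => g y μ ν) x)

/-- The Ricci tensor
`R_{μν} = ∂_α Γ^α_{μν} - ∂_ν Γ^α_{μα} + Γ^α_{αβ} Γ^β_{μν} - Γ^α_{νβ} Γ^β_{αμ}`. -/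
def ricci (g : Spacetime → Matrix (Fin 4) (Fin 4) ℝ) (μ ν : Fin 4) : Spacetime → ℝ :=
  fun x => ∑ α, (classD α (christoffel g α μ ν) x - classD ν (christoffel g α μ α) x
    + ∑ β, (christoffel g α α β x * christoffel g β μ ν x
      - christoffel g α ν β x * christoffel g β α μ x))

/-- The scalar curvature `R = g^{μν} R_{μν}`. -/
def scalarCurvature (g : Spacetime → Matrix (Fin 4) (Fin 4) ℝ) : Spacetime → ℝ :=
  fun x => ∑ μ, ∑ ν, (g x)⁻¹ μ ν * ricci g μ ν x

/-- The Einstein-Hilbert Lagrangian `-(2/κ²) √(-g) (R - 2Λ)`. -/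
def einsteinHilbert (κ Λ : ℝ) (g : Spacetime → Matrix (Fin 4) (Fin 4) ℝ) : Spacetime → ℝ :=
  fun x => -(2 / κ ^ 2) * √(-(g x).det) * (scalarCurvature g x - 2 * Λ)

/-- The Goldberg variables `√(-g) g^{μν} = η^{μν} + κ h^{μν}`, for a field `h_{μν}` with lower
indices. -/
def goldberg (κ : ℝ) (h : Fin 4 → Fin 4 → Spacetime → ℝ) (x : Spacetime) :
    Matrix (Fin 4) (Fin 4) ℝ :=
  Matrix.of fun μ ν => eta μ ν + κ * (mink μ * mink ν * h μ ν x)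

/-- The metric with given Goldberg variables `G^{μν} = √(-g) g^{μν}`. In four dimensions
`det G = g`, so `g_{μν} = √(-det G) (G⁻¹)_{μν}`. -/
def metricOfGoldberg (G : Spacetime → Matrix (Fin 4) (Fin 4) ℝ) (x : Spacetime) :
    Matrix (Fin 4) (Fin 4) ℝ :=
  √(-(G x).det) • (G x)⁻¹

theorem goldberg_metricOfGoldberg (G : Spacetime → Matrix (Fin 4) (Fin 4) ℝ) (x : Spacetime)
    (hG : (G x).det < 0) :
    √(-(metricOfGoldberg G x).det) • (metricOfGoldberg G x)⁻¹ = G x := by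
  have hs : 0 < √(-(G x).det) := Real.sqrt_pos.2 (by linarith)
  have hsq : √(-(G x).det) ^ 2 = -(G x).det := Real.sq_sqrt (by linarith)
  have hne : (G x).det ≠ 0 := hG.ne
  have hu : IsUnit (G x).det := isUnit_iff_ne_zero.2 hne
  have hdet : (metricOfGoldberg G x).det = (G x).det := by
    rw [metricOfGoldberg, Matrix.det_smul, Matrix.det_nonsing_inv, Ring.inverse_eq_inv']
    have : √(-(G x).det) ^ Fintype.card (Fin 4) = (G x).det ^ 2 := by
      calc √(-(G x).det) ^ Fintype.card (Fin 4) = (√(-(G x).det) ^ 2) ^ 2 := by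
            rw [Fintype.card_fin]; ring
        _ = (G x).det ^ 2 := by rw [hsq, neg_sq]
    rw [this]
    field_simp
  have hinv : (metricOfGoldberg G x)⁻¹ = (√(-(G x).det))⁻¹ • G x := by
    apply Matrix.inv_eq_right_inv
    rw [metricOfGoldberg, Matrix.smul_mul, Matrix.mul_smul, smul_smul, mul_inv_cancel₀ hs.ne',
      one_smul, Matrix.nonsing_inv_mul _ hu]
  rw [hdet, hinv, smul_smul, mul_inv_cancel₀ hs.ne', one_smul]

/-- A polynomial in a classical field `h_{μν}` and its first derivatives `∂_ρ h_{μν}`. -/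
abbrev LocalPolynomial : Type :=
  MvPolynomial ((Fin 4 × Fin 4) ⊕ (Fin 4 × Fin 4 × Fin 4)) ℝ

/-- The value of such a polynomial on a field: the variable `inl (μ, ν)` becomes `h_{μν}` and
`inr (ρ, μ, ν)` becomes `∂_ρ h_{μν}`. -/
def LocalPolynomial.on (B : LocalPolynomial) (h : Fin 4 → Fin 4 → Spacetime → ℝ) :
    Spacetime → ℝ :=
  fun x => MvPolynomial.eval
    (Sum.elim (fun i => h i.1 i.2 x) (fun i => classD i.1 (h i.2.1 i.2.2) x)) B

end MassiveGravity

end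

open MassiveGravity

noncomputable section

namespace MassiveGravity

/-! ### Tensor monomials and their normal form

A tensor monomial is a product of factors `∂_{d} f` whose indices are labels in `ℕ`; the labels
below a bound `k` are contracted. Identities between linear combinations of such monomials are
verified by computing normal forms. -/

/-! Statements (1) and (2) are identities between cubic Wick polynomials that follow from index
gymnastics, graded commutativity, the Leibniz rules and the Klein-Gordon equation. For (2), the
monomials of $d_QT-i\,\partial^\mu T_\mu$ cancel once metrics are contracted, $\partial^2 f$ is
replaced by $-m^2f$ and dummy indices are renamed. For (1), no $d_Q$-exact term is needed: on the
free fields the two couplings differ by the divergence of the explicit vector `differenceTerms`.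
Both cancellations are established by reflection. Monomials become lists of factors with numbered
indices, every rewriting step is shown to preserve the value in the Wick algebra
(`Term.eval_reduce`, `evalSum_eq_zero`), and the kernel evaluates the normal forms
(`vanishes_variation`, `vanishes_difference`).

For (3), let $U=\sqrt{-g}\,g^{-1}$ be the Goldberg matrix, $L=U^{-1}$ and
$\varphi_\mu=\partial_\mu\log\sqrt{-g}=\frac12L_{ab}\partial_\mu U^{ab}$. Then
$\Gamma^\alpha_{\mu\alpha}=\varphi_\mu$ and $U^{\mu\nu}\Gamma^\alpha_{\mu\nu}=-\partial_\nu
U^{\alpha\nu}$, and `sqrt_mul_scalarCurvature` gives $$\sqrt{-g}\,R=-\partial_\alpha\partial_\nu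
U^{\alpha\nu}-\partial_\nu(U^{\mu\nu}\varphi_\mu)+\tfrac12U^{ab}\varphi_a\varphi_b-\tfrac14U^{\mu\nu}L_{ac}L_{bd}\,\partial_\mu
U^{ab}\partial_\nu U^{cd}+\tfrac12L_{\mu\nu}\,\partial_\rho U^{\mu\sigma}\partial_\sigma
U^{\nu\rho}.$$ Now insert $U=\eta+\kappa h$ and $L=\eta-\kappa h+\kappa^2hh-\dots$. Eight times the
$\kappa^3$ coefficient of the last three terms is the part of $T_{\mathrm{grav}}$ with derivatives.
The first divergence is linear in $\kappa$ and drops out; the second yields `boundaryTerm`. Since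
$\sqrt{-g}=\sqrt{-\det U}$, the cosmological term contributes the $\kappa^3$ coefficient of the
square root of a determinant, which is the mass term of $T_{\mathrm{grav}}$. -/

/-- A factor of a tensor monomial: a derivative of a field, of the trace `h^ρ_ρ`, or of the
traceless field `H`, or the Minkowski metric. The arguments are index labels; the list holds the
labels of the derivatives. -/
inductive Factor : Type
  | h (i j : ℕ) (d : List ℕ)
  | u (i : ℕ) (d : List ℕ)
  | ut (i : ℕ) (d : List ℕ)
  | v (i : ℕ) (d : List ℕ)
  | tr (d : List ℕ)
  | traceless (i j : ℕ) (d : List ℕ)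
  | eta (i j : ℕ)
  deriving DecidableEq

namespace Factor

/-- Rename the labels of a factor. -/
def relabel (s : ℕ → ℕ) : Factor → Factor
  | h i j d => h (s i) (s j) (d.map s)
  | u i d => u (s i) (d.map s)
  | ut i d => ut (s i) (d.map s)
  | v i d => v (s i) (d.map s)
  | tr d => tr (d.map s)
  | traceless i j d => traceless (s i) (s j) (d.map s)
  | eta i j => eta (s i) (s j)

/-- All labels of the factor are smaller than `k`. -/
def below (k : ℕ) : Factor → Bool
  | h i j d => Nat.blt i k && (Nat.blt j k && d.all (Nat.blt · k))
  | u i d => Nat.blt i k && d.all (Nat.blt · k)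
  | ut i d => Nat.blt i k && d.all (Nat.blt · k)
  | v i d => Nat.blt i k && d.all (Nat.blt · k)
  | tr d => d.all (Nat.blt · k)
  | traceless i j d => Nat.blt i k && (Nat.blt j k && d.all (Nat.blt · k))
  | eta i j => Nat.blt i k && Nat.blt j k

/-- The Fermi factors. -/
def fermi : Factor → Bool
  | u _ _ => true
  | ut _ _ => true
  | _ => false

/-- The factors that are derivatives of a basic field. -/
def isJet : Factor → Bool
  | h _ _ _ => true
  | u _ _ => true
  | ut _ _ => true
  | v _ _ => true
  | _ => false

/-- The ghost number of a factor. -/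
def gh : Factor → ℤ
  | u _ _ => 1
  | ut _ _ => -1
  | _ => 0

/-- Differentiate a factor with respect to the coordinate with label `l`. -/
def deriv (l : ℕ) : Factor → Factor
  | h i j d => h i j (l :: d)
  | u i d => u i (l :: d)
  | ut i d => ut i (l :: d)
  | v i d => v i (l :: d)
  | tr d => tr (l :: d)
  | traceless i j d => traceless i j (l :: d)
  | eta i j => eta i j

/-- A numerical code of a list of small labels. -/
def listCode : List ℕ → ℕ
  | [] => 1
  | a :: l => a + 8 * listCode l

/-- A numerical code of a factor, used to order the factors of a monomial. -/
def code : Factor → ℕ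
  | h i j d => 0 + 8 * (i + 8 * (j + 8 * listCode d))
  | u i d => 1 + 8 * (i + 8 * listCode d)
  | ut i d => 2 + 8 * (i + 8 * listCode d)
  | v i d => 3 + 8 * (i + 8 * listCode d)
  | tr d => 4 + 8 * listCode d
  | traceless i j d => 5 + 8 * (i + 8 * (j + 8 * listCode d))
  | eta i j => 6 + 8 * (i + 8 * j)

/-- Insert a label into an ordered list of labels. -/
def insertLabel (a : ℕ) : List ℕ → List ℕ
  | [] => [a]
  | b :: l => bif Nat.ble a b then a :: b :: l else b :: insertLabel a l

/-- Order a list of labels. -/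
def sortLabels : List ℕ → List ℕ
  | [] => []
  | a :: l => insertLabel a (sortLabels l)

/-- Order the derivatives, and the two indices of the symmetric tensor `h`. -/
def normalize : Factor → Factor
  | h i j d => bif Nat.ble i j then h i j (sortLabels d) else h j i (sortLabels d)
  | u i d => u i (sortLabels d)
  | ut i d => ut i (sortLabels d)
  | v i d => v i (sortLabels d)
  | f => f

end Factor

/-- The linear combination `c m^p` of the tensor monomial with the given factors, in which the
labels below `k` are contracted. -/
structure Term : Type where
  c : ℚ
  p : ℕ
  k : ℕ
  fs : List Factor

/-- A contribution to the image of a tensor monomial under a substitution: a coefficient `c m^p`, a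
list of factors, and whether these contain one more contracted label. -/
structure Contribution : Type where
  c : ℚ
  p : ℕ
  fresh : Bool
  fs : List Factor

namespace Contribution

/-- Multiply by a factor from the left. -/
def cons (f : Factor) (t : Contribution) : Contribution := ⟨t.c, t.p, t.fresh, f :: t.fs⟩

/-- Multiply by a factor from the left, with the sign `(-1)^{gh f}`. -/
def gradedCons (f : Factor) (t : Contribution) : Contribution :=
  ⟨bif f.fermi then -t.c else t.c, t.p, t.fresh, f :: t.fs⟩

/-- Multiply by factors from the right. -/
def append (l : List Factor) (t : Contribution) : Contribution := ⟨t.c, t.p, t.fresh, t.fs ++ l⟩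

/-- The term obtained by contracting the labels below `k`, and the fresh one if there is one. -/
def toTerm (c : ℚ) (p k : ℕ) (t : Contribution) : Term :=
  ⟨c * t.c, p + t.p, bif t.fresh then k + 1 else k, t.fs⟩

end Contribution

/-- The definition of the trace and of the traceless part of `h`; `k` is a fresh label. -/
def Factor.expand (k : ℕ) : Factor → Option (List Contribution)
  | .tr d => some [⟨1, 0, true, [.h k k d]⟩]
  | .traceless i j d => some [⟨1, 0, false, [.h i j d]⟩, ⟨-1 / 4, 0, true, [.eta i j, .h k k d]⟩]
  | _ => none

/-- Expand the first trace or traceless part in a monomial. -/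
def expandFirst (k : ℕ) : List Factor → List Contribution
  | [] => [⟨1, 0, false, []⟩]
  | f :: fs =>
    match f.expand k with
    | some l => l.map (·.append fs)
    | none => (expandFirst k fs).map (·.cons f)

/-- The gauge variation of a factor, divided by `i / 2`; `k` is a fresh label. -/
def Factor.variation (k : ℕ) : Factor → List Contribution
  | .h i j d => [⟨-1, 0, false, [.u j (i :: d)]⟩, ⟨-1, 0, false, [.u i (j :: d)]⟩,
      ⟨1, 0, true, [.eta i j, .u k (k :: d)]⟩]
  | .ut i d => [⟨2, 0, true, [.h i k (k :: d)]⟩, ⟨2, 1, false, [.v i d]⟩]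
  | .v i d => [⟨-1, 1, false, [.u i d]⟩]
  | _ => []

/-- The gauge variation of a monomial, divided by `i / 2`. -/
def variation (k : ℕ) : List Factor → List Contribution
  | [] => []
  | f :: fs => (f.variation k).map (·.append fs) ++ (variation k fs).map (·.gradedCons f)

/-- The monomials in the derivative of a monomial. -/
def derivs (l : ℕ) : List Factor → List (List Factor)
  | [] => []
  | f :: fs => (f.deriv l :: fs) :: (derivs l fs).map (f :: ·)

/-- Remove the first metric tensor from a monomial. -/
def findEta : List Factor → Option (ℕ × ℕ × List Factor)
  | [] => none
  | .eta i j :: fs => some (i, j, fs)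
  | f :: fs => (findEta fs).map fun r => (r.1, r.2.1, f :: r.2.2)

/-- Remove a repeated entry from a list of labels. -/
def findRepeated : List ℕ → Option (ℕ × List ℕ)
  | [] => none
  | a :: l => bif l.any (Nat.beq a) then some (a, l.erase a) else
      (findRepeated l).map fun r => (r.1, a :: r.2)

/-- Remove a repeated derivative from a factor. -/
def Factor.findBox : Factor → Option (ℕ × Factor)
  | .h i j d => (findRepeated d).map fun r => (r.1, .h i j r.2)
  | .u i d => (findRepeated d).map fun r => (r.1, .u i r.2)
  | .ut i d => (findRepeated d).map fun r => (r.1, .ut i r.2)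
  | .v i d => (findRepeated d).map fun r => (r.1, .v i r.2)
  | _ => none

/-- Remove the first repeated derivative from a monomial. -/
def findBox : List Factor → Option (ℕ × List Factor)
  | [] => none
  | f :: fs =>
    match f.findBox with
    | some r => some (r.1, r.2 :: fs)
    | none => (findBox fs).map fun r => (r.1, f :: r.2)

/-- The transposition of two labels. -/
def transpose (i j n : ℕ) : ℕ := bif Nat.beq n i then j else bif Nat.beq n j then i else n

/-- Replace one label by another. -/
def replace (i j n : ℕ) : ℕ := bif Nat.beq n i then j else n

namespace Term

/-- Expand the first trace or traceless part. -/
def expand (t : Term) : List Term :=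
  bif t.fs.all (·.below t.k) then (expandFirst t.k t.fs).map (·.toTerm t.c t.p t.k) else [t]

/-- The gauge variation divided by `i / 2`. -/
def variation (t : Term) : List Term :=
  (MassiveGravity.variation t.k t.fs).map (·.toTerm t.c t.p t.k)

/-- The divergence of a term with the free label `k`. -/
def divergence (t : Term) : List Term :=
  (derivs t.k t.fs).map fun fs => ⟨t.c, t.p, t.k + 1, fs⟩

/-- Contract the first metric tensor. -/
def contractEta (t : Term) : Term :=
  match t.k, findEta t.fs with
  | k + 1, some (i, j, fs) =>
    -- Exchanging the labels `j` and `k` makes the last label the second index of the metric, so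
    -- that contracting it lowers the number of labels by one. Whenever a guard fails the term is
    -- returned unchanged; the value is therefore preserved without any hypothesis on the term.
    let fs' := fs.map (·.relabel (transpose j k))
    bif Nat.ble j k then
      bif Nat.beq i j then
        bif fs'.all (·.below k) then ⟨4 * t.c, t.p, k, fs'⟩ else t
      else bif Nat.blt (transpose j k i) k then
        ⟨t.c, t.p, k, fs'.map (·.relabel (replace k (transpose j k i)))⟩
      else t
    else t
  | _, _ => t

/-- Apply the Klein-Gordon equation to the first repeated derivative. -/
def kleinGordon (t : Term) : Term :=
  match t.k, findBox t.fs with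
  | k + 1, some (i, _) =>
    bif Nat.ble i k then
      -- The repeated label is moved to the last position, so that removing the pair of derivatives
      -- leaves a monomial in the labels below `k`.
      match findBox (t.fs.map (·.relabel (transpose i k))) with
      | some (j, fs) =>
        bif Nat.beq j k && fs.all (·.below k) then ⟨-t.c, t.p + 2, k, fs⟩ else t
      | none => t
    else t
  | _, _ => t

end Term

/-! ### Sorting of factors and canonical representatives -/

/-- Insert a factor into an ordered list of factors; the first component tells whether the sign
changes. -/
def insertFactor (f : Factor) : List Factor → Bool × List Factor
  | [] => (false, [f])
  | g :: l => bif Nat.ble f.code g.code then (false, f :: g :: l) else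
      let r := insertFactor f l
      (xor (f.fermi && g.fermi) r.1, g :: r.2)

/-- Order a list of factors. -/
def sortFactors : List Factor → Bool × List Factor
  | [] => (false, [])
  | f :: l =>
    let r := sortFactors l
    let r' := insertFactor f.normalize r.2
    (xor r.1 r'.1, r'.2)

/-- The images of a monomial under the permutations of the labels below `n`. -/
def relabelings : ℕ → List Factor → List (List Factor)
  | 0, fs => [fs]
  | n + 1, fs => (List.range (n + 1)).flatMap fun j =>
      relabelings n (fs.map (·.relabel (transpose j n)))

/-- A numerical code of a monomial. -/
def monomialCode : List Factor → ℕ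
  | [] => 1
  -- The base is $2^{20}$. Collisions of codes are harmless: codes only guide the search, and
  -- `smallest` and `addTerm` compare the monomials themselves before cancelling or merging
  -- anything.
  | f :: l => f.code + 1048576 * monomialCode l

/-- The element of smallest code of a list of monomials with signs; the second component tells
whether it occurs with both signs. -/
def smallest (a : Bool × List Factor) (n : ℕ) (z : Bool) :
    List (Bool × List Factor) → (Bool × List Factor) × Bool
  | [] => (a, z)
  | b :: l =>
    let n' := monomialCode b.2
    bif Nat.blt n' n then smallest b n' false l
    else bif Nat.beq n' n && xor a.1 b.1 then
      smallest a n (z || decide (a.2 = b.2)) l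
    else smallest a n z l

namespace Term

/-- The normal form of a term under renaming contracted labels and permuting the factors. -/
def canonical (t : Term) : Term :=
  match (relabelings t.k t.fs).map sortFactors with
  | [] => t
  | a :: l =>
    let r := smallest a (monomialCode a.2) false l
    ⟨bif r.2 then 0 else bif r.1.1 then -t.c else t.c, t.p, t.k, r.1.2⟩

end Term

/-- Add a term to a linear combination, merging it with an equal monomial. -/
def addTerm (t : Term) : List Term → List Term
  | [] => [t]
  | s :: l =>
    bif Nat.beq s.p t.p && (Nat.beq s.k t.k && Nat.beq (monomialCode s.fs) (monomialCode t.fs)) then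
      if s.p = t.p ∧ s.k = t.k ∧ s.fs = t.fs then ⟨s.c + t.c, s.p, s.k, s.fs⟩ :: l
      else s :: addTerm t l
    else s :: addTerm t l

/-- The normal form of a linear combination of terms. -/
def collect : List Term → List Term
  | [] => []
  | t :: l => addTerm t (collect l)

/-- Repeated expansion of traces and traceless parts. -/
def expandAll : ℕ → List Term → List Term
  | 0, l => l
  | n + 1, l => expandAll n (l.flatMap Term.expand)

/-- Contract metric tensors, apply the Klein-Gordon equation, and bring the result to normal
form. -/
def Term.reduce (t : Term) : Term :=
  -- Three contractions suffice because a cubic monomial contains at most three traceless factors,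
  -- each bringing one metric. One use of the Klein-Gordon equation suffices because at most three
  -- derivatives occur, so at most one factor carries a repeated pair.
  (t.contractEta.contractEta.contractEta.kleinGordon).canonical

/-- A sufficient condition for a linear combination of terms without traces to vanish. -/
def vanishes (l : List Term) : Bool :=
  (collect (l.map Term.reduce)).all fun t => decide (t.c = 0)

/-- Multiply a linear combination of terms by a number. -/
def scale (a : ℚ) (l : List Term) : List Term := l.map fun t => ⟨a * t.c, t.p, t.k, t.fs⟩

/-! ### The couplings, the current and the connecting vector as lists of monomials -/

/-- The terms of `couplingHΦ`. -/
def couplingHΦTerms : List Term :=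
   [⟨-2, 0, 4, [.traceless 3 2 [], .traceless 1 0 [3], .traceless 1 0 [2]]⟩,
    ⟨-4, 0, 4, [.traceless 3 2 [], .traceless 1 3 [0], .traceless 0 2 [1]]⟩,
    ⟨1, 0, 3, [.tr [], .traceless 1 0 [2], .traceless 2 0 [1]]⟩,
    ⟨2, 0, 3, [.tr [], .traceless 2 1 [], .traceless 0 1 [2, 0]]⟩,
    ⟨1 / 4, 0, 2, [.tr [], .tr [], .traceless 1 0 [1, 0]]⟩,
    ⟨1 / 4, 0, 2, [.tr [1], .tr [0], .traceless 1 0 []]⟩,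
    ⟨4, 0, 3, [.traceless 2 1 [], .u 0 [], .ut 0 [2, 1]]⟩,
    ⟨4, 0, 3, [.traceless 2 1 [2], .u 0 [], .ut 0 [1]]⟩,
    ⟨4, 0, 3, [.traceless 2 1 [2], .u 0 [], .ut 1 [0]]⟩,
    ⟨1, 0, 2, [.tr [1], .u 0 [], .ut 1 [0]]⟩,
    ⟨4, 0, 3, [.traceless 2 1 [], .v 0 [2], .v 0 [1]]⟩,
    ⟨-4, 1, 2, [.v 0 [1], .u 1 [], .ut 0 []]⟩,
    ⟨2 / 3, 2, 3, [.traceless 2 1 [], .traceless 2 0 [], .traceless 1 0 []]⟩,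
    ⟨1 / 4, 2, 2, [.traceless 1 0 [], .traceless 1 0 [], .tr []]⟩,
    ⟨-3 / 32, 2, 0, [.tr [], .tr [], .tr []]⟩,
    ⟨-1 / 2, 2, 1, [.tr [], .u 0 [], .ut 0 []]⟩,
    ⟨1 / 2, 2, 1, [.tr [], .v 0 [], .v 0 []]⟩]

/-- The terms of `coupling`. -/
def couplingTerms : List Term :=
   [⟨1, 0, 2, [.h 1 0 [], .tr [1], .tr [0]]⟩,
    ⟨-2, 0, 4, [.h 3 2 [], .h 1 0 [3], .h 1 0 [2]]⟩,
    ⟨-4, 0, 4, [.h 3 2 [], .h 3 0 [1], .h 2 1 [0]]⟩,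
    ⟨-2, 0, 3, [.h 2 1 [], .h 2 1 [0], .tr [0]]⟩,
    ⟨4, 0, 4, [.h 3 2 [], .h 3 1 [0], .h 2 1 [0]]⟩,
    ⟨4, 0, 3, [.h 2 1 [2], .u 0 [], .ut 1 [0]]⟩,
    ⟨-4, 0, 3, [.h 2 1 [], .u 0 [2], .ut 0 [1]]⟩,
    ⟨4, 0, 3, [.h 2 1 [], .v 0 [2], .v 0 [1]]⟩,
    ⟨-4, 1, 2, [.v 0 [1], .u 1 [], .ut 0 []]⟩,
    ⟨-4 / 3, 2, 3, [.h 2 1 [], .h 2 0 [], .h 1 0 []]⟩,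
    ⟨1, 2, 2, [.h 1 0 [], .h 1 0 [], .tr []]⟩,
    ⟨-1 / 6, 2, 0, [.tr [], .tr [], .tr []]⟩]

/-- The terms of `current`. -/
def currentTerms : List Term :=
   [⟨-1, 0, 1, [.u 0 [], .tr [1], .tr [0]]⟩,
    ⟨2, 0, 3, [.u 2 [], .h 1 0 [3], .h 1 0 [2]]⟩,
    ⟨-4, 0, 3, [.u 2 [], .h 1 0 [1], .h 3 0 [2]]⟩,
    ⟨4, 0, 3, [.u 2 [], .h 1 0 [2], .h 3 0 [1]]⟩,
    ⟨-4, 0, 2, [.u 1 [], .v 0 [2], .v 0 [1]]⟩,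
    ⟨1 / 2, 0, 1, [.u 1 [], .tr [0], .tr [0]]⟩,
    ⟨-1, 0, 3, [.u 3 [], .h 1 0 [2], .h 1 0 [2]]⟩,
    ⟨-2, 0, 3, [.u 3 [], .h 2 0 [1], .h 2 1 [0]]⟩,
    ⟨2, 0, 2, [.u 2 [], .v 0 [1], .v 0 [1]]⟩,
    ⟨4, 0, 3, [.u 1 [2], .h 2 0 [], .h 3 1 [0]]⟩,
    ⟨4, 0, 3, [.u 1 [2], .h 3 0 [], .h 0 2 [1]]⟩,
    ⟨2, 0, 2, [.u 0 [1], .h 0 1 [], .tr [2]]⟩,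
    ⟨-4, 0, 3, [.u 1 [2], .h 2 0 [], .h 0 1 [3]]⟩,
    ⟨-4, 0, 3, [.u 3 [2], .h 1 0 [], .h 2 0 [1]]⟩,
    ⟨-1, 0, 1, [.u 0 [0], .tr [], .tr [1]]⟩,
    ⟨2, 0, 3, [.u 0 [0], .h 2 1 [], .h 2 1 [3]]⟩,
    ⟨2, 0, 2, [.u 1 [], .u 0 [2], .ut 0 [1]]⟩,
    ⟨2, 0, 2, [.u 1 [], .u 0 [1], .ut 0 [2]]⟩,
    ⟨-2, 0, 2, [.u 2 [], .u 0 [1], .ut 0 [1]]⟩,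
    ⟨1, 2, 2, [.u 2 [], .h 1 0 [], .h 1 0 []]⟩,
    ⟨-1 / 2, 2, 0, [.u 0 [], .tr [], .tr []]⟩]

/-- The terms of a vector whose divergence is the difference of the two couplings. -/
def differenceTerms : List Term :=
   [⟨-1 / 4, 0, 3, [.h 3 2 [2], .h 1 1 [], .h 0 0 []]⟩,
    ⟨-1 / 2, 0, 3, [.h 2 2 [1], .h 3 1 [], .h 0 0 []]⟩,
    ⟨2, 0, 3, [.h 3 2 [1], .h 2 1 [], .h 0 0 []]⟩,
    ⟨-1 / 32, 0, 3, [.h 2 2 [3], .h 1 1 [], .h 0 0 []]⟩,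
    ⟨1 / 2, 0, 3, [.h 2 1 [3], .h 2 1 [], .h 0 0 []]⟩,
    ⟨3 / 4, 0, 3, [.h 2 2 [3], .h 1 0 [], .h 1 0 []]⟩,
    ⟨-2, 0, 3, [.h 2 1 [3], .h 2 0 [], .h 1 0 []]⟩,
    ⟨4, 0, 2, [.h 2 1 [], .u 0 [], .ut 0 [1]]⟩,
    ⟨-1 / 2, 0, 2, [.h 1 1 [], .u 0 [], .ut 0 [2]]⟩,
    ⟨1 / 2, 0, 2, [.h 1 1 [], .u 0 [2], .ut 0 []]⟩,
    ⟨-1 / 2, 0, 2, [.h 1 1 [2], .u 0 [], .ut 0 []]⟩,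
    ⟨-1, 0, 2, [.h 1 1 [], .v 0 [2], .v 0 []]⟩,
    ⟨1 / 2, 0, 2, [.h 1 1 [2], .v 0 [], .v 0 []]⟩]

/-- `Term.variation` computes $d_Q$ divided by $i/2$, so gauge invariance reads: variation of $T$
minus twice the divergence of the current is zero. Monomials of $T$ contain at most three traces and
those of the current at most two, which fixes the numbers of expansion passes. -/
theorem vanishes_variation :
    vanishes ((expandAll 3 couplingTerms).flatMap Term.variation
      ++ scale (-2) (expandAll 2 (currentTerms.flatMap Term.divergence))) = true := by
  decide +kernel

/-- In `differenceTerms`, as in `currentTerms`, the label equal to the third entry of a term is the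
free vector index; `Term.divergence` contracts it with the derivative. -/
theorem vanishes_difference :
    vanishes (expandAll 4 couplingHΦTerms ++ scale (-1) (expandAll 3 couplingTerms)
      ++ scale (-1) (differenceTerms.flatMap Term.divergence)) = true := by
  decide +kernel

/-! ### Contraction -/

section Contraction

variable {A : Type*} [AddCommGroup A] [Module ℝ A]

theorem ctr_add (f g : Fin 4 → A) : (ctr fun μ => f μ + g μ) = ctr f + ctr g := by
  simp [ctr, Finset.sum_add_distrib]

theorem ctr_sub (f g : Fin 4 → A) : (ctr fun μ => f μ - g μ) = ctr f - ctr g := by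
  simp [ctr, Finset.sum_sub_distrib, smul_sub]

theorem ctr_neg (f : Fin 4 → A) : (ctr fun μ => -f μ) = -ctr f := by
  simp [ctr]

theorem ctr_smul (c : ℝ) (f : Fin 4 → A) : (ctr fun μ => c • f μ) = c • ctr f := by
  simp only [ctr, Finset.smul_sum, smul_comm c]

theorem map_ctr {B F : Type*} [AddCommGroup B] [Module ℝ B] [FunLike F A B]
    [LinearMapClass F ℝ A B] (φ : F) (f : Fin 4 → A) : φ (ctr f) = ctr fun μ => φ (f μ) := by
  simp [ctr]

theorem ctr_eta (μ : Fin 4) (f : Fin 4 → A) : (ctr fun ν => eta μ ν • f ν) = f μ := by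
  rw [ctr, Finset.sum_eq_single μ]
  · have : mink μ * mink μ = 1 := by fin_cases μ <;> simp [mink]
    simp [eta, smul_smul, this]
  · intro ν _ h
    simp [eta, Matrix.diagonal_apply_ne' _ h]
  · simp

theorem ctr_eta_self (a : A) : (ctr fun ν => eta ν ν • a) = (4 : ℝ) • a := by
  simp only [ctr, smul_smul, ← Finset.sum_smul]
  congr 1
  simp [Fin.sum_univ_four, mink, eta]
  norm_num

/-- Extend an assignment of indices to the labels below `k` to all labels. -/
def extend {k : ℕ} (e : Fin k → Fin 4) (n : ℕ) : Fin 4 := if h : n < k then e ⟨n, h⟩ else 0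

/-- Contract the labels below `k`. -/
def ctrAll (k : ℕ) (F : (ℕ → Fin 4) → A) : A :=
  ∑ e : Fin k → Fin 4, (∏ i, mink (e i)) • F (extend e)

theorem ctrAll_zero (F : (ℕ → Fin 4) → A) : ctrAll 0 F = F fun _ => 0 := by
  have h : ∀ e : Fin 0 → Fin 4, extend e = fun _ => 0 := fun e => by
    funext n
    simp [extend]
  rw [ctrAll, Fintype.sum_unique, h]
  simp

theorem extend_snoc {k : ℕ} (e : Fin k → Fin 4) (μ : Fin 4) :
    extend (Fin.snoc (α := fun _ => Fin 4) e μ) = Function.update (extend e) k μ := by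
  funext n
  rcases lt_trichotomy n k with h | rfl | h
  · have h1 : n < k + 1 := by omega
    simp [extend, h, h1, Function.update_of_ne h.ne, Fin.snoc]
  · simp [extend, Fin.snoc]
  · have h1 : ¬ n < k + 1 := by omega
    have h2 : ¬ n < k := by omega
    simp [extend, h1, h2, Function.update_of_ne h.ne']

/-- Splits off the last label as the outermost contraction. Under `extend e` the label `k` is out of
range and has the default index `0`, which the update overwrites. -/
theorem ctrAll_succ (k : ℕ) (F : (ℕ → Fin 4) → A) :
    ctrAll (k + 1) F = ctr fun μ => ctrAll k fun e => F (Function.update e k μ) := by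
  rw [ctrAll, ← (Fin.snocEquiv fun _ => Fin 4).sum_comp, Fintype.sum_prod_type, ctr]
  refine Finset.sum_congr rfl fun μ _ => ?_
  rw [ctrAll, Finset.smul_sum]
  refine Finset.sum_congr rfl fun e _ => ?_
  rw [smul_smul, ← extend_snoc, Fin.prod_univ_castSucc]
  simp [Fin.snocEquiv, mul_comm]

theorem transpose_eq (i j n : ℕ) :
    transpose i j n = if n = i then j else if n = j then i else n := by
  have h : ∀ a b : ℕ, Nat.beq a b = decide (a = b) := fun a b => by
    rw [Bool.eq_iff_iff, Nat.beq_eq, decide_eq_true_iff]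
  simp only [transpose, h, Bool.cond_decide]

/-- Contracted labels are dummies: exchanging two of them permutes the index assignments and leaves
the product of metric signs unchanged. -/
theorem ctrAll_transpose {k i j : ℕ} (hi : i < k) (hj : j < k) (F : (ℕ → Fin 4) → A) :
    ctrAll k (fun e => F (e ∘ transpose i j)) = ctrAll k F := by
  rw [ctrAll, ctrAll,
    ← (Equiv.arrowCongr (Equiv.swap (⟨i, hi⟩ : Fin k) ⟨j, hj⟩) (Equiv.refl (Fin 4))).sum_comp
      (fun e => (∏ i, mink (e i)) • F (extend e))]
  refine Finset.sum_congr rfl fun e _ => ?_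
  congr 1
  · exact (Equiv.prod_comp (Equiv.swap (⟨i, hi⟩ : Fin k) ⟨j, hj⟩) fun n => mink (e n)).symm
  · congr 1
    funext n
    by_cases hn : n < k
    · simp only [Function.comp_apply, extend, hn, dite_true, Equiv.arrowCongr_apply,
        Equiv.coe_refl, Equiv.symm_swap, id, transpose_eq]
      rw [Equiv.swap_apply_def]
      simp only [Fin.mk.injEq]
      split_ifs <;> simp_all
    · have h1 : n ≠ i := by omega
      have h2 : n ≠ j := by omega
      simp [extend, hn, transpose_eq, h1, h2]

theorem ctrAll_congr {k : ℕ} {F G : (ℕ → Fin 4) → A} (h : ∀ e, F e = G e) :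
    ctrAll k F = ctrAll k G := by
  rw [funext h]

theorem ctrAll_add (k : ℕ) (F G : (ℕ → Fin 4) → A) :
    (ctrAll k fun e => F e + G e) = ctrAll k F + ctrAll k G := by
  simp [ctrAll, Finset.sum_add_distrib]

theorem ctrAll_smul (k : ℕ) (c : ℝ) (F : (ℕ → Fin 4) → A) :
    (ctrAll k fun e => c • F e) = c • ctrAll k F := by
  simp only [ctrAll, Finset.smul_sum, smul_comm c]

theorem ctrAll_sum {ι : Type*} (k : ℕ) (l : List ι) (F : ι → (ℕ → Fin 4) → A) :
    (ctrAll k fun e => (l.map fun t => F t e).sum) = (l.map fun t => ctrAll k (F t)).sum := by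
  induction l with
  | nil => simp [ctrAll]
  | cons a l ih => simp only [List.map_cons, List.sum_cons, ctrAll_add, ih]

theorem ctr_ctrAll (k : ℕ) (F : Fin 4 → (ℕ → Fin 4) → A) :
    (ctr fun μ => ctrAll k (F μ)) = ctrAll k fun e => ctr fun μ => F μ e := by
  simp only [ctr, ctrAll, Finset.smul_sum]
  rw [Finset.sum_comm]
  exact Finset.sum_congr rfl fun ν _ => Finset.sum_congr rfl fun μ _ => smul_comm _ _ _

theorem map_ctrAll {B F : Type*} [AddCommGroup B] [Module ℝ B] [FunLike F A B]
    [LinearMapClass F ℝ A B] (φ : F) (k : ℕ) (f : (ℕ → Fin 4) → A) :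
    φ (ctrAll k f) = ctrAll k fun e => φ (f e) := by
  simp [ctrAll]

end Contraction

section ContractionMul

variable {A : Type*} [Ring A] [Algebra ℝ A]

theorem mul_ctr (a : A) (f : Fin 4 → A) : a * ctr f = ctr fun μ => a * f μ := by
  simp [ctr, Finset.mul_sum]

theorem ctr_mul (a : A) (f : Fin 4 → A) : ctr f * a = ctr fun μ => f μ * a := by
  simp [ctr, Finset.sum_mul]

end ContractionMul

/-! ### The value of a tensor monomial -/

variable {m : ℝ}

/-- The value of a factor, for an assignment of indices to the labels. -/
def Factor.val (m : ℝ) (e : ℕ → Fin 4) : Factor → Wick m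
  | h i j d => jet m (.h (e i) (e j)) (d.map e : List (Fin 4))
  | u i d => jet m (.u (e i)) (d.map e : List (Fin 4))
  | ut i d => jet m (.ut (e i)) (d.map e : List (Fin 4))
  | v i d => jet m (.v (e i)) (d.map e : List (Fin 4))
  | tr d => ctr fun ρ => jet m (.h ρ ρ) (d.map e : List (Fin 4))
  | traceless i j d => jet m (.h (e i) (e j)) (d.map e : List (Fin 4))
      - (1 / 4 : ℝ) • MassiveGravity.eta (e i) (e j) • ctr fun ρ => jet m (.h ρ ρ) (d.map e : List (Fin 4))
  | eta i j => MassiveGravity.eta (e i) (e j) • 1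

/-- The value of a monomial, for an assignment of indices to the labels. -/
def monomial (m : ℝ) (e : ℕ → Fin 4) (fs : List Factor) : Wick m := (fs.map (Factor.val m e)).prod

/-- The value of a term. -/
def Term.eval (m : ℝ) (t : Term) : Wick m :=
  ((t.c : ℝ) * m ^ t.p) • ctrAll t.k fun e => monomial m e t.fs

/-- The value of a linear combination of terms. -/
def evalSum (m : ℝ) (l : List Term) : Wick m := (l.map (Term.eval m)).sum

theorem monomial_nil (e : ℕ → Fin 4) : monomial m e [] = 1 := rfl

theorem monomial_cons (e : ℕ → Fin 4) (f : Factor) (fs : List Factor) :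
    monomial m e (f :: fs) = f.val m e * monomial m e fs := by simp [monomial]

theorem monomial_append (e : ℕ → Fin 4) (l l' : List Factor) :
    monomial m e (l ++ l') = monomial m e l * monomial m e l' := by simp [monomial]

theorem evalSum_nil : evalSum m [] = 0 := rfl

theorem evalSum_cons (t : Term) (l : List Term) :
    evalSum m (t :: l) = t.eval m + evalSum m l := by simp [evalSum]

theorem evalSum_append (l l' : List Term) :
    evalSum m (l ++ l') = evalSum m l + evalSum m l' := by simp [evalSum]

theorem evalSum_scale (a : ℚ) (l : List Term) : evalSum m (scale a l) = (a : ℝ) • evalSum m l := by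
  induction l with
  | nil => simp [scale, evalSum_nil]
  | cons t l ih =>
    have : scale a (t :: l) = ⟨a * t.c, t.p, t.k, t.fs⟩ :: scale a l := rfl
    rw [this, evalSum_cons, ih, evalSum_cons, smul_add]
    simp only [Term.eval, smul_smul]
    push_cast
    rw [mul_assoc]

theorem evalSum_flatMap {g : Term → List Term} {G : Term → Wick m}
    (h : ∀ t, evalSum m (g t) = G t) (l : List Term) :
    evalSum m (l.flatMap g) = (l.map G).sum := by
  induction l with
  | nil => rfl
  | cons t l ih => simp [evalSum_append, h, ih]

theorem Factor.val_relabel (s : ℕ → ℕ) (e : ℕ → Fin 4) (f : Factor) :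
    (f.relabel s).val m e = f.val m (e ∘ s) := by
  cases f <;> simp [relabel, val, List.map_map]

theorem monomial_relabel (s : ℕ → ℕ) (e : ℕ → Fin 4) (fs : List Factor) :
    monomial m e (fs.map (·.relabel s)) = monomial m (e ∘ s) fs := by
  simp [monomial, List.map_map, Function.comp_def, Factor.val_relabel]

theorem map_congr_below {e e' : ℕ → Fin 4} {k : ℕ} (h : ∀ n < k, e n = e' n) {d : List ℕ}
    (hd : d.all (Nat.blt · k) = true) : d.map e = d.map e' := by
  refine List.map_congr_left fun n hn => h n ?_
  simpa [Nat.blt_eq] using List.all_eq_true.1 hd n hn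

theorem Factor.val_congr {e e' : ℕ → Fin 4} {k : ℕ} (h : ∀ n < k, e n = e' n) {f : Factor}
    (hf : f.below k = true) : f.val m e = f.val m e' := by
  cases f <;> simp only [below, Bool.and_eq_true, Nat.blt_eq] at hf
  case h i j d => simp only [val, h i hf.1, h j hf.2.1, map_congr_below h hf.2.2]
  case u i d => simp only [val, h i hf.1, map_congr_below h hf.2]
  case ut i d => simp only [val, h i hf.1, map_congr_below h hf.2]
  case v i d => simp only [val, h i hf.1, map_congr_below h hf.2]
  case tr d => simp only [val, map_congr_below h hf]
  case traceless i j d => simp only [val, h i hf.1, h j hf.2.1, map_congr_below h hf.2.2]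
  case eta i j => simp only [val, h i hf.1, h j hf.2]

theorem monomial_congr {e e' : ℕ → Fin 4} {k : ℕ} (h : ∀ n < k, e n = e' n) {fs : List Factor}
    (hf : fs.all (·.below k) = true) : monomial m e fs = monomial m e' fs := by
  rw [monomial, monomial]
  congr 1
  exact List.map_congr_left fun f hmem => Factor.val_congr h (List.all_eq_true.1 hf f hmem)

theorem Factor.val_update (e : ℕ → Fin 4) (k : ℕ) (μ : Fin 4) {f : Factor}
    (hf : f.below k = true) : f.val m (Function.update e k μ) = f.val m e :=
  val_congr (fun _ hn => Function.update_of_ne hn.ne _ _) hf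

theorem monomial_update (e : ℕ → Fin 4) (k : ℕ) (μ : Fin 4) {fs : List Factor}
    (hf : fs.all (·.below k) = true) : monomial m (Function.update e k μ) fs = monomial m e fs :=
  monomial_congr (fun _ hn => Function.update_of_ne hn.ne _ _) hf

theorem ctrAll_relabel {k i j : ℕ} (hi : i < k) (hj : j < k) (fs : List Factor) :
    (ctrAll k fun e => monomial m e (fs.map (·.relabel (transpose i j)))) =
      ctrAll k fun e => monomial m e fs := by
  simp only [monomial_relabel]
  exact ctrAll_transpose hi hj fun e => monomial m e fs

/-! #### Substitutions -/

/-- The value of a contribution, for an assignment of indices to the labels. -/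
def Contribution.val (m : ℝ) (k : ℕ) (e : ℕ → Fin 4) (t : Contribution) : Wick m :=
  ((t.c : ℝ) * m ^ t.p) • bif t.fresh then ctr fun μ => monomial m (Function.update e k μ) t.fs
    else monomial m e t.fs

/-- The bridge from substitutions inside a single factor to whole terms: a fresh contraction created
by the substitution is absorbed as label `k` of the enlarged term. -/
theorem Contribution.ctrAll_val (c : ℚ) (p k : ℕ) (t : Contribution) :
    ((c : ℝ) * m ^ p) • (ctrAll k fun e => t.val m k e) = (t.toTerm c p k).eval m := by
  obtain ⟨c', p', fresh, fs⟩ := t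
  have hc : ((c : ℝ) * m ^ p) * ((c' : ℝ) * m ^ p') = ((c * c' : ℚ) : ℝ) * m ^ (p + p') := by
    push_cast; ring
  cases fresh
  · simp only [val, toTerm, Term.eval, cond_false, ctrAll_smul, smul_smul, hc]
  · simp only [val, toTerm, Term.eval, cond_true, ctrAll_smul, smul_smul, hc, ctrAll_succ,
      ctr_ctrAll]

/-- The remaining factors use labels below `k` only, so they do not see the fresh label and can be
pulled out of its contraction. -/
theorem Contribution.val_append (k : ℕ) (e : ℕ → Fin 4) (t : Contribution) {fs : List Factor}
    (hf : fs.all (·.below k) = true) :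
    (t.append fs).val m k e = t.val m k e * monomial m e fs := by
  obtain ⟨c', p', fresh, fs'⟩ := t
  cases fresh <;>
    simp [val, append, monomial_append, ctr_mul, monomial_update _ _ _ hf]

theorem Contribution.val_cons (k : ℕ) (e : ℕ → Fin 4) (t : Contribution) {f : Factor}
    (hf : f.below k = true) : (t.cons f).val m k e = f.val m e * t.val m k e := by
  obtain ⟨c', p', fresh, fs'⟩ := t
  cases fresh <;>
    simp [val, cons, monomial_cons, mul_ctr, Factor.val_update _ _ _ hf]

theorem Contribution.val_gradedCons (k : ℕ) (e : ℕ → Fin 4) (t : Contribution) {f : Factor}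
    (hf : f.below k = true) :
    (t.gradedCons f).val m k e =
      (bif f.fermi then (-1 : ℂ) else 1) • f.val m e * t.val m k e := by
  rw [smul_mul_assoc, ← val_cons k e t hf]
  cases hff : f.fermi
  · simp [gradedCons, hff, cons]
  · simp [gradedCons, hff, cons, val]

theorem Factor.expand_val (e : ℕ → Fin 4) {k : ℕ} {f : Factor} (hf : f.below k = true)
    {l : List Contribution} (hl : f.expand k = some l) :
    (l.map (Contribution.val m k e)).sum = f.val m e := by
  cases f <;> simp only [expand, Option.some.injEq, reduceCtorEq] at hl
  case tr d =>
    subst hl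
    simp only [below] at hf
    have : ∀ μ, d.map (Function.update e k μ) = d.map e := fun μ =>
      map_congr_below (fun n hn => Function.update_of_ne hn.ne _ _) hf
    simp [Contribution.val, monomial, val, this]
  case traceless i j d =>
    subst hl
    simp only [below, Bool.and_eq_true, Nat.blt_eq] at hf
    have : ∀ μ, d.map (Function.update e k μ) = d.map e := fun μ =>
      map_congr_below (fun n hn => Function.update_of_ne hn.ne _ _) hf.2.2
    simp [Contribution.val, monomial, val, this, Function.update_of_ne hf.1.ne,
      Function.update_of_ne hf.2.1.ne, ctr_smul]
    module

theorem expandFirst_val (e : ℕ → Fin 4) {k : ℕ} {fs : List Factor}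
    (hf : fs.all (·.below k) = true) :
    ((expandFirst k fs).map (Contribution.val m k e)).sum = monomial m e fs := by
  induction fs with
  | nil => simp [expandFirst, Contribution.val]
  | cons f fs ih =>
    simp only [List.all_cons, Bool.and_eq_true] at hf
    rw [expandFirst, monomial_cons]
    cases hl : f.expand k with
    | none =>
      simp only [List.map_map, Function.comp_def, Contribution.val_cons _ _ _ hf.1]
      rw [List.sum_map_mul_left, ih hf.2]
    | some l =>
      simp only [List.map_map, Function.comp_def, Contribution.val_append _ _ _ hf.2]
      rw [List.sum_map_mul_right, Factor.expand_val e hf.1 hl]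

theorem sum_toTerm (c : ℚ) (p k : ℕ) (l : List Contribution) :
    evalSum m (l.map (·.toTerm c p k)) =
      ((c : ℝ) * m ^ p) • ctrAll k fun e => (l.map (Contribution.val m k e)).sum := by
  rw [ctrAll_sum, List.smul_sum, evalSum, List.map_map, List.map_map]
  simp [Function.comp_def, ← Contribution.ctrAll_val]

/-- No closedness hypothesis is needed, since `Term.expand` leaves a term alone when one of its
labels would clash with the fresh one. -/
theorem Term.evalSum_expand (t : Term) : evalSum m t.expand = t.eval m := by
  rw [expand]
  cases hf : t.fs.all (·.below t.k)
  · simp [evalSum]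
  · rw [cond_true, sum_toTerm]
    simp only [expandFirst_val _ hf]
    rfl

theorem evalSum_expandAll (n : ℕ) (l : List Term) : evalSum m (expandAll n l) = evalSum m l := by
  induction n generalizing l with
  | zero => rfl
  | succ n ih => rw [expandAll, ih, evalSum_flatMap Term.evalSum_expand]; rfl

/-! ### Gauge variation of monomials -/

/-- The condition under which the gauge variation of a term is computed. -/
def Term.isClosed (t : Term) : Bool := t.fs.all fun f => f.below t.k && f.isJet

theorem Factor.variation_val (e : ℕ → Fin 4) {k : ℕ} {f : Factor} (hf : f.below k = true)
    (hj : f.isJet = true) :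
    dQ m (f.val m e) = (Complex.I / 2) • ((f.variation k).map (Contribution.val m k e)).sum := by
  cases f <;> simp only [below, isJet, Bool.and_eq_true, Nat.blt_eq, reduceCtorEq] at hf hj
  case h i j d =>
    have : ∀ μ, d.map (Function.update e k μ) = d.map e := fun μ =>
      map_congr_below (fun n hn => Function.update_of_ne hn.ne _ _) hf.2.2
    simp [variation, Contribution.val, monomial, val, this, Function.update_of_ne hf.1.ne,
      Function.update_of_ne hf.2.1.ne, ctr_smul, dQ_jet, dQJet]
    module
  case u i d => simp [variation, val, dQ_jet, dQJet]
  case ut i d =>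
    have : ∀ μ, d.map (Function.update e k μ) = d.map e := fun μ =>
      map_congr_below (fun n hn => Function.update_of_ne hn.ne _ _) hf.2
    simp [variation, Contribution.val, monomial, val, this, Function.update_of_ne hf.1.ne,
      dQ_jet, dQJet]
    module
  case v i d =>
    simp [variation, Contribution.val, monomial, val, dQ_jet, dQJet]

theorem Factor.dQ_val_mul (e : ℕ → Fin 4) {f : Factor} (hj : f.isJet = true) (y : Wick m) :
    dQ m (f.val m e * y) =
      dQ m (f.val m e) * y + (bif f.fermi then (-1 : ℂ) else 1) • (f.val m e * dQ m y) := by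
  cases f <;> simp only [isJet, reduceCtorEq] at hj <;>
    simp [val, dQ_jet_mul, dQ_jet, fermi, Field.sign, Field.gh]

/-- Graded Leibniz rule along the list of factors. `Factor.variation` is a dummy on traces,
traceless parts and metrics, so every factor is required to be a derivative of a basic field; this
is why traces are expanded first. -/
theorem variation_val (e : ℕ → Fin 4) {k : ℕ} {fs : List Factor}
    (hf : fs.all (fun f => f.below k && f.isJet) = true) :
    dQ m (monomial m e fs) =
      (Complex.I / 2) • ((variation k fs).map (Contribution.val m k e)).sum := by
  induction fs with
  | nil =>
    simp [monomial_nil, variation, dQ]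
  | cons f fs ih =>
    simp only [List.all_cons, Bool.and_eq_true] at hf
    have hb : fs.all (·.below k) = true := by
      refine List.all_eq_true.2 fun g hg => ?_
      have := List.all_eq_true.1 hf.2 g hg
      simp only [Bool.and_eq_true] at this
      exact this.1
    rw [monomial_cons, Factor.dQ_val_mul e hf.1.2, Factor.variation_val e hf.1.1 hf.1.2, variation,
      ih hf.2]
    simp only [List.map_append, List.map_map, Function.comp_def, List.sum_append,
      Contribution.val_append _ _ _ hb, Contribution.val_gradedCons _ _ _ hf.1.1]
    rw [List.sum_map_mul_right, List.sum_map_mul_left, smul_add, smul_mul_assoc, smul_mul_assoc,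
      mul_smul_comm, smul_comm (Complex.I / 2)]

variable {m : ℝ}

theorem dQ_real_smul (c : ℝ) (w : Wick m) : dQ m (c • w) = c • dQ m w := by
  rw [← algebraMap_smul ℂ c w, map_smul, algebraMap_smul]

theorem pd_real_smul (μ : Fin 4) (c : ℝ) (w : Wick m) : pd m μ (c • w) = c • pd m μ w := by
  rw [← algebraMap_smul ℂ c w, map_smul, algebraMap_smul]

theorem Term.dQ_eval {t : Term} (ht : t.isClosed = true) :
    dQ m (t.eval m) = (Complex.I / 2) • evalSum m t.variation := by
  have h : dQ m (ctrAll t.k fun e => monomial m e t.fs) =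
      (Complex.I / 2) • ctrAll t.k fun e =>
        ((MassiveGravity.variation t.k t.fs).map (Contribution.val m t.k e)).sum := by
    have h' := map_ctrAll ((dQ m).restrictScalars ℝ) t.k fun e => monomial m e t.fs
    simp only [LinearMap.coe_restrictScalars] at h'
    simp only [h', variation_val _ ht]
    simp only [ctrAll, Finset.smul_sum, smul_comm (Complex.I / 2)]
  rw [variation, sum_toTerm, eval, dQ_real_smul, h, smul_comm]

theorem dQ_evalSum {l : List Term} (hl : l.all Term.isClosed = true) :
    dQ m (evalSum m l) = (Complex.I / 2) • evalSum m (l.flatMap Term.variation) := by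
  induction l with
  | nil => simp [evalSum]
  | cons t l ih =>
    simp only [List.all_cons, Bool.and_eq_true] at hl
    rw [evalSum_cons, map_add, Term.dQ_eval hl.1, ih hl.2, List.flatMap_cons, evalSum_append,
      smul_add]

/-! #### Divergences -/

/-- The value of a term with the free label `k`, for a value of the free index. -/
def Term.evalFree (m : ℝ) (μ : Fin 4) (t : Term) : Wick m :=
  ((t.c : ℝ) * m ^ t.p) • ctrAll t.k fun e => monomial m (Function.update e t.k μ) t.fs

/-- The value of a linear combination of terms with one free label. -/
def evalFreeSum (m : ℝ) (μ : Fin 4) (l : List Term) : Wick m := (l.map (Term.evalFree m μ)).sum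

theorem pd_one (μ : Fin 4) : pd m μ 1 = 0 := by
  simp [pd]

/-- The metric is excluded because `Factor.deriv` returns it unchanged, whereas its derivative is
zero. -/
theorem Factor.pd_val (e : ℕ → Fin 4) (l : ℕ) {f : Factor}
    (hf : ∀ i j, f ≠ .eta i j) : pd m (e l) (f.val m e) = (f.deriv l).val m e := by
  have hc : ∀ g : Fin 4 → Wick m, pd m (e l) (ctr g) = ctr fun μ => pd m (e l) (g μ) := fun g =>
    map_ctr ((pd m (e l)).restrictScalars ℝ) g
  cases f
  case eta i j => exact (hf i j rfl).elim
  all_goals simp [val, deriv, pd_jet, hc, map_sub]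

/-- No factor is a metric tensor. -/
def noEta : List Factor → Bool
  | [] => true
  | .eta _ _ :: _ => false
  | _ :: l => noEta l

theorem noEta_cons {f : Factor} {fs : List Factor} (h : noEta (f :: fs) = true) :
    (∀ i j, f ≠ .eta i j) ∧ noEta fs = true := by
  cases f <;> simp_all [noEta]

theorem pd_monomial (e : ℕ → Fin 4) (l : ℕ) {fs : List Factor} (hf : noEta fs = true) :
    pd m (e l) (monomial m e fs) = ((derivs l fs).map (monomial m e)).sum := by
  induction fs with
  | nil => simp [monomial_nil, derivs, pd_one]
  | cons f fs ih =>
    have h := noEta_cons hf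
    rw [monomial_cons, pd_mul, Factor.pd_val e l h.1, ih h.2, derivs]
    simp only [List.map_cons, List.sum_cons, List.map_map, Function.comp_def, monomial_cons]
    rw [List.sum_map_mul_left]

/-- The label `t.k` serves at once as free index of the vector and as index of the derivative, so
contracting over its value is the step from `ctrAll t.k` to `ctrAll (t.k + 1)`. -/
theorem Term.ctr_pd_evalFree {t : Term} (ht : noEta t.fs = true) :
    (ctr fun μ => pd m μ (t.evalFree m μ)) = evalSum m t.divergence := by
  have h : ∀ μ, pd m μ (t.evalFree m μ) = ((t.c : ℝ) * m ^ t.p) • ctrAll t.k fun e =>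
      ((derivs t.k t.fs).map (monomial m (Function.update e t.k μ))).sum := fun μ => by
    rw [evalFree, pd_real_smul]
    congr 1
    refine (map_ctrAll ((pd m μ).restrictScalars ℝ) t.k _).trans (ctrAll_congr fun e => ?_)
    have := pd_monomial (m := m) (Function.update e t.k μ) t.k ht
    rw [Function.update_self] at this
    exact this
  simp only [h, ctr_smul, divergence, evalSum, List.map_map, Function.comp_def, eval]
  rw [← ctrAll_succ t.k fun e => ((derivs t.k t.fs).map (monomial m e)).sum, ctrAll_sum,
    List.smul_sum, List.map_map]
  rfl

theorem ctr_pd_evalFreeSum {l : List Term} (hl : l.all (fun t => noEta t.fs) = true) :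
    (ctr fun μ => pd m μ (evalFreeSum m μ l)) = evalSum m (l.flatMap Term.divergence) := by
  induction l with
  | nil => simp [evalFreeSum, evalSum, ctr]
  | cons t l ih =>
    simp only [List.all_cons, Bool.and_eq_true] at hl
    have : ∀ μ, evalFreeSum m μ (t :: l) = t.evalFree m μ + evalFreeSum m μ l := fun μ => by
      simp [evalFreeSum]
    simp only [this, map_add]
    rw [ctr_add, Term.ctr_pd_evalFree hl.1, ih hl.2, List.flatMap_cons, evalSum_append]

/-! #### Contraction with the metric and the Klein-Gordon equation -/

theorem findEta_eq {fs : List Factor} {i j : ℕ} {fs' : List Factor}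
    (h : findEta fs = some (i, j, fs')) (e : ℕ → Fin 4) :
    monomial m e fs = eta (e i) (e j) • monomial m e fs' := by
  induction fs generalizing fs' with
  | nil => simp [findEta] at h
  | cons f fs ih =>
    by_cases hf : ∃ a b, f = .eta a b
    · obtain ⟨a, b, rfl⟩ := hf
      simp only [findEta, Option.some.injEq, Prod.mk.injEq] at h
      obtain ⟨rfl, rfl, rfl⟩ := h
      simp [monomial_cons, Factor.val]
    · have h' : findEta (f :: fs) = (findEta fs).map fun r => (r.1, r.2.1, f :: r.2.2) := by
        cases f
        case eta a b => exact (hf ⟨a, b, rfl⟩).elim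
        all_goals rfl
      rw [h'] at h
      cases hr : findEta fs with
      | none => simp [hr] at h
      | some r =>
        obtain ⟨a, b, fs''⟩ := r
        simp only [hr, Option.map_some, Option.some.injEq, Prod.mk.injEq] at h
        obtain ⟨rfl, rfl, rfl⟩ := h
        rw [monomial_cons, ih hr, monomial_cons, mul_smul_comm]

theorem transpose_left (i j : ℕ) : transpose i j i = j := by simp [transpose_eq]

theorem Term.eval_contractEta (t : Term) : t.contractEta.eval m = t.eval m := by
  obtain ⟨c, p, k, fs⟩ := t
  rw [contractEta]
  split
  next k i j fs' hk hfs =>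
    dsimp only at hk hfs ⊢
    subst hk
    cases hjk : Nat.ble j k
    · rfl
    rw [cond_true]
    have hj : j < k + 1 := by simpa [Nat.lt_succ_iff] using hjk
    -- Invariance under exchange of dummies brings the metric into the form $\eta_{i'k}$, with `k`
    -- the label that `ctrAll_succ` contracts first. Its contraction substitutes `i'` for `k`, or
    -- gives the factor $\eta^\mu{}_\mu=4$ when the two indices agree.
    have key : (ctrAll (k + 1) fun e => monomial m e fs) = ctrAll (k + 1) fun e =>
        eta (e (transpose j k i)) (e k) •
          monomial m e (fs'.map (·.relabel (transpose j k))) := by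
      rw [← ctrAll_transpose hj k.lt_succ_self]
      refine ctrAll_congr fun e => ?_
      rw [findEta_eq hfs, monomial_relabel, Function.comp_apply, Function.comp_apply,
        transpose_left]
    cases hij : Nat.beq i j
    · rw [cond_false]
      cases hi : Nat.blt (transpose j k i) k
      · rfl
      rw [cond_true, eval, eval]
      dsimp only
      have hi' : transpose j k i < k := by simpa using hi
      rw [key, ctrAll_succ, ctr_ctrAll]
      congr 1
      refine ctrAll_congr fun e => ?_
      simp only [Function.update_of_ne hi'.ne, Function.update_self, ctr_eta]
      rw [monomial_relabel]
      congr 1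
      funext n
      by_cases hn : n = k
      · subst hn; simp [replace]
      · have : Nat.beq n k = false := by
          rw [Bool.eq_false_iff]; simpa using hn
        simp [replace, this, hn]
    · rw [cond_true]
      cases hb : (fs'.map (·.relabel (transpose j k))).all (·.below k)
      · rfl
      rw [cond_true, eval, eval]
      dsimp only
      have hij' : i = j := by simpa using hij
      subst hij'
      rw [key, transpose_left, ctrAll_succ, ctr_ctrAll]
      simp only [Function.update_self, monomial_update _ _ _ hb, ctr_eta_self, ctrAll_smul,
        smul_smul]
      push_cast
      ring_nf
  next => rfl

theorem findRepeated_perm {l l' : List ℕ} {a : ℕ} (h : findRepeated l = some (a, l')) :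
    l.Perm (a :: a :: l') := by
  induction l generalizing l' with
  | nil => simp [findRepeated] at h
  | cons b l ih =>
    rw [findRepeated] at h
    cases hb : l.any (Nat.beq b)
    · rw [hb, cond_false] at h
      cases hr : findRepeated l with
      | none => simp [hr] at h
      | some r =>
        obtain ⟨a', l''⟩ := r
        simp only [hr, Option.map_some, Option.some.injEq, Prod.mk.injEq] at h
        obtain ⟨rfl, rfl⟩ := h
        exact ((ih hr).cons b).trans ((List.Perm.swap _ _ _).trans ((List.Perm.swap _ _ _).cons _))
    · rw [hb, cond_true, Option.some.injEq, Prod.mk.injEq] at h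
      obtain ⟨rfl, rfl⟩ := h
      have hmem : b ∈ l := by
        obtain ⟨x, hx, hbx⟩ := List.any_eq_true.1 hb
        have : b = x := by simpa using hbx
        rwa [this]
      exact (List.perm_cons_erase hmem).cons b

theorem map_update_repeated {d d' : List ℕ} {k : ℕ} (h : findRepeated d = some (k, d'))
    (hd : d'.all (Nat.blt · k) = true) (e : ℕ → Fin 4) (μ : Fin 4) :
    ((d.map (Function.update e k μ) : List (Fin 4)) : Multiset (Fin 4)) =
      μ ::ₘ μ ::ₘ ((d'.map e : List (Fin 4)) : Multiset (Fin 4)) := by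
  rw [Multiset.cons_coe, Multiset.cons_coe, Multiset.coe_eq_coe]
  refine ((findRepeated_perm h).map _).trans ?_
  have h' : d'.map (Function.update e k μ) = d'.map e :=
    map_congr_below (fun n hn => Function.update_of_ne hn.ne _ _) hd
  simp only [List.map_cons, Function.update_self, h']
  rfl

/-- The condition on `f'` ensures that the label `k` occurs only in the removed pair of derivatives;
its contraction is then exactly the d'Alembertian of a field derivative. -/
theorem Factor.findBox_eq {f f' : Factor} {k : ℕ} (h : f.findBox = some (k, f'))
    (hf : f'.below k = true) (e : ℕ → Fin 4) :
    (ctr fun μ => f.val m (Function.update e k μ)) = -(m ^ 2 • f'.val m e) := by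
  cases f <;> simp only [findBox, Option.map_eq_some_iff, Prod.mk.injEq, reduceCtorEq] at h
  all_goals
    obtain ⟨⟨a, d'⟩, hd, ha, hf'⟩ := h
    dsimp only at ha hf'
    subst ha hf'
    simp only [below, Bool.and_eq_true, Nat.blt_eq] at hf
  case h i j d =>
    simp only [val, map_update_repeated hd hf.2.2, Function.update_of_ne hf.1.ne,
      Function.update_of_ne hf.2.1.ne, jet_kleinGordon_ctr]
  all_goals
    simp only [val, map_update_repeated hd hf.2, Function.update_of_ne hf.1.ne,
      jet_kleinGordon_ctr]

theorem findBox_eq {fs fs' : List Factor} {k : ℕ} (h : findBox fs = some (k, fs'))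
    (hf : fs'.all (·.below k) = true) (e : ℕ → Fin 4) :
    (ctr fun μ => monomial m (Function.update e k μ) fs) = -(m ^ 2 • monomial m e fs') := by
  induction fs generalizing fs' with
  | nil => simp [findBox] at h
  | cons f fs ih =>
    rw [findBox] at h
    cases hr : f.findBox with
    | some r =>
      obtain ⟨a, f'⟩ := r
      simp only [hr, Option.some.injEq, Prod.mk.injEq] at h
      obtain ⟨rfl, rfl⟩ := h
      simp only [List.all_cons, Bool.and_eq_true] at hf
      simp only [monomial_cons, monomial_update _ _ _ hf.2]
      rw [← ctr_mul, Factor.findBox_eq hr hf.1, neg_mul, smul_mul_assoc]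
    | none =>
      simp only [hr, Option.map_eq_some_iff, Prod.mk.injEq] at h
      obtain ⟨⟨a, fs''⟩, hfs, ha, hfs'⟩ := h
      dsimp only at ha hfs'
      subst ha hfs'
      simp only [List.all_cons, Bool.and_eq_true] at hf
      simp only [monomial_cons, Factor.val_update _ _ _ hf.1]
      rw [← mul_ctr, ih hfs hf.2, mul_neg, mul_smul_comm]

theorem Term.eval_kleinGordon (t : Term) : t.kleinGordon.eval m = t.eval m := by
  obtain ⟨c, p, k, fs⟩ := t
  rw [kleinGordon]
  split
  next k i fs' hk hfs =>
    dsimp only at hk hfs ⊢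
    subst hk
    cases hik : Nat.ble i k
    · rfl
    rw [cond_true]
    have hi : i < k + 1 := by simpa [Nat.lt_succ_iff] using hik
    split
    next j fs'' hfs'' =>
      cases hb : Nat.beq j k && fs''.all (·.below k)
      · rfl
      rw [cond_true, eval, eval]
      dsimp only
      rw [Bool.and_eq_true] at hb
      have hjk : j = k := by simpa using hb.1
      subst hjk
      rw [← ctrAll_relabel hi j.lt_succ_self, ctrAll_succ, ctr_ctrAll]
      simp only [findBox_eq hfs'' hb.2]
      rw [ctrAll_congr (fun e => (neg_smul (m ^ 2) (monomial m e fs'')).symm), ctrAll_smul,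
        smul_smul]
      push_cast
      ring_nf
    next => rfl
  next => rfl

variable {m : ℝ}

/-! #### Normal forms -/

theorem insertLabel_perm (a : ℕ) (l : List ℕ) : (Factor.insertLabel a l).Perm (a :: l) := by
  induction l with
  | nil => rfl
  | cons b l ih =>
    rw [Factor.insertLabel]
    cases Nat.ble a b
    · exact (ih.cons b).trans (List.Perm.swap _ _ _)
    · rfl

theorem sortLabels_perm (l : List ℕ) : (Factor.sortLabels l).Perm l := by
  induction l with
  | nil => rfl
  | cons a l ih => exact (insertLabel_perm a _).trans (ih.cons a)

theorem map_sortLabels (e : ℕ → Fin 4) (d : List ℕ) :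
    (((Factor.sortLabels d).map e : List (Fin 4)) : Multiset (Fin 4)) =
      ((d.map e : List (Fin 4)) : Multiset (Fin 4)) :=
  Multiset.coe_eq_coe.2 ((sortLabels_perm d).map e)

theorem Factor.val_normalize (e : ℕ → Fin 4) (f : Factor) :
    f.normalize.val m e = f.val m e := by
  cases f
  case h i j d =>
    rw [normalize]
    cases Nat.ble i j
    · simp only [cond_false, val, map_sortLabels, jet_symm (e j)]
    · simp only [cond_true, val, map_sortLabels]
  all_goals simp only [normalize, val, map_sortLabels]

theorem bose_commute {P : Field → Prop} {w z : Wick m}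
    (hw : w ∈ linearFields m fun g => ¬ g.IsFermi) (hz : z ∈ linearFields m P) :
    w * z = z * w := by
  induction hz using Submodule.span_induction with
  | mem x hx =>
    obtain ⟨f, α, _, rfl⟩ := hx
    exact bose_comm hw (f, α)
  | zero => simp
  | add x y _ _ hx hy => rw [add_mul, mul_add, hx, hy]
  | smul c x _ hx => rw [smul_mul_assoc, mul_smul_comm, hx]

theorem Factor.val_mem_fermi (e : ℕ → Fin 4) {f : Factor} (hf : f.fermi = true) :
    f.val m e ∈ linearFields m Field.IsFermi := by
  cases f <;> simp only [fermi, reduceCtorEq] at hf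
  · exact jet_mem (f := .u _) trivial _
  · exact jet_mem (f := .ut _) trivial _

/-- The alternative accounts for the metric, whose value is a scalar multiple of `1` and not a
linear combination of fields. -/
theorem Factor.val_mem_bose (e : ℕ → Fin 4) {f : Factor} (hf : f.fermi = false) :
    (∃ c : ℝ, f.val m e = c • 1) ∨ f.val m e ∈ linearFields m fun g => ¬ g.IsFermi := by
  have hh : ∀ μ ν α, jet m (.h μ ν) α ∈ linearFields m fun g => ¬ g.IsFermi := fun μ ν α =>
    jet_mem (P := fun g => ¬ g.IsFermi) (by simp [Field.IsFermi]) α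
  cases f <;> simp only [fermi, reduceCtorEq] at hf
  · exact .inr (hh _ _ _)
  · exact .inr (jet_mem (P := fun g => ¬ g.IsFermi) (by simp [Field.IsFermi]) _)
  · exact .inr (ctr_mem fun _ => hh _ _ _)
  · exact .inr (Submodule.sub_mem _ (hh _ _ _)
      (real_smul_mem _ (real_smul_mem _ (ctr_mem fun _ => hh _ _ _))))
  · exact .inl ⟨_, rfl⟩

/-- The sign for a change of order of Fermi factors. -/
def boolSign (b : Bool) : ℝ := bif b then -1 else 1

theorem boolSign_xor (a b : Bool) : boolSign (xor a b) = boolSign a * boolSign b := by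
  cases a <;> cases b <;> simp [boolSign]

theorem Factor.val_mul_comm (e : ℕ → Fin 4) (f g : Factor) :
    f.val m e * g.val m e = boolSign (f.fermi && g.fermi) • (g.val m e * f.val m e) := by
  have key : ∀ f' g' : Factor, f'.fermi = false →
      f'.val m e * g'.val m e = g'.val m e * f'.val m e := by
    intro f' g' hf
    rcases val_mem_bose (m := m) e hf with ⟨c, hc⟩ | hf
    · simp [hc]
    · cases hg : g'.fermi
      · rcases val_mem_bose (m := m) e hg with ⟨c, hc⟩ | hg
        · simp [hc]
        · exact bose_commute hf hg
      · exact bose_commute hf (val_mem_fermi e hg)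
  cases hf : f.fermi
  · simp [boolSign, key f g hf]
  · cases hg : g.fermi
    · simp [boolSign, key g f hg]
    · have h1 : ∃ b : Jet, b.1.IsFermi ∧ g.val m e = jet m b.1 b.2 := by
        cases g <;> simp only [fermi, reduceCtorEq] at hg
        · exact ⟨(.u _, _), trivial, rfl⟩
        · exact ⟨(.ut _, _), trivial, rfl⟩
      obtain ⟨b, hb, hgb⟩ := h1
      rw [hgb, fermi_anticomm (val_mem_fermi e hf) b hb]
      simp [boolSign]

/-- Each exchange of neighbours contributes $-1$ precisely when both factors are Fermi; the Boolean
accumulates these signs by `xor`. -/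
theorem insertFactor_eq (e : ℕ → Fin 4) (f : Factor) (l : List Factor) :
    monomial m e (f :: l) =
      boolSign (insertFactor f l).1 • monomial m e (insertFactor f l).2 := by
  induction l with
  | nil => simp [insertFactor, boolSign]
  | cons g l ih =>
    rw [insertFactor]
    cases Nat.ble f.code g.code
    · rw [cond_false]
      dsimp only
      rw [boolSign_xor, mul_smul, monomial_cons e g, ← mul_smul_comm, ← ih, monomial_cons,
        monomial_cons, monomial_cons, ← mul_assoc, Factor.val_mul_comm, smul_mul_assoc, mul_assoc]
    · simp [boolSign]

theorem sortFactors_eq (e : ℕ → Fin 4) (l : List Factor) :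
    monomial m e l = boolSign (sortFactors l).1 • monomial m e (sortFactors l).2 := by
  induction l with
  | nil => simp [sortFactors, boolSign]
  | cons f l ih =>
    rw [sortFactors, boolSign_xor, mul_smul, ← insertFactor_eq, monomial_cons, monomial_cons, ih,
      Factor.val_normalize, mul_smul_comm]

/-- Every listed relabeling is a composition of transpositions of contracted labels, so
`ctrAll_relabel` applies step by step. That all permutations are reached matters for the success of
the computation but not for its soundness. -/
theorem relabelings_eq {k n : ℕ} (hn : n ≤ k) {fs fs' : List Factor}
    (h : fs' ∈ relabelings n fs) :
    (ctrAll k fun e => monomial m e fs') = ctrAll k fun e => monomial m e fs := by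
  induction n generalizing fs with
  | zero =>
    rw [relabelings, List.mem_singleton] at h
    rw [h]
  | succ n ih =>
    rw [relabelings, List.mem_flatMap] at h
    obtain ⟨j, hj, h⟩ := h
    rw [ih (by omega) h]
    rw [List.mem_range] at hj
    exact ctrAll_relabel (by omega) (by omega) fs

/-- `P` will say that a signed monomial represents a given value. The search preserves this, and its
flag is raised only when the selected monomial represents the value with both signs. -/
theorem smallest_spec {P : Bool × List Factor → Prop} {a : Bool × List Factor} (n : ℕ) (z : Bool)
    {l : List (Bool × List Factor)} (ha : P a) (hl : ∀ b ∈ l, P b)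
    (hz : z = true → P (!a.1, a.2)) :
    P (smallest a n z l).1 ∧
      ((smallest a n z l).2 = true → P (!(smallest a n z l).1.1, (smallest a n z l).1.2)) := by
  induction l generalizing a n z with
  | nil => exact ⟨ha, hz⟩
  | cons b l ih =>
    have hb := hl b (by simp)
    have hl' : ∀ b ∈ l, P b := fun b hb => hl b (by simp [hb])
    rw [smallest]
    cases Nat.blt (monomialCode b.2) n
    · rw [cond_false]
      cases hx : Nat.beq (monomialCode b.2) n && xor a.1 b.1
      · exact ih n z ha hl' hz
      · refine ih n _ ha hl' fun h => ?_
        rw [Bool.or_eq_true, decide_eq_true_iff] at h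
        rcases h with h | h
        · exact hz h
        · rw [Bool.and_eq_true] at hx
          have : b = (!a.1, a.2) := by
            obtain ⟨b1, b2⟩ := b
            have h1 := hx.2
            dsimp only at h h1 ⊢
            subst h
            cases ha1 : a.1 <;> cases b1 <;> simp_all
          rwa [← this]
    · exact ih _ false hb hl' (by simp)

theorem Term.eval_canonical (t : Term) : t.canonical.eval m = t.eval m := by
  rw [canonical]
  split
  next => rfl
  next a l hal =>
    dsimp only
    let P : Bool × List Factor → Prop := fun b =>
      (ctrAll t.k fun e => monomial m e t.fs) = boolSign b.1 • ctrAll t.k fun e => monomial m e b.2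
    have hP : ∀ b ∈ a :: l, P b := by
      intro b hb
      rw [← hal, List.mem_map] at hb
      obtain ⟨fs, hfs, rfl⟩ := hb
      change _ = _
      rw [← relabelings_eq le_rfl hfs, ← ctrAll_smul]
      exact ctrAll_congr fun e => sortFactors_eq e fs
    obtain ⟨h1, h2⟩ := smallest_spec (P := P) (l := l) (monomialCode a.2) false (hP a (by simp))
      (fun b hb => hP b (by simp [hb])) (by simp)
    generalize smallest a (monomialCode a.2) false l = r at h1 h2
    obtain ⟨⟨s, fs⟩, z⟩ := r
    dsimp only [P] at h1 h2 ⊢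
    rw [eval, eval]
    cases z
    · rw [h1]
      cases s <;> simp [boolSign]
    · have h3 := h2 rfl
      -- A value that equals its own negative vanishes, as the Wick algebra is a real vector space.
      -- This detects monomials killed by the anticommutation of ghosts.
      have h4 : (ctrAll t.k fun e => monomial m e t.fs) = 0 := by
        have h5 : (2 : ℝ) • (ctrAll t.k fun e => monomial m e t.fs) = 0 := by
          rw [two_smul]
          nth_rewrite 1 [h1]
          rw [h3]
          cases s <;> simp [boolSign]
        exact (smul_eq_zero.1 h5).resolve_left two_ne_zero
      simp [h4]

theorem evalSum_addTerm (t : Term) (l : List Term) :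
    evalSum m (addTerm t l) = t.eval m + evalSum m l := by
  induction l with
  | nil => simp [addTerm, evalSum]
  | cons s l ih =>
    rw [addTerm]
    have h : evalSum m (s :: addTerm t l) = t.eval m + evalSum m (s :: l) := by
      rw [evalSum_cons, ih, evalSum_cons, add_left_comm]
    cases Nat.beq s.p t.p && (Nat.beq s.k t.k && Nat.beq (monomialCode s.fs) (monomialCode t.fs))
    · exact h
    · rw [cond_true]
      split_ifs with hst
      · obtain ⟨h1, h2, h3⟩ := hst
        rw [evalSum_cons, evalSum_cons, ← add_assoc]
        congr 1
        simp only [Term.eval, ← h1, ← h2, ← h3]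
        rw [← add_smul]
        push_cast
        ring_nf
      · exact h

theorem evalSum_collect (l : List Term) : evalSum m (collect l) = evalSum m l := by
  induction l with
  | nil => rfl
  | cons t l ih => rw [collect, evalSum_addTerm, ih, evalSum_cons]

theorem Term.eval_reduce (t : Term) : t.reduce.eval m = t.eval m := by
  simp only [reduce, eval_canonical, eval_kleinGordon, eval_contractEta]

/-- Soundness of the reflection: `collect` and `Term.reduce` preserve values, so vanishing
coefficients in the normal form force the value of the original list to be zero. -/
theorem evalSum_eq_zero {l : List Term} (h : vanishes l = true) : evalSum m l = 0 := by
  have h1 : evalSum m (collect (l.map Term.reduce)) = evalSum m l := by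
    rw [evalSum_collect, evalSum, List.map_map]
    simp [Function.comp_def, Term.eval_reduce, evalSum]
  rw [← h1, evalSum]
  refine List.sum_eq_zero fun w hw => ?_
  rw [List.mem_map] at hw
  obtain ⟨t, ht, rfl⟩ := hw
  have h2 := List.all_eq_true.1 h t ht
  rw [decide_eq_true_iff] at h2
  simp [Term.eval, h2]

variable {m : ℝ}

/-! ### The couplings as linear combinations of tensor monomials -/

/-- The derivative `∂_α` of the trace of `h`. -/
def traceJet (m : ℝ) (α : Multiset (Fin 4)) : Wick m := ctr fun ρ => jet m (.h ρ ρ) α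

/-- The derivative `∂_α` of the traceless part of `h`. -/
def tracelessJet (m : ℝ) (μ ν : Fin 4) (α : Multiset (Fin 4)) : Wick m :=
  jet m (.h μ ν) α - (1 / 4 : ℝ) • eta μ ν • traceJet m α

theorem pd_traceJet (ρ : Fin 4) (α : Multiset (Fin 4)) :
    pd m ρ (traceJet m α) = traceJet m (ρ ::ₘ α) := by
  refine (map_ctr ((pd m ρ).restrictScalars ℝ) _).trans ?_
  simp [traceJet, pd_jet]

theorem pd_tracelessJet (ρ μ ν : Fin 4) (α : Multiset (Fin 4)) :
    pd m ρ (tracelessJet m μ ν α) = tracelessJet m μ ν (ρ ::ₘ α) := by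
  simp only [tracelessJet, map_sub, pd_real_smul, pd_traceJet, pd_jet]

theorem tr_hField : tr (hField m) = traceJet m 0 := rfl

theorem ΦField_eq : ΦField m = (1 / 2 : ℝ) • traceJet m 0 := rfl

theorem HField_eq (μ ν : Fin 4) : HField m μ ν = tracelessJet m μ ν 0 := by
  rw [HField, ΦField_eq, tracelessJet, hField]
  module

theorem val_h (e : ℕ → Fin 4) (i j : ℕ) (d : List ℕ) :
    (Factor.h i j d).val m e = jet m (.h (e i) (e j)) (d.map e : List (Fin 4)) := rfl

theorem val_u (e : ℕ → Fin 4) (i : ℕ) (d : List ℕ) :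
    (Factor.u i d).val m e = jet m (.u (e i)) (d.map e : List (Fin 4)) := rfl

theorem val_ut (e : ℕ → Fin 4) (i : ℕ) (d : List ℕ) :
    (Factor.ut i d).val m e = jet m (.ut (e i)) (d.map e : List (Fin 4)) := rfl

theorem val_v (e : ℕ → Fin 4) (i : ℕ) (d : List ℕ) :
    (Factor.v i d).val m e = jet m (.v (e i)) (d.map e : List (Fin 4)) := rfl

theorem val_tr (e : ℕ → Fin 4) (d : List ℕ) :
    (Factor.tr d).val m e = traceJet m (d.map e : List (Fin 4)) := rfl

theorem val_traceless (e : ℕ → Fin 4) (i j : ℕ) (d : List ℕ) :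
    (Factor.traceless i j d).val m e =
      tracelessJet m (e i) (e j) (d.map e : List (Fin 4)) := rfl

/-- The labels in the term lists decrease from the outermost contraction inwards, the order in which
`ctrAll_succ` peels them off. Both sides therefore unfold to the same nested contractions, with no
renaming of indices. -/
theorem coupling_eq_evalSum :
    coupling m (wickD m) (hField m) (uField m) (utField m) (vField m) =
      evalSum m couplingTerms := by
  simp only [coupling, couplingTerms, evalSum_cons, evalSum_nil, Term.eval, ctrAll_succ,
    ctrAll_zero, monomial, List.map_cons, List.map_nil, List.prod_cons, List.prod_nil, val_tr,
    val_h, val_u, val_ut, val_v, ctr2, ctr3, ctr4, tr_hField, wickD, pow_succ (traceJet m 0), pow_zero]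
  simp [hField, uField, utField, vField, pd_jet, pd_traceJet, mul_assoc]
  module

/-- The coefficients in the list differ from those of `couplingHΦ` by a power of $\frac12$ for each
factor $\Phi=\frac12h$; for instance $-\frac34\Phi^3$ becomes $-\frac3{32}h^3$. -/
theorem couplingHΦ_eq_evalSum :
    couplingHΦ m (wickD m) (HField m) (ΦField m) (uField m) (utField m) (vField m) =
      evalSum m couplingHΦTerms := by
  have hpair : ∀ μ ν : Fin 4, (([μ, ν] : List (Fin 4)) : Multiset (Fin 4)) = μ ::ₘ {ν} :=
    fun _ _ => rfl
  simp only [couplingHΦ, couplingHΦTerms, evalSum_cons, evalSum_nil, Term.eval, ctrAll_succ,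
    ctrAll_zero, monomial, List.map_cons, List.map_nil, List.prod_cons, List.prod_nil, val_tr,
    val_traceless, val_u, val_ut, val_v, ctr2, ctr3, ctr4, wickD, ΦField_eq, HField_eq, pd_real_smul,
    smul_pow, pow_succ (traceJet m 0), pow_zero, smul_mul_assoc, mul_smul_comm, ctr_smul]
  simp [uField, utField, vField, pd_jet, pd_traceJet, pd_tracelessJet, hpair, mul_assoc]
  module

theorem current_eq_evalFreeSum (μ : Fin 4) :
    current m (wickD m) (hField m) (uField m) (utField m) (vField m) μ =
      evalFreeSum m μ currentTerms := by
  simp only [current, currentTerms, evalFreeSum, List.sum_cons, List.sum_nil, Term.evalFree,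
    ctrAll_succ, ctrAll_zero, monomial, List.map_cons, List.map_nil, List.prod_cons, List.prod_nil,
    val_tr, val_h, val_u, val_ut, val_v, ctr2, ctr3, tr_hField, wickD, pow_succ (traceJet m 0), pow_zero,
    mul_add, mul_sub, mul_neg, mul_smul_comm, mul_ctr, ctr_mul, ctr_add, ctr_sub, ctr_neg, ctr_smul]
  simp [hField, uField, utField, vField, pd_jet, pd_traceJet, mul_assoc]
  module

theorem tracelessJet_symm (μ ν : Fin 4) (α : Multiset (Fin 4)) :
    tracelessJet m μ ν α = tracelessJet m ν μ α := by
  have : eta μ ν = eta ν μ := by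
    rw [eta, ← Matrix.transpose_apply (Matrix.diagonal mink), Matrix.diagonal_transpose]
  rw [tracelessJet, tracelessJet, jet_symm, this]

theorem tr_HField : tr (HField m) = 0 := by
  simp only [tr, HField_eq, tracelessJet, ctr_sub, ctr_smul, ctr_eta_self]
  rw [← traceJet, smul_smul]
  norm_num

/-! ### Gauge invariance and equivalence -/

theorem dQ_coupling :
    dQ m (coupling m (wickD m) (hField m) (uField m) (utField m) (vField m)) =
      Complex.I • (ctr fun μ =>
        wickD m μ (current m (wickD m) (hField m) (uField m) (utField m) (vField m) μ)) := by
  have h1 : (expandAll 3 couplingTerms).all Term.isClosed = true := by decide +kernel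
  have h2 : currentTerms.all (fun t => noEta t.fs) = true := by decide +kernel
  have h3 := evalSum_eq_zero (m := m) vanishes_variation
  rw [evalSum_append, evalSum_scale, evalSum_expandAll] at h3
  -- The factor $2$ cancels the normalization $i/2$ of the computed variation and leaves the factor
  -- $i$ of the claim.
  have h4 : evalSum m ((expandAll 3 couplingTerms).flatMap Term.variation) =
      (2 : ℝ) • evalSum m (currentTerms.flatMap Term.divergence) := by
    rw [← sub_eq_zero, ← h3]
    push_cast
    module
  simp only [coupling_eq_evalSum, current_eq_evalFreeSum, wickD]
  rw [ctr_pd_evalFreeSum h2, ← evalSum_expandAll 3 couplingTerms, dQ_evalSum h1, h4]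
  module

theorem jetMonomial_mem_ghostNumber (e : ℕ → Fin 4) {fs : List Factor}
    (hf : fs.all Factor.isJet = true) :
    monomial m e fs ∈ ghostNumber m (fs.map Factor.gh).sum := by
  refine Submodule.subset_span ?_
  induction fs with
  | nil => exact ⟨[], rfl, rfl⟩
  | cons f fs ih =>
    simp only [List.all_cons, Bool.and_eq_true] at hf
    obtain ⟨l, hl, hw⟩ := ih hf.2
    have : ∃ a : Jet, a.1.gh = f.gh ∧ f.val m e = jet m a.1 a.2 := by
      have hf' := hf.1
      cases f <;> simp only [Factor.isJet, reduceCtorEq] at hf'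
      · exact ⟨(.h _ _, _), rfl, rfl⟩
      · exact ⟨(.u _, _), rfl, rfl⟩
      · exact ⟨(.ut _, _), rfl, rfl⟩
      · exact ⟨(.v _, _), rfl, rfl⟩
    obtain ⟨a, ha, hv⟩ := this
    refine ⟨a :: l, ?_, ?_⟩
    · simp [ha, hl]
    · rw [monomial_cons, hw, hv, List.map_cons, List.prod_cons]

theorem real_smul_mem_ghostNumber {k : ℤ} {w : Wick m} (c : ℝ) (hw : w ∈ ghostNumber m k) :
    c • w ∈ ghostNumber m k := by
  rw [← algebraMap_smul ℂ c w]
  exact Submodule.smul_mem _ _ hw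

theorem evalFreeSum_mem_ghostNumber (μ : Fin 4) {l : List Term}
    (hl : l.all (fun t => t.fs.all Factor.isJet && decide ((t.fs.map Factor.gh).sum = 0)) = true) :
    evalFreeSum m μ l ∈ ghostNumber m 0 := by
  refine list_sum_mem fun w hw => ?_
  rw [List.mem_map] at hw
  obtain ⟨t, ht, rfl⟩ := hw
  have h := List.all_eq_true.1 hl t ht
  rw [Bool.and_eq_true, decide_eq_true_iff] at h
  refine real_smul_mem_ghostNumber _ (Submodule.sum_mem _ fun e _ =>
    real_smul_mem_ghostNumber _ ?_)
  rw [← h.2]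
  exact jetMonomial_mem_ghostNumber _ h.1

theorem equivalentCouplings :
    EquivalentCouplings m
      (couplingHΦ m (wickD m) (HField m) (ΦField m) (uField m) (utField m) (vField m))
      (coupling m (wickD m) (hField m) (uField m) (utField m) (vField m)) := by
  -- The $d_Q$-exact part is zero. Trivial couplings are defined with an upper-index vector and a
  -- plain sum, so the lower-index vector is raised by the sign `mink μ`.
  refine ⟨0, Submodule.zero_mem _, fun μ => mink μ • evalFreeSum m μ differenceTerms, fun μ =>
    real_smul_mem_ghostNumber _ (evalFreeSum_mem_ghostNumber μ (by decide +kernel)), ?_⟩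
  have h2 : differenceTerms.all (fun t => noEta t.fs) = true := by decide +kernel
  have h3 := evalSum_eq_zero (m := m) vanishes_difference
  simp only [evalSum_append, evalSum_scale, evalSum_expandAll] at h3
  have h4 := ctr_pd_evalFreeSum (m := m) h2
  simp only [ctr, ← pd_real_smul] at h4
  rw [map_zero, zero_add, h4, coupling_eq_evalSum, couplingHΦ_eq_evalSum, ← sub_eq_zero, ← h3]
  push_cast
  module

/-! ### Algebra of the Christoffel symbols

Here `U` and `L` are mutually inverse symmetric matrices, and `l` is a tensor with
`l α μ ν = l α ν μ`, which will be `∂_α L_{μν}`. -/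

section ChristoffelAlgebra

/-- Contraction of two tensors with three lower indices. -/
def tensorInner (U : Matrix (Fin 4) (Fin 4) ℝ) (A B : Fin 4 → Fin 4 → Fin 4 → ℝ) : ℝ :=
  ∑ p : Fin 4 × Fin 4 × Fin 4, ∑ q : Fin 4 × Fin 4 × Fin 4,
    U p.1 q.1 * U p.2.1 q.2.1 * U p.2.2 q.2.2 * A p.1 p.2.1 p.2.2 * B q.1 q.2.1 q.2.2

/-- The one-form `φ_μ = -½ U^{ab} l_{μab}`. -/
def logDeriv (U : Matrix (Fin 4) (Fin 4) ℝ) (l : Fin 4 → Fin 4 → Fin 4 → ℝ) (μ : Fin 4) : ℝ :=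
  -(1 / 2) * ∑ a, ∑ b, U a b * l μ a b

/-- The tensor `φ_α L_{μν} + l_{αμν}`. -/
def metricDeriv (U L : Matrix (Fin 4) (Fin 4) ℝ) (l : Fin 4 → Fin 4 → Fin 4 → ℝ)
    (α μ ν : Fin 4) : ℝ :=
  logDeriv U l α * L μ ν + l α μ ν

/-- The Christoffel symbols with lowered first index, up to a conformal factor. -/
def christoffelLower (U L : Matrix (Fin 4) (Fin 4) ℝ) (l : Fin 4 → Fin 4 → Fin 4 → ℝ)
    (β μ ν : Fin 4) : ℝ :=
  1 / 2 * (metricDeriv U L l μ β ν + metricDeriv U L l ν β μ - metricDeriv U L l β μ ν)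

/-- The Christoffel symbols. -/
def christoffelUpper (U L : Matrix (Fin 4) (Fin 4) ℝ) (l : Fin 4 → Fin 4 → Fin 4 → ℝ)
    (α μ ν : Fin 4) : ℝ :=
  ∑ β, U α β * christoffelLower U L l β μ ν

/-- The derivative `∂_α U^{μν} = -U^{μa} U^{νb} l_{αab}`. -/
def inverseDeriv (U : Matrix (Fin 4) (Fin 4) ℝ) (l : Fin 4 → Fin 4 → Fin 4 → ℝ)
    (α μ ν : Fin 4) : ℝ :=
  -∑ a, ∑ b, U μ a * U ν b * l α a b

variable {U L : Matrix (Fin 4) (Fin 4) ℝ} {l : Fin 4 → Fin 4 → Fin 4 → ℝ}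

theorem tensorInner_add_left (A A' B : Fin 4 → Fin 4 → Fin 4 → ℝ) :
    tensorInner U (fun a b c => A a b c + A' a b c) B =
      tensorInner U A B + tensorInner U A' B := by
  simp only [tensorInner, ← Finset.sum_add_distrib]
  exact Finset.sum_congr rfl fun p _ => Finset.sum_congr rfl fun q _ => by ring

theorem tensorInner_sub_left (A A' B : Fin 4 → Fin 4 → Fin 4 → ℝ) :
    tensorInner U (fun a b c => A a b c - A' a b c) B =
      tensorInner U A B - tensorInner U A' B := by
  simp only [tensorInner, ← Finset.sum_sub_distrib]
  exact Finset.sum_congr rfl fun p _ => Finset.sum_congr rfl fun q _ => by ring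

theorem tensorInner_smul_left (c : ℝ) (A B : Fin 4 → Fin 4 → Fin 4 → ℝ) :
    tensorInner U (fun a b d => c * A a b d) B = c * tensorInner U A B := by
  simp only [tensorInner, Finset.mul_sum]
  exact Finset.sum_congr rfl fun p _ => Finset.sum_congr rfl fun q _ => by ring

theorem tensorInner_comm (hU : ∀ a b, U a b = U b a) (A B : Fin 4 → Fin 4 → Fin 4 → ℝ) :
    tensorInner U A B = tensorInner U B A := by
  rw [tensorInner, Finset.sum_comm]
  refine Finset.sum_congr rfl fun p _ => Finset.sum_congr rfl fun q _ => ?_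
  rw [hU p.1, hU p.2.1, hU p.2.2]
  ring

/-- Exchange of the first two components of a triple. -/
def swapFst : Fin 4 × Fin 4 × Fin 4 ≃ Fin 4 × Fin 4 × Fin 4 where
  toFun p := (p.2.1, p.1, p.2.2)
  invFun p := (p.2.1, p.1, p.2.2)
  left_inv _ := rfl
  right_inv _ := rfl

/-- Exchange of the last two components of a triple. -/
def swapSnd : Fin 4 × Fin 4 × Fin 4 ≃ Fin 4 × Fin 4 × Fin 4 where
  toFun p := (p.1, p.2.2, p.2.1)
  invFun p := (p.1, p.2.2, p.2.1)
  left_inv _ := rfl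
  right_inv _ := rfl

theorem tensorInner_swapFst (A B : Fin 4 → Fin 4 → Fin 4 → ℝ) :
    tensorInner U (fun a b c => A b a c) (fun a b c => B b a c) = tensorInner U A B :=
  Fintype.sum_equiv swapFst _ _ fun p => Fintype.sum_equiv swapFst _ _ fun q => by
    simp only [swapFst, Equiv.coe_fn_mk]
    ring

theorem tensorInner_swapSnd (A B : Fin 4 → Fin 4 → Fin 4 → ℝ) :
    tensorInner U (fun a b c => A a c b) (fun a b c => B a c b) = tensorInner U A B :=
  Fintype.sum_equiv swapSnd _ _ fun p => Fintype.sum_equiv swapSnd _ _ fun q => by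
    simp only [swapSnd, Equiv.coe_fn_mk]
    ring

theorem sum_mul_inverse (hUL : U * L = 1) (a c : Fin 4) :
    ∑ b, U a b * L b c = if a = c then 1 else 0 := by
  rw [← Matrix.mul_apply, hUL, Matrix.one_apply]

/-- Contraction with a tensor `φ_a L_{bc}`. -/
theorem tensorInner_tmul (hU : ∀ a b, U a b = U b a) (hUL : U * L = 1) (φ : Fin 4 → ℝ)
    (B : Fin 4 → Fin 4 → Fin 4 → ℝ) :
    tensorInner U (fun a b c => φ a * L b c) B =
      ∑ a, ∑ a', U a a' * φ a * ∑ b, ∑ c, U b c * B a' b c := by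
  have key : ∀ b' c', ∑ b, ∑ c, U b b' * U c c' * L b c = U b' c' := fun b' c' => by
    rw [Finset.sum_comm]
    have : ∀ c, ∑ b, U b b' * U c c' * L b c = if b' = c then U c c' else 0 := fun c => by
      have h := sum_mul_inverse hUL b' c
      have h2 : ∑ b, U b b' * U c c' * L b c = U c c' * ∑ b, U b' b * L b c := by
        rw [Finset.mul_sum]
        exact Finset.sum_congr rfl fun b _ => by rw [hU b b']; ring
      rw [h2, h]
      split_ifs <;> simp
    simp [this]
  simp only [tensorInner, Fintype.sum_prod_type]
  refine Finset.sum_congr rfl fun a _ => ?_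
  have h1 : ∀ a' b' c', ∑ b, ∑ c, U a a' * U b b' * U c c' * (φ a * L b c) * B a' b' c' =
      U a a' * φ a * (U b' c' * B a' b' c') := fun a' b' c' => by
    rw [← key b' c', Finset.sum_mul, Finset.mul_sum]
    refine Finset.sum_congr rfl fun b _ => ?_
    rw [Finset.sum_mul, Finset.mul_sum]
    exact Finset.sum_congr rfl fun c _ => by ring
  simp only [Finset.mul_sum, ← h1]
  rw [Finset.sum_congr rfl fun b _ => Finset.sum_comm, Finset.sum_comm]
  refine Finset.sum_congr rfl fun a' _ => ?_
  rw [Finset.sum_congr rfl fun b _ => Finset.sum_comm, Finset.sum_comm]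
  refine Finset.sum_congr rfl fun b' _ => ?_
  rw [Finset.sum_congr rfl fun b _ => Finset.sum_comm, Finset.sum_comm]

theorem christoffelUpper_symm (hL : ∀ a b, L a b = L b a) (hl : ∀ α a b, l α a b = l α b a)
    (α μ ν : Fin 4) : christoffelUpper U L l α μ ν = christoffelUpper U L l α ν μ := by
  simp only [christoffelUpper, christoffelLower, metricDeriv]
  refine Finset.sum_congr rfl fun β _ => ?_
  rw [hL μ ν, hl β μ ν]
  ring

/-- Dimension four enters through $U^{ab}L_{ab}=4$: the trace is $4\varphi_\mu-2\varphi_\mu$. -/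
theorem sum_mul_metricDeriv (hU : ∀ a b, U a b = U b a) (hUL : U * L = 1) (μ : Fin 4) :
    ∑ a, ∑ b, U a b * metricDeriv U L l μ a b = 2 * logDeriv U l μ := by
  have h1 : ∑ a, ∑ b, U a b * L a b = 4 := by
    have : ∀ b, ∑ a, U a b * L a b = 1 := fun b => by
      have h := sum_mul_inverse hUL b b
      rw [if_pos rfl] at h
      rw [← h]
      exact Finset.sum_congr rfl fun a _ => by rw [hU a b]
    rw [Finset.sum_comm]
    simp [this]
  have h2 : ∑ a, ∑ b, U a b * l μ a b = -2 * logDeriv U l μ := by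
    rw [logDeriv]; ring
  calc ∑ a, ∑ b, U a b * metricDeriv U L l μ a b
      = logDeriv U l μ * (∑ a, ∑ b, U a b * L a b) + ∑ a, ∑ b, U a b * l μ a b := by
        simp only [metricDeriv, Finset.mul_sum, ← Finset.sum_add_distrib]
        exact Finset.sum_congr rfl fun a _ => Finset.sum_congr rfl fun b _ => by ring
    _ = 2 * logDeriv U l μ := by rw [h1, h2]; ring

/-- This is $\Gamma^\alpha_{\mu\alpha}=\partial_\mu\log\sqrt{-g}$. Two of the three terms in the
Christoffel symbol are antisymmetric in the contracted pair and cancel against the symmetric $U$,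
leaving half of the trace of `metricDeriv`. -/
theorem sum_christoffelUpper_self (hU : ∀ a b, U a b = U b a) (hL : ∀ a b, L a b = L b a)
    (hUL : U * L = 1) (hl : ∀ α a b, l α a b = l α b a) (μ : Fin 4) :
    ∑ α, christoffelUpper U L l α μ α = logDeriv U l μ := by
  have hW : ∀ a b c, metricDeriv U L l a b c = metricDeriv U L l a c b := fun a b c => by
    rw [metricDeriv, metricDeriv, hL, hl]
  have h : ∑ α, ∑ β, U α β * (metricDeriv U L l α β μ - metricDeriv U L l β μ α) = 0 := by
    have : ∑ α, ∑ β, U α β * metricDeriv U L l α β μ =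
        ∑ α, ∑ β, U α β * metricDeriv U L l β μ α := by
      rw [Finset.sum_comm]
      exact Finset.sum_congr rfl fun a _ => Finset.sum_congr rfl fun b _ => by rw [hU, hW]
    simp only [mul_sub, Finset.sum_sub_distrib, this, sub_self]
  calc ∑ α, christoffelUpper U L l α μ α
      = 1 / 2 * (∑ α, ∑ β, U α β * metricDeriv U L l μ α β) + 1 / 2 *
          ∑ α, ∑ β, U α β * (metricDeriv U L l α β μ - metricDeriv U L l β μ α) := by
        simp only [christoffelUpper, christoffelLower, Finset.mul_sum, ← Finset.sum_add_distrib]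
        refine Finset.sum_congr rfl fun a _ => Finset.sum_congr rfl fun b _ => ?_
        rw [hW μ b a]
        ring
    _ = logDeriv U l μ := by rw [h, sum_mul_metricDeriv hU hUL]; ring

/-- The identity that makes Goldberg variables convenient. The conformal one-form $\varphi$ enters
the contraction $U^{\mu\nu}\Gamma_{\beta\mu\nu}$ once through the trace and once through
$U^{\mu\nu}\varphi_\mu L_{\beta\nu}=\varphi_\beta$, with opposite signs, so only the divergence of
$U$ survives. -/
theorem sum_mul_christoffelUpper (hU : ∀ a b, U a b = U b a) (hL : ∀ a b, L a b = L b a)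
    (hUL : U * L = 1) (α : Fin 4) :
    ∑ μ, ∑ ν, U μ ν * christoffelUpper U L l α μ ν = -∑ ν, inverseDeriv U l ν α ν := by
  have hd : ∀ β, ∑ μ, ∑ ν, U μ ν * christoffelLower U L l β μ ν =
      ∑ μ, ∑ ν, U μ ν * l μ β ν := fun β => by
    have h1 : ∑ μ, ∑ ν, U μ ν * metricDeriv U L l ν β μ =
        ∑ μ, ∑ ν, U μ ν * metricDeriv U L l μ β ν := by
      rw [Finset.sum_comm]
      exact Finset.sum_congr rfl fun a _ => Finset.sum_congr rfl fun b _ => by rw [hU]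
    have h2 : ∑ μ, ∑ ν, U μ ν * (logDeriv U l μ * L β ν) = logDeriv U l β := by
      have : ∀ μ, ∑ ν, U μ ν * (logDeriv U l μ * L β ν) =
          if μ = β then logDeriv U l μ else 0 := fun μ => by
        have h := sum_mul_inverse hUL μ β
        calc ∑ ν, U μ ν * (logDeriv U l μ * L β ν)
            = logDeriv U l μ * ∑ ν, U μ ν * L ν β := by
              rw [Finset.mul_sum]
              exact Finset.sum_congr rfl fun ν _ => by rw [hL β ν]; ring
          _ = _ := by rw [h]; split_ifs <;> simp
      simp [this]
    calc ∑ μ, ∑ ν, U μ ν * christoffelLower U L l β μ ν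
        = 1 / 2 * ((∑ μ, ∑ ν, U μ ν * metricDeriv U L l μ β ν)
            + (∑ μ, ∑ ν, U μ ν * metricDeriv U L l ν β μ)
            - ∑ μ, ∑ ν, U μ ν * metricDeriv U L l β μ ν) := by
          simp only [christoffelLower, Finset.mul_sum, ← Finset.sum_add_distrib,
            ← Finset.sum_sub_distrib]
          exact Finset.sum_congr rfl fun a _ => Finset.sum_congr rfl fun b _ => by ring
      _ = (∑ μ, ∑ ν, U μ ν * metricDeriv U L l μ β ν) - logDeriv U l β := by
          rw [h1, sum_mul_metricDeriv hU hUL]; ring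
      _ = ∑ μ, ∑ ν, U μ ν * l μ β ν := by
          nth_rewrite 1 [← h2]
          simp only [← Finset.sum_sub_distrib, metricDeriv]
          exact Finset.sum_congr rfl fun a _ => Finset.sum_congr rfl fun b _ => by ring
  calc ∑ μ, ∑ ν, U μ ν * christoffelUpper U L l α μ ν
      = ∑ β, U α β * ∑ μ, ∑ ν, U μ ν * christoffelLower U L l β μ ν := by
        simp only [christoffelUpper, Finset.mul_sum]
        rw [Finset.sum_congr rfl fun b _ => Finset.sum_comm, Finset.sum_comm]
        exact Finset.sum_congr rfl fun a _ => Finset.sum_congr rfl fun b _ =>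
          Finset.sum_congr rfl fun c _ => by ring
    _ = -∑ ν, inverseDeriv U l ν α ν := by
        simp only [hd, inverseDeriv, Finset.sum_neg_distrib, neg_neg, Finset.mul_sum]
        rw [Finset.sum_comm]
        refine Finset.sum_congr rfl fun a _ => Finset.sum_congr rfl fun b _ =>
          Finset.sum_congr rfl fun c _ => by ring

theorem tensorInner_add_right (hU : ∀ a b, U a b = U b a) (A B B' : Fin 4 → Fin 4 → Fin 4 → ℝ) :
    tensorInner U A (fun a b c => B a b c + B' a b c) =
      tensorInner U A B + tensorInner U A B' := by
  rw [tensorInner_comm hU, tensorInner_add_left, tensorInner_comm hU B, tensorInner_comm hU B']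

theorem tensorInner_sub_right (hU : ∀ a b, U a b = U b a) (A B B' : Fin 4 → Fin 4 → Fin 4 → ℝ) :
    tensorInner U A (fun a b c => B a b c - B' a b c) =
      tensorInner U A B - tensorInner U A B' := by
  rw [tensorInner_comm hU, tensorInner_sub_left, tensorInner_comm hU B, tensorInner_comm hU B']

theorem tensorInner_smul_right (hU : ∀ a b, U a b = U b a) (r : ℝ)
    (A B : Fin 4 → Fin 4 → Fin 4 → ℝ) :
    tensorInner U A (fun a b c => r * B a b c) = r * tensorInner U A B := by
  rw [tensorInner_comm hU, tensorInner_smul_left, tensorInner_comm hU B]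

/-! ### Pairings of permuted tensors that are symmetric in their last two slots -/

section SymmetricTensors

variable {A B : Fin 4 → Fin 4 → Fin 4 → ℝ}

theorem tensorInner_left_swap (A B : Fin 4 → Fin 4 → Fin 4 → ℝ) :
    tensorInner U (fun a b c => A b a c) B = tensorInner U A (fun a b c => B b a c) :=
  tensorInner_swapFst A fun a b c => B b a c

theorem tensorInner_right_cycle (hA : ∀ a b c, A a b c = A a c b) :
    tensorInner U A (fun a b c => B c a b) = tensorInner U A (fun a b c => B b a c) := by
  rw [← tensorInner_swapSnd]
  congr 1
  funext a b c
  exact hA a c b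

theorem tensorInner_swap_cycle (hA : ∀ a b c, A a b c = A a c b)
    (hB : ∀ a b c, B a b c = B a c b) :
    tensorInner U (fun a b c => A b a c) (fun a b c => B c a b) =
      tensorInner U A (fun a b c => B b a c) := by
  refine (tensorInner_left_swap A _).trans (Eq.trans ?_ (tensorInner_right_cycle hA))
  congr 1
  funext a b c
  exact hB c b a

theorem tensorInner_cycle_cycle (A B : Fin 4 → Fin 4 → Fin 4 → ℝ) :
    tensorInner U (fun a b c => A c a b) (fun a b c => B c a b) = tensorInner U A B :=
  (tensorInner_swapSnd (fun a b c => A b a c) fun a b c => B b a c).trans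
    (tensorInner_swapFst A B)

end SymmetricTensors

/-- The part of the Einstein-Hilbert Lagrangian that is quadratic in the first derivatives. -/
theorem christoffel_quadratic (hU : ∀ a b, U a b = U b a) (hL : ∀ a b, L a b = L b a)
    (hUL : U * L = 1) (hl : ∀ α a b, l α a b = l α b a) :
    tensorInner U l (christoffelLower U L l)
      - tensorInner U (christoffelLower U L l) (fun a b c => christoffelLower U L l c b a) =
    1 / 2 * (∑ a, ∑ b, U a b * logDeriv U l a * logDeriv U l b)
      - 1 / 4 * tensorInner U l l + 1 / 2 * tensorInner U l (fun a b c => l b a c) := by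
  set W := metricDeriv U L l with hWdef
  set F : Fin 4 → Fin 4 → Fin 4 → ℝ := fun a b c => logDeriv U l a * L b c with hF
  have hFs : ∀ a b c, F a b c = F a c b := fun a b c => by simp only [hF, hL b c]
  have hW : ∀ a b c, W a b c = W a c b := fun a b c => by
    rw [hWdef, metricDeriv, metricDeriv, hL, hl]
  have hWF : W = fun a b c => F a b c + l a b c := rfl
  have hΓ : christoffelLower U L l = fun a b c =>
      1 / 2 * (W b a c + W c a b - W a b c) := rfl
  have hΓr : (fun a b c => christoffelLower U L l c b a) = fun a b c =>
      1 / 2 * (W b a c + W a b c - W c a b) := by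
    funext a b c
    rw [hΓ]
    simp only [hW b c a, hW a c b, hW c b a]
  have hcomm : ∀ A B : Fin 4 → Fin 4 → Fin 4 → ℝ,
      tensorInner U A (fun a b c => B b a c) = tensorInner U B (fun a b c => A b a c) :=
    fun A B => by rw [← tensorInner_left_swap, tensorInner_comm hU]
  have h1 : tensorInner U l (christoffelLower U L l) =
      tensorInner U l (fun a b c => W b a c) - 1 / 2 * tensorInner U l W := by
    rw [hΓ, tensorInner_smul_right hU, tensorInner_sub_right hU, tensorInner_add_right hU,
      tensorInner_right_cycle hl]
    ring
  -- Write $\sigma$ for the exchange of the first two slots. As $W$ is symmetric in the last two,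
  -- the nine pairings of its permuted copies reduce to the two numbers $\langle W,W\rangle$ and
  -- $\langle W,\sigma W\rangle$.
  have h2 : tensorInner U (christoffelLower U L l) (fun a b c => christoffelLower U L l c b a) =
      1 / 4 * (2 * tensorInner U W (fun a b c => W b a c) - tensorInner U W W) := by
    rw [hΓr, hΓ]
    simp only [tensorInner_smul_right hU, tensorInner_smul_left, tensorInner_sub_right hU,
      tensorInner_add_right hU, tensorInner_sub_left, tensorInner_add_left]
    have e1 := tensorInner_swapFst (U := U) W W
    have e2 := tensorInner_cycle_cycle (U := U) W W
    have e3 := tensorInner_swap_cycle (U := U) hW hW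
    have e4 := tensorInner_right_cycle (U := U) (B := W) hW
    have e5 := tensorInner_left_swap (U := U) W W
    have e6 := (tensorInner_comm hU (fun a b c => W c a b) fun a b c => W b a c).trans e3
    have e7 := (tensorInner_comm hU (fun a b c => W c a b) W).trans e4
    linarith
  have hFl : tensorInner U F l =
      -2 * ∑ a, ∑ b, U a b * logDeriv U l a * logDeriv U l b := by
    rw [tensorInner_tmul hU hUL, Finset.mul_sum]
    refine Finset.sum_congr rfl fun a _ => ?_
    rw [Finset.mul_sum]
    refine Finset.sum_congr rfl fun b _ => ?_
    rw [logDeriv, logDeriv]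
    ring
  -- Instead of computing the trace of $L$ again, this is read off from $\langle F,W\rangle$, known
  -- by `sum_mul_metricDeriv`, and $W=F+l$.
  have hFF : tensorInner U F F = 4 * ∑ a, ∑ b, U a b * logDeriv U l a * logDeriv U l b := by
    have hW2 : tensorInner U F W = 2 * ∑ a, ∑ b, U a b * logDeriv U l a * logDeriv U l b := by
      rw [tensorInner_tmul hU hUL, Finset.mul_sum]
      refine Finset.sum_congr rfl fun a _ => ?_
      rw [Finset.mul_sum]
      refine Finset.sum_congr rfl fun b _ => ?_
      rw [sum_mul_metricDeriv hU hUL]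
      ring
    rw [hWF, tensorInner_add_right hU, hFl] at hW2
    linarith
  have hFσF : tensorInner U F (fun a b c => F b a c) =
      ∑ a, ∑ b, U a b * logDeriv U l a * logDeriv U l b := by
    rw [tensorInner_tmul hU hUL]
    refine Finset.sum_congr rfl fun a _ => Finset.sum_congr rfl fun b _ => ?_
    congr 1
    have : ∀ c, ∑ d, U c d * (logDeriv U l c * L b d) =
        if c = b then logDeriv U l c else 0 := fun c => by
      have h := sum_mul_inverse hUL c b
      calc ∑ d, U c d * (logDeriv U l c * L b d)
          = logDeriv U l c * ∑ d, U c d * L d b := by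
            rw [Finset.mul_sum]
            exact Finset.sum_congr rfl fun d _ => by rw [hL b d]; ring
        _ = _ := by rw [h]; split_ifs <;> simp
    simp only [hF, this, Finset.sum_ite_eq', Finset.mem_univ, if_true]
  have hlW : tensorInner U l W = tensorInner U F l + tensorInner U l l := by
    rw [hWF, tensorInner_add_right hU, tensorInner_comm hU l F]
  have hlσW : tensorInner U l (fun a b c => W b a c) =
      tensorInner U F (fun a b c => l b a c) + tensorInner U l (fun a b c => l b a c) := by
    rw [hWF, tensorInner_add_right hU, hcomm l F]
  have hWW : tensorInner U W W =
      tensorInner U F F + 2 * tensorInner U F l + tensorInner U l l := by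
    rw [hWF, tensorInner_add_right hU, tensorInner_add_left, tensorInner_add_left,
      tensorInner_comm hU l F]
    ring
  have hWσW : tensorInner U W (fun a b c => W b a c) =
      tensorInner U F (fun a b c => F b a c) + 2 * tensorInner U F (fun a b c => l b a c)
        + tensorInner U l (fun a b c => l b a c) := by
    rw [hWF, tensorInner_add_right hU, tensorInner_add_left, tensorInner_add_left, hcomm l F]
    ring
  -- The mixed pairing $\langle F,\sigma l\rangle$ has not been evaluated; it cancels between the
  -- two halves.
  rw [h1, h2, hlW, hlσW, hWW, hWσW, hFl, hFF, hFσF]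
  ring

/-! ### Moving an inner summation to the front -/

section SumOrder

variable {M : Type*} [AddCommMonoid M]

theorem sum_front_three (f : Fin 4 → Fin 4 → Fin 4 → M) :
    ∑ a, ∑ b, ∑ c, f a b c = ∑ c, ∑ a, ∑ b, f a b c := by
  rw [Finset.sum_congr rfl fun a _ => Finset.sum_comm, Finset.sum_comm]

theorem sum_front_four (f : Fin 4 → Fin 4 → Fin 4 → Fin 4 → M) :
    ∑ a, ∑ b, ∑ c, ∑ d, f a b c d = ∑ d, ∑ a, ∑ b, ∑ c, f a b c d := by
  rw [Finset.sum_congr rfl fun a _ => sum_front_three (f a), Finset.sum_comm]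

theorem sum_front_five (f : Fin 4 → Fin 4 → Fin 4 → Fin 4 → Fin 4 → M) :
    ∑ a, ∑ b, ∑ c, ∑ d, ∑ e, f a b c d e = ∑ e, ∑ a, ∑ b, ∑ c, ∑ d, f a b c d e := by
  rw [Finset.sum_congr rfl fun a _ => sum_front_four (f a), Finset.sum_comm]

end SumOrder

/-- $\partial U$ is $-l$ with its last two indices raised, and the explicit $U$ raises the first
one. -/
theorem sum_mul_inverseDeriv_mul (hU : ∀ a b, U a b = U b a)
    (B : Fin 4 → Fin 4 → Fin 4 → ℝ) :
    ∑ α, ∑ β, ∑ μ, ∑ ν, U α β * inverseDeriv U l α μ ν * B β μ ν = -tensorInner U l B := by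
  have h : ∀ α, ∑ β, ∑ μ, ∑ ν, U α β * inverseDeriv U l α μ ν * B β μ ν =
      -∑ a, ∑ b, ∑ β, ∑ μ, ∑ ν, U α β * U a μ * U b ν * l α a b * B β μ ν := fun α => by
    calc ∑ β, ∑ μ, ∑ ν, U α β * inverseDeriv U l α μ ν * B β μ ν
        = -∑ β, ∑ μ, ∑ ν, ∑ a, ∑ b, U α β * U a μ * U b ν * l α a b * B β μ ν := by
          simp only [inverseDeriv, ← Finset.sum_neg_distrib, Finset.mul_sum, Finset.sum_mul]
          refine Finset.sum_congr rfl fun β _ => Finset.sum_congr rfl fun μ _ =>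
            Finset.sum_congr rfl fun ν _ => Finset.sum_congr rfl fun a _ =>
            Finset.sum_congr rfl fun b _ => ?_
          rw [hU a μ, hU b ν]
          ring
      _ = _ := by
          rw [sum_front_five, Finset.sum_congr rfl fun b _ => sum_front_four _, Finset.sum_comm]
  simp only [h, tensorInner, Fintype.sum_prod_type, Finset.sum_neg_distrib]

theorem sum_inverseDeriv_mul_christoffelUpper (hU : ∀ a b, U a b = U b a) :
    ∑ α, ∑ μ, ∑ ν, inverseDeriv U l α μ ν * christoffelUpper U L l α μ ν =
      -tensorInner U l (christoffelLower U L l) := by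
  rw [← sum_mul_inverseDeriv_mul hU]
  refine Finset.sum_congr rfl fun α _ => ?_
  refine Eq.trans ?_ (sum_front_three _)
  refine Finset.sum_congr rfl fun μ _ => Finset.sum_congr rfl fun ν _ => ?_
  rw [christoffelUpper, Finset.mul_sum]
  exact Finset.sum_congr rfl fun β _ => by ring

theorem sum_mul_christoffelUpper_mul (hU : ∀ a b, U a b = U b a) (hL : ∀ a b, L a b = L b a)
    (hl : ∀ α a b, l α a b = l α b a) :
    ∑ μ, ∑ ν, ∑ α, ∑ β, U μ ν * (christoffelUpper U L l α ν β * christoffelUpper U L l β α μ) =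
      tensorInner U (christoffelLower U L l) (fun a b c => christoffelLower U L l c b a) := by
  have hs : ∀ a b c, christoffelLower U L l a b c = christoffelLower U L l a c b := fun a b c => by
    simp only [christoffelLower, metricDeriv, hL b c, hl a b c]
    ring
  simp only [tensorInner, Fintype.sum_prod_type, christoffelUpper, Finset.sum_mul_sum]
  simp only [Finset.mul_sum]
  rw [sum_front_five]
  refine Finset.sum_congr rfl fun α' _ => ?_
  rw [Finset.sum_comm]
  refine Finset.sum_congr rfl fun ν _ => ?_
  rw [sum_front_three]
  refine Finset.sum_congr rfl fun β _ => ?_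
  rw [Finset.sum_comm]
  refine Finset.sum_congr rfl fun α _ => Finset.sum_congr rfl fun μ _ =>
    Finset.sum_congr rfl fun β' _ => ?_
  rw [hU μ ν, hU α α', hs β' α μ]
  ring

/-- Together with its consequences below, this translates the quadratic expressions in $l=\partial
L$ back into $\partial U$, the variable in which the Lagrangian is expanded. -/
theorem lower_inverseDeriv (hLU : L * U = 1) (α μ σ : Fin 4) :
    ∑ ν, L μ ν * inverseDeriv U l α ν σ = -∑ b, U σ b * l α μ b := by
  have h := sum_mul_inverse hLU μ
  calc ∑ ν, L μ ν * inverseDeriv U l α ν σ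
      = -∑ a, ∑ b, (∑ ν, L μ ν * U ν a) * (U σ b * l α a b) := by
        simp only [inverseDeriv, mul_neg, Finset.sum_neg_distrib, Finset.mul_sum, Finset.sum_mul]
        congr 1
        refine Eq.trans ?_ (sum_front_three _).symm
        exact Finset.sum_congr rfl fun ν _ => Finset.sum_congr rfl fun a _ =>
          Finset.sum_congr rfl fun b _ => by ring
    _ = -∑ b, U σ b * l α μ b := by
        simp only [h, ite_mul, one_mul, zero_mul]
        rw [Finset.sum_comm]
        simp

/-- Lowering both upper indices of one factor turns it into $-l$; the sign is compensated by the
sign in `sum_mul_inverseDeriv_mul`. -/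
theorem sum_inverseDeriv_sq (hU : ∀ a b, U a b = U b a) (hLU : L * U = 1) :
    ∑ μ, ∑ ν, ∑ a, ∑ b, ∑ c, ∑ d, U μ ν * L a c * L b d
        * inverseDeriv U l μ a b * inverseDeriv U l ν c d = tensorInner U l l := by
  have h : ∀ ν a b, ∑ c, ∑ d, L a c * L b d * inverseDeriv U l ν c d = -l ν a b := by
    intro ν a b
    calc ∑ c, ∑ d, L a c * L b d * inverseDeriv U l ν c d
        = ∑ d, L b d * ∑ c, L a c * inverseDeriv U l ν c d := by
          rw [Finset.sum_comm]
          refine Finset.sum_congr rfl fun d _ => ?_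
          rw [Finset.mul_sum]
          exact Finset.sum_congr rfl fun c _ => by ring
      _ = -∑ e, (∑ d, L b d * U d e) * l ν a e := by
          simp only [lower_inverseDeriv hLU, mul_neg, Finset.sum_neg_distrib, Finset.mul_sum,
            Finset.sum_mul]
          rw [Finset.sum_comm]
          simp only [mul_assoc]
      _ = -l ν a b := by
          simp [sum_mul_inverse hLU]
  have h2 := sum_mul_inverseDeriv_mul (l := l) hU l
  rw [← neg_eq_iff_eq_neg] at h2
  rw [← h2]
  simp only [← Finset.sum_neg_distrib]
  refine Finset.sum_congr rfl fun μ _ => Finset.sum_congr rfl fun ν _ =>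
    Finset.sum_congr rfl fun a _ => Finset.sum_congr rfl fun b _ => ?_
  rw [← mul_neg, ← h ν a b, Finset.mul_sum]
  refine Finset.sum_congr rfl fun c _ => ?_
  rw [Finset.mul_sum]
  exact Finset.sum_congr rfl fun d _ => by ring

theorem sum_inverseDeriv_mul_swap (hU : ∀ a b, U a b = U b a) (hL : ∀ a b, L a b = L b a)
    (hLU : L * U = 1) (hl : ∀ α a b, l α a b = l α b a) :
    ∑ μ, ∑ ν, ∑ ρ, ∑ σ, L μ ν * inverseDeriv U l ρ μ σ * inverseDeriv U l σ ν ρ =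
      tensorInner U l (fun a b c => l b a c) := by
  have h1 : tensorInner U l (fun a b c => l b a c) = tensorInner U l (fun a b c => l c b a) := by
    rw [← tensorInner_right_cycle hl]
    congr 1
    funext a b c
    exact hl c a b
  have h2 := sum_mul_inverseDeriv_mul (l := l) hU fun a b c => l c b a
  rw [← neg_eq_iff_eq_neg] at h2
  rw [h1, ← h2, Finset.sum_comm]
  simp only [← Finset.sum_neg_distrib]
  calc ∑ ν, ∑ μ, ∑ ρ, ∑ σ, L μ ν * inverseDeriv U l ρ μ σ * inverseDeriv U l σ ν ρ
      = ∑ ν, ∑ ρ, ∑ σ, (∑ μ, L ν μ * inverseDeriv U l ρ μ σ) * inverseDeriv U l σ ν ρ := by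
        refine Finset.sum_congr rfl fun ν _ => ?_
        simp only [Finset.sum_mul]
        refine Eq.trans ?_ (sum_front_three _).symm
        exact Finset.sum_congr rfl fun μ _ => Finset.sum_congr rfl fun ρ _ =>
          Finset.sum_congr rfl fun σ _ => by rw [hL μ ν]
    _ = ∑ ν, ∑ ρ, ∑ σ, ∑ b, -(U σ b * inverseDeriv U l σ ν ρ * l ρ ν b) := by
        simp only [lower_inverseDeriv hLU, Finset.sum_mul, ← Finset.sum_neg_distrib]
        exact Finset.sum_congr rfl fun ν _ => Finset.sum_congr rfl fun ρ _ =>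
          Finset.sum_congr rfl fun σ _ => Finset.sum_congr rfl fun b _ => by ring
    _ = _ := by
        rw [sum_front_four, Finset.sum_congr rfl fun b _ => sum_front_three _, Finset.sum_comm]

/-- The two expressions $\frac12L\,\partial U$ and $-\frac12U\,\partial L$ for the logarithmic
derivative agree, as $U$ and $L$ are inverse to each other. -/
theorem sum_mul_inverseDeriv (hL : ∀ a b, L a b = L b a) (hLU : L * U = 1) (μ : Fin 4) :
    1 / 2 * ∑ a, ∑ b, L a b * inverseDeriv U l μ a b = logDeriv U l μ := by
  rw [logDeriv, neg_mul, ← mul_neg]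
  congr 1
  calc ∑ a, ∑ b, L a b * inverseDeriv U l μ a b
      = ∑ b, -∑ c, U b c * l μ b c := by
        rw [Finset.sum_comm]
        refine Finset.sum_congr rfl fun b _ => ?_
        rw [← lower_inverseDeriv hLU]
        exact Finset.sum_congr rfl fun a _ => by rw [hL a b]
    _ = -∑ a, ∑ b, U a b * l μ a b := by rw [Finset.sum_neg_distrib]

end ChristoffelAlgebra

/-! ### Partial derivatives -/

section ClassD

variable {f g : Spacetime → ℝ} {x : Spacetime}

theorem classD_add (hf : DifferentiableAt ℝ f x) (hg : DifferentiableAt ℝ g x) (μ : Fin 4) :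
    classD μ (fun y => f y + g y) x = classD μ f x + classD μ g x := by
  simp only [classD]
  rw [fderiv_fun_add hf hg]
  rfl

theorem classD_mul (hf : DifferentiableAt ℝ f x) (hg : DifferentiableAt ℝ g x) (μ : Fin 4) :
    classD μ (fun y => f y * g y) x = classD μ f x * g x + f x * classD μ g x := by
  simp only [classD]
  rw [fderiv_fun_mul hf hg]
  simp [mul_comm, add_comm]

theorem classD_const_mul (hf : DifferentiableAt ℝ f x) (c : ℝ) (μ : Fin 4) :
    classD μ (fun y => c * f y) x = c * classD μ f x := by
  simp only [classD]
  rw [fderiv_const_mul hf]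
  rfl

theorem classD_neg (f : Spacetime → ℝ) (x : Spacetime) (μ : Fin 4) :
    classD μ (fun y => -f y) x = -classD μ f x := by
  simp only [classD]
  rw [fderiv_fun_neg]
  rfl

theorem classD_const (c : ℝ) (x : Spacetime) (μ : Fin 4) : classD μ (fun _ => c) x = 0 := by
  simp [classD]

theorem classD_sum {ι : Type*} {s : Finset ι} {F : ι → Spacetime → ℝ}
    (hF : ∀ i ∈ s, DifferentiableAt ℝ (F i) x) (μ : Fin 4) :
    classD μ (fun y => ∑ i ∈ s, F i y) x = ∑ i ∈ s, classD μ (F i) x := by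
  simp only [classD]
  rw [fderiv_fun_sum hF]
  simp

theorem classD_congr (h : f =ᶠ[𝓝 x] g) (μ : Fin 4) : classD μ f x = classD μ g x := by
  simp only [classD, h.fderiv_eq]

theorem contDiffAt_classD (hf : ContDiffAt ℝ ∞ f x) (μ : Fin 4) :
    ContDiffAt ℝ ∞ (classD μ f) x :=
  (hf.fderiv_right (by simp)).clm_apply contDiffAt_const

end ClassD

/-! ### The determinant and the inverse -/

section Determinant

theorem contDiffAt_det {U : Spacetime → Matrix (Fin 4) (Fin 4) ℝ} {x : Spacetime}
    (hU : ∀ μ ν, ContDiffAt ℝ ∞ (fun y => U y μ ν) x) :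
    ContDiffAt ℝ ∞ (fun y => (U y).det) x := by
  simp only [Matrix.det_apply]
  exact ContDiffAt.sum fun σ _ => (contDiffAt_prod fun i _ => hU _ _).const_smul _

/-- Cramer's rule: each entry of the adjugate is a determinant of $U$ with one row replaced by a
constant vector. -/
theorem contDiffAt_inv {U : Spacetime → Matrix (Fin 4) (Fin 4) ℝ} {x : Spacetime}
    (hU : ∀ μ ν, ContDiffAt ℝ ∞ (fun y => U y μ ν) x) (hdet : (U x).det ≠ 0) (μ ν : Fin 4) :
    ContDiffAt ℝ ∞ (fun y => (U y)⁻¹ μ ν) x := by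
  simp only [Matrix.inv_def, Ring.inverse_eq_inv', Matrix.smul_apply, smul_eq_mul,
    Matrix.adjugate_apply]
  refine ((contDiffAt_det hU).inv hdet).mul (contDiffAt_det fun a b => ?_)
  by_cases h : a = ν
  · subst h
    simp only [Matrix.updateRow_self]
    exact contDiffAt_const
  · simp only [Matrix.updateRow_ne h]
    exact hU a b

theorem eventually_det_ne_zero {U : Spacetime → Matrix (Fin 4) (Fin 4) ℝ} {x : Spacetime}
    (hU : ∀ μ ν, ContDiffAt ℝ ∞ (fun y => U y μ ν) x) (hdet : (U x).det ≠ 0) :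
    ∀ᶠ y in 𝓝 x, (U y).det ≠ 0 :=
  (contDiffAt_det hU).continuousAt.eventually_ne hdet

/-- Differentiate $UU^{-1}=1$, which holds on a neighbourhood of the point, and multiply by $U^{-1}$
from the left. -/
theorem classD_inv {U : Spacetime → Matrix (Fin 4) (Fin 4) ℝ} {x : Spacetime}
    (hU : ∀ μ ν, ContDiffAt ℝ ∞ (fun y => U y μ ν) x) (hdet : (U x).det ≠ 0) (α a b : Fin 4) :
    classD α (fun y => (U y)⁻¹ a b) x =
      -∑ c, ∑ d, (U x)⁻¹ a c * classD α (fun y => U y c d) x * (U x)⁻¹ d b := by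
  have hUd : ∀ c d, DifferentiableAt ℝ (fun y => U y c d) x := fun c d =>
    (hU c d).differentiableAt (by simp)
  have hLd : ∀ c d, DifferentiableAt ℝ (fun y => (U y)⁻¹ c d) x := fun c d =>
    (contDiffAt_inv hU hdet c d).differentiableAt (by simp)
  have h1 : ∀ c, ∑ d, (classD α (fun y => U y c d) x * (U x)⁻¹ d b
      + U x c d * classD α (fun y => (U y)⁻¹ d b) x) = 0 := fun c => by
    have h2 : (fun y => ∑ d, U y c d * (U y)⁻¹ d b) =ᶠ[𝓝 x]
        fun _ => (1 : Matrix (Fin 4) (Fin 4) ℝ) c b := by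
      filter_upwards [eventually_det_ne_zero hU hdet] with y hy
      rw [← Matrix.mul_apply, Matrix.mul_nonsing_inv _ (isUnit_iff_ne_zero.2 hy)]
    have h3 := classD_congr h2 α
    rw [classD_const, classD_sum fun d _ => (hUd c d).fun_mul (hLd d b)] at h3
    rw [← h3]
    exact Finset.sum_congr rfl fun d _ => (classD_mul (hUd c d) (hLd d b) α).symm
  have h4 : ∑ c, ∑ d, (U x)⁻¹ a c * (U x c d * classD α (fun y => (U y)⁻¹ d b) x) =
      classD α (fun y => (U y)⁻¹ a b) x := by
    have h5 := Matrix.nonsing_inv_mul _ (isUnit_iff_ne_zero.2 hdet)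
    rw [Finset.sum_comm]
    have : ∀ d, ∑ c, (U x)⁻¹ a c * (U x c d * classD α (fun y => (U y)⁻¹ d b) x) =
        if a = d then classD α (fun y => (U y)⁻¹ d b) x else 0 := fun d => by
      simp only [← mul_assoc, ← Finset.sum_mul]
      rw [sum_mul_inverse h5]
      split_ifs <;> simp
    simp [this]
  rw [← h4, ← sub_eq_zero, sub_neg_eq_add, ← Finset.sum_add_distrib]
  refine Finset.sum_eq_zero fun c _ => ?_
  rw [← Finset.sum_add_distrib, ← mul_zero ((U x)⁻¹ a c), ← h1 c, Finset.mul_sum]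
  exact Finset.sum_congr rfl fun d _ => by ring

/-- Jacobi's formula for the derivative of the determinant. -/
theorem hasDerivAt_det_line (M V : Matrix (Fin 4) (Fin 4) ℝ) (hM : M.det ≠ 0) :
    HasDerivAt (fun t : ℝ => (M + t • V).det) (M.det * (M⁻¹ * V).trace) 0 := by
  -- The polynomial $\det(1+tM^{-1}V)$ with its constant and linear terms stripped off and divided
  -- by $t^2$; the remainder $t^2q(t)$ does not contribute to the derivative at $0$.
  set q := (1 + (Polynomial.X : Polynomial ℝ) • (M⁻¹ * V).map Polynomial.C).det.divX.divX with hq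
  have h1 : (fun t : ℝ => (M + t • V).det) =
      fun t => M.det * (1 + (M⁻¹ * V).trace * t + q.eval t * t ^ 2) := by
    funext t
    rw [hq, ← Matrix.det_one_add_smul, ← Matrix.det_mul, mul_add, mul_one, Matrix.mul_smul,
      ← mul_assoc, Matrix.mul_nonsing_inv _ (isUnit_iff_ne_zero.2 hM), one_mul]
  rw [h1]
  refine HasDerivAt.const_mul _ ?_
  have h2 : HasDerivAt (fun t : ℝ => q.eval t * t ^ 2) 0 0 := by
    simpa using (q.hasDerivAt 0).fun_mul (hasDerivAt_pow 2 (0 : ℝ))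
  simpa using (((hasDerivAt_id (0 : ℝ)).const_mul (M⁻¹ * V).trace).const_add 1).fun_add h2

theorem classD_det {U : Spacetime → Matrix (Fin 4) (Fin 4) ℝ} {x : Spacetime}
    (hU : ∀ μ ν, ContDiffAt ℝ ∞ (fun y => U y μ ν) x) (hdet : (U x).det ≠ 0) (α : Fin 4) :
    classD α (fun y => (U y).det) x =
      (U x).det * ∑ a, ∑ b, (U x)⁻¹ a b * classD α (fun y => U y b a) x := by
  let detFun : (Fin 4 → Fin 4 → ℝ) → ℝ := fun M => (Matrix.of M).det
  have hd : Differentiable ℝ detFun := by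
    have : ContDiff ℝ ∞ detFun := by
      simp only [detFun, Matrix.det_apply, Matrix.of_apply]
      exact ContDiff.sum fun σ _ =>
        (contDiff_prod fun i _ => contDiff_apply_apply _ _ _ _).const_smul _
    exact this.differentiable (by simp)
  let V : Fin 4 → Fin 4 → ℝ := fun a b => classD α (fun y => U y a b) x
  let M : Fin 4 → Fin 4 → ℝ := fun a b => U x a b
  -- The directional derivative is identified by uniqueness, by restricting the determinant to the
  -- line $M+tV$.
  have h1 : fderiv ℝ detFun M V = (U x).det * ((U x)⁻¹ * Matrix.of V).trace := by
    have h2 : HasDerivAt (fun t : ℝ => M + t • V) V 0 := by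
      simpa using ((hasDerivAt_id (0 : ℝ)).smul_const V).const_add M
    have h3 := HasFDerivAt.comp_hasDerivAt (0 : ℝ) (f := fun t : ℝ => M + t • V)
      (l := detFun) (by simpa using (hd M).hasFDerivAt) h2
    exact h3.unique (hasDerivAt_det_line (U x) (Matrix.of V) hdet)
  have h4 : HasFDerivAt (fun y => (fun a b => U y a b : Fin 4 → Fin 4 → ℝ))
      (ContinuousLinearMap.pi fun a => ContinuousLinearMap.pi fun b =>
        fderiv ℝ (fun y => U y a b) x) x :=
    hasFDerivAt_pi.2 fun a => hasFDerivAt_pi.2 fun b =>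
      ((hU a b).differentiableAt (by simp)).hasFDerivAt
  have h5 := (hd M).hasFDerivAt.comp x h4
  have h6 : classD α (fun y => (U y).det) x = fderiv ℝ detFun M V := by
    have := h5.fderiv
    change fderiv ℝ (fun y => (U y).det) x _ = _
    change fderiv ℝ (fun y => (U y).det) x = _ at this
    rw [this]
    rfl
  rw [h6, h1]
  congr 1

end Determinant

/-! ### The Einstein-Hilbert Lagrangian in Goldberg variables -/

section Geometry

/-- The derivatives `∂_α L_{ab}` of the inverse matrix. -/
def invDeriv (U : Spacetime → Matrix (Fin 4) (Fin 4) ℝ) (y : Spacetime) (α a b : Fin 4) : ℝ :=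
  classD α (fun z => (U z)⁻¹ a b) y

variable {U : Spacetime → Matrix (Fin 4) (Fin 4) ℝ}

/-- Special to dimension four: the scalar factor enters the determinant as $(\sqrt{-\det U})^4=(\det
U)^2$. -/
theorem det_metricOfGoldberg {y : Spacetime} (hy : (U y).det < 0) :
    (metricOfGoldberg U y).det = (U y).det := by
  have hsq : √(-(U y).det) ^ 2 = -(U y).det := Real.sq_sqrt (by linarith)
  rw [metricOfGoldberg, Matrix.det_smul, Matrix.det_nonsing_inv, Ring.inverse_eq_inv']
  have : √(-(U y).det) ^ Fintype.card (Fin 4) = (U y).det ^ 2 := by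
    calc √(-(U y).det) ^ Fintype.card (Fin 4) = (√(-(U y).det) ^ 2) ^ 2 := by
          rw [Fintype.card_fin]; ring
      _ = (U y).det ^ 2 := by rw [hsq, neg_sq]
  rw [this]
  field_simp [hy.ne]

theorem inv_metricOfGoldberg {y : Spacetime} (hy : (U y).det < 0) :
    (metricOfGoldberg U y)⁻¹ = (√(-(U y).det))⁻¹ • U y := by
  have hs : 0 < √(-(U y).det) := Real.sqrt_pos.2 (by linarith)
  apply Matrix.inv_eq_right_inv
  rw [metricOfGoldberg, Matrix.smul_mul, Matrix.mul_smul, smul_smul, mul_inv_cancel₀ hs.ne',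
    one_smul, Matrix.nonsing_inv_mul _ (isUnit_iff_ne_zero.2 hy.ne)]

theorem inv_symm {y : Spacetime} (hs : ∀ μ ν, U y μ ν = U y ν μ) (a b : Fin 4) :
    (U y)⁻¹ a b = (U y)⁻¹ b a := by
  have h : (U y).transpose = U y := by
    ext i j
    exact hs j i
  rw [← Matrix.transpose_apply (U y)⁻¹ b a, Matrix.transpose_nonsing_inv, h]

/-- Links the algebraic section to calculus: the formula for the derivative of an inverse is applied
to $L=U^{-1}$, whose inverse is $U$ near the point. -/
theorem inverseDeriv_invDeriv {y : Spacetime} (hU : ∀ μ ν, ContDiff ℝ ∞ fun y => U y μ ν)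
    (hs : ∀ y μ ν, U y μ ν = U y ν μ) (hy : (U y).det < 0) (α μ ν : Fin 4) :
    inverseDeriv (U y) (invDeriv U y) α μ ν = classD α (fun z => U z μ ν) y := by
  have hLd : ((U y)⁻¹).det ≠ 0 := by
    rw [Matrix.det_nonsing_inv, Ring.inverse_eq_inv']
    exact inv_ne_zero hy.ne
  have hyy : (U y)⁻¹⁻¹ = U y := Matrix.nonsing_inv_nonsing_inv _ (isUnit_iff_ne_zero.2 hy.ne)
  have h1 := classD_inv (U := fun z => (U z)⁻¹)
    (fun a b => contDiffAt_inv (fun c d => (hU c d).contDiffAt) hy.ne a b) hLd α μ ν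
  have h2 : (fun z => (U z)⁻¹⁻¹ μ ν) =ᶠ[𝓝 y] fun z => U z μ ν := by
    filter_upwards [eventually_det_ne_zero (fun c d => (hU c d).contDiffAt) hy.ne] with z hz
    rw [Matrix.nonsing_inv_nonsing_inv _ (isUnit_iff_ne_zero.2 hz)]
  rw [← classD_congr h2, h1, inverseDeriv, hyy]
  congr 1
  refine Finset.sum_congr rfl fun a _ => Finset.sum_congr rfl fun b _ => ?_
  rw [hs y ν b, invDeriv]
  ring

theorem invDeriv_symm (hs : ∀ y μ ν, U y μ ν = U y ν μ) (y : Spacetime) (α a b : Fin 4) :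
    invDeriv U y α a b = invDeriv U y α b a := by
  have : (fun z => (U z)⁻¹ a b) = fun z => (U z)⁻¹ b a := funext fun z => inv_symm (hs z) a b
  rw [invDeriv, this, invDeriv]

theorem logDeriv_invDeriv {y : Spacetime} (hU : ∀ μ ν, ContDiff ℝ ∞ fun y => U y μ ν)
    (hs : ∀ y μ ν, U y μ ν = U y ν μ) (hy : (U y).det < 0) (μ : Fin 4) :
    logDeriv (U y) (invDeriv U y) μ =
      1 / 2 * ∑ a, ∑ b, (U y)⁻¹ a b * classD μ (fun z => U z a b) y := by
  rw [← sum_mul_inverseDeriv (inv_symm (hs y))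
    (Matrix.nonsing_inv_mul _ (isUnit_iff_ne_zero.2 hy.ne))]
  simp only [inverseDeriv_invDeriv hU hs hy]

/-- Identifies $\varphi_\mu$ as $\partial_\mu\log\sqrt{-\det U}$, by Jacobi's formula and the
symmetry of $U$. -/
theorem classD_sqrt_det {y : Spacetime} (hU : ∀ μ ν, ContDiff ℝ ∞ fun y => U y μ ν)
    (hs : ∀ y μ ν, U y μ ν = U y ν μ) (hy : (U y).det < 0) (μ : Fin 4) :
    classD μ (fun z => √(-(U z).det)) y = √(-(U y).det) * logDeriv (U y) (invDeriv U y) μ := by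
  have hd : DifferentiableAt ℝ (fun z => -(U z).det) y :=
    ((contDiffAt_det fun c d => (hU c d).contDiffAt).differentiableAt (by simp)).neg
  have hsp : 0 < √(-(U y).det) := Real.sqrt_pos.2 (by linarith)
  have hsq : √(-(U y).det) * √(-(U y).det) = -(U y).det := Real.mul_self_sqrt (by linarith)
  have h1 : classD μ (fun z => √(-(U z).det)) y =
      1 / (2 * √(-(U y).det)) * classD μ (fun z => -(U z).det) y := by
    simp only [classD]
    rw [fderiv_sqrt hd (by linarith)]
    rfl
  have h2 : ∑ a, ∑ b, (U y)⁻¹ a b * classD μ (fun z => U z b a) y =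
      ∑ a, ∑ b, (U y)⁻¹ a b * classD μ (fun z => U z a b) y := by
    refine Finset.sum_congr rfl fun a _ => Finset.sum_congr rfl fun b _ => ?_
    have : (fun z => U z b a) = fun z => U z a b := funext fun z => hs z b a
    rw [this]
  rw [h1, classD_neg, classD_det (fun c d => (hU c d).contDiffAt) hy.ne,
    logDeriv_invDeriv hU hs hy, h2]
  generalize ∑ a, ∑ b, (U y)⁻¹ a b * classD μ (fun z => U z a b) y = S
  generalize √(-(U y).det) = r at hsp hsq
  rw [show (U y).det = -(r * r) by linarith]
  field_simp

theorem contDiffAt_sqrt_det {y : Spacetime} (hU : ∀ μ ν, ContDiff ℝ ∞ fun y => U y μ ν)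
    (hy : (U y).det < 0) : ContDiffAt ℝ ∞ (fun z => √(-(U z).det)) y :=
  (contDiffAt_det fun c d => (hU c d).contDiffAt).neg.sqrt (by linarith)

theorem classD_metric {y : Spacetime} (hU : ∀ μ ν, ContDiff ℝ ∞ fun y => U y μ ν)
    (hs : ∀ y μ ν, U y μ ν = U y ν μ) (hy : (U y).det < 0) (α a b : Fin 4) :
    classD α (fun z => metricOfGoldberg U z a b) y =
      √(-(U y).det) * metricDeriv (U y) (U y)⁻¹ (invDeriv U y) α a b := by
  have h := classD_mul ((contDiffAt_sqrt_det hU hy).differentiableAt (by simp))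
    ((contDiffAt_inv (fun c d => (hU c d).contDiffAt) hy.ne a b).differentiableAt (by simp)) α
  simp only [metricOfGoldberg, Matrix.smul_apply, smul_eq_mul]
  rw [h, classD_sqrt_det hU hs hy, metricDeriv, invDeriv]
  ring

/-- The factor $\sqrt{-\det U}$ in the derivatives of the metric cancels against its inverse in
$g^{\alpha\beta}$. -/
theorem christoffel_metricOfGoldberg {y : Spacetime} (hU : ∀ μ ν, ContDiff ℝ ∞ fun y => U y μ ν)
    (hs : ∀ y μ ν, U y μ ν = U y ν μ) (hy : (U y).det < 0) (α μ ν : Fin 4) :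
    christoffel (metricOfGoldberg U) α μ ν y =
      christoffelUpper (U y) (U y)⁻¹ (invDeriv U y) α μ ν := by
  have hsp : √(-(U y).det) ≠ 0 := (Real.sqrt_pos.2 (by linarith)).ne'
  simp only [christoffel, classD_metric hU hs hy, inv_metricOfGoldberg hy, christoffelUpper,
    christoffelLower, Finset.mul_sum, Matrix.smul_apply, smul_eq_mul]
  refine Finset.sum_congr rfl fun β _ => ?_
  field_simp

theorem eventually_det_neg {x : Spacetime} (hU : ∀ μ ν, ContDiff ℝ ∞ fun y => U y μ ν)
    (hx : (U x).det < 0) : ∀ᶠ y in 𝓝 x, (U y).det < 0 :=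
  (contDiffAt_det fun c d => (hU c d).contDiffAt).continuousAt.eventually_lt continuousAt_const hx

theorem contDiffAt_invDeriv {x : Spacetime} (hU : ∀ μ ν, ContDiff ℝ ∞ fun y => U y μ ν)
    (hx : (U x).det < 0) (α a b : Fin 4) : ContDiffAt ℝ ∞ (fun y => invDeriv U y α a b) x :=
  contDiffAt_classD (contDiffAt_inv (fun c d => (hU c d).contDiffAt) hx.ne a b) α

theorem contDiffAt_logDeriv {x : Spacetime} (hU : ∀ μ ν, ContDiff ℝ ∞ fun y => U y μ ν)
    (hx : (U x).det < 0) (μ : Fin 4) :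
    ContDiffAt ℝ ∞ (fun y => logDeriv (U y) (invDeriv U y) μ) x :=
  contDiffAt_const.mul (ContDiffAt.sum fun a _ => ContDiffAt.sum fun b _ =>
    (hU a b).contDiffAt.mul (contDiffAt_invDeriv hU hx μ a b))

theorem contDiffAt_metricDeriv {x : Spacetime} (hU : ∀ μ ν, ContDiff ℝ ∞ fun y => U y μ ν)
    (hx : (U x).det < 0) (α μ ν : Fin 4) :
    ContDiffAt ℝ ∞ (fun y => metricDeriv (U y) (U y)⁻¹ (invDeriv U y) α μ ν) x :=
  ((contDiffAt_logDeriv hU hx α).mul (contDiffAt_inv (fun c d => (hU c d).contDiffAt) hx.ne μ ν)).add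
    (contDiffAt_invDeriv hU hx α μ ν)

theorem contDiffAt_christoffelUpper {x : Spacetime} (hU : ∀ μ ν, ContDiff ℝ ∞ fun y => U y μ ν)
    (hx : (U x).det < 0) (α μ ν : Fin 4) :
    ContDiffAt ℝ ∞ (fun y => christoffelUpper (U y) (U y)⁻¹ (invDeriv U y) α μ ν) x :=
  ContDiffAt.sum fun β _ => (hU α β).contDiffAt.mul (contDiffAt_const.mul
    (((contDiffAt_metricDeriv hU hx μ β ν).add (contDiffAt_metricDeriv hU hx ν β μ)).sub
      (contDiffAt_metricDeriv hU hx β μ ν)))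

/-- The curvature density `√(-g) R` as a divergence plus terms quadratic in first derivatives. -/
theorem sqrt_mul_scalarCurvature {x : Spacetime} (hU : ∀ μ ν, ContDiff ℝ ∞ fun y => U y μ ν)
    (hs : ∀ y μ ν, U y μ ν = U y ν μ) (hx : (U x).det < 0) :
    √(-(metricOfGoldberg U x).det) * scalarCurvature (metricOfGoldberg U) x =
      -(∑ α, ∑ ν, classD α (classD ν fun y => U y α ν) x)
      - (∑ μ, ∑ ν, U x μ ν * classD ν (fun y => logDeriv (U y) (invDeriv U y) μ) x)
      - (∑ β, ∑ ν, logDeriv (U x) (invDeriv U x) β * classD ν (fun y => U y β ν) x)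
      + (1 / 2 * (∑ a, ∑ b, U x a b * logDeriv (U x) (invDeriv U x) a
          * logDeriv (U x) (invDeriv U x) b)
        - 1 / 4 * (∑ μ, ∑ ν, ∑ a, ∑ b, ∑ c, ∑ d, U x μ ν * (U x)⁻¹ a c * (U x)⁻¹ b d
          * classD μ (fun y => U y a b) x * classD ν (fun y => U y c d) x)
        + 1 / 2 * (∑ μ, ∑ ν, ∑ ρ, ∑ σ, (U x)⁻¹ μ ν * classD ρ (fun y => U y μ σ) x
          * classD σ (fun y => U y ν ρ) x)) := by
  have hsp : √(-(U x).det) ≠ 0 := (Real.sqrt_pos.2 (by linarith)).ne'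
  have hUL := Matrix.mul_nonsing_inv _ (isUnit_iff_ne_zero.2 hx.ne)
  have hLU := Matrix.nonsing_inv_mul _ (isUnit_iff_ne_zero.2 hx.ne)
  have hUs := hs x
  have hLs := inv_symm (hs x)
  have hls := invDeriv_symm hs x
  set Γ : Fin 4 → Fin 4 → Fin 4 → Spacetime → ℝ := fun α μ ν y =>
    christoffelUpper (U y) (U y)⁻¹ (invDeriv U y) α μ ν with hΓ
  have hΓd : ∀ α μ ν, DifferentiableAt ℝ (Γ α μ ν) x := fun α μ ν =>
    (contDiffAt_christoffelUpper hU hx α μ ν).differentiableAt (by simp)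
  have hUd : ∀ μ ν, DifferentiableAt ℝ (fun y => U y μ ν) x := fun μ ν =>
    (hU μ ν).contDiffAt.differentiableAt (by simp)
  -- The curvature differentiates the Christoffel symbols, so their closed form is needed on a whole
  -- neighbourhood; it holds on the open set where the determinant is negative.
  have hev : ∀ α μ ν, christoffel (metricOfGoldberg U) α μ ν =ᶠ[𝓝 x] Γ α μ ν := fun α μ ν => by
    filter_upwards [eventually_det_neg hU hx] with y hy
    exact christoffel_metricOfGoldberg hU hs hy α μ ν
  have hric : ∀ μ ν, ricci (metricOfGoldberg U) μ ν x =
      ∑ α, (classD α (Γ α μ ν) x - classD ν (Γ α μ α) x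
        + ∑ β, (Γ α α β x * Γ β μ ν x - Γ α ν β x * Γ β α μ x)) := fun μ ν => by
    simp only [ricci, fun α μ ν => classD_congr (hev α μ ν), (hev _ _ _).eq_of_nhds]
  -- the trace of the Christoffel symbols
  have htr : ∀ μ ν, ∑ α, classD ν (Γ α μ α) x =
      classD ν (fun y => logDeriv (U y) (invDeriv U y) μ) x := fun μ ν => by
    rw [← classD_sum fun α _ => hΓd α μ α]
    refine classD_congr ?_ ν
    filter_upwards [eventually_det_neg hU hx] with y hy
    exact sum_christoffelUpper_self (hs y) (inv_symm (hs y))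
      (Matrix.mul_nonsing_inv _ (isUnit_iff_ne_zero.2 hy.ne)) (invDeriv_symm hs y) μ
  -- the divergence of the contracted Christoffel symbols
  have hdiv : ∀ α, ∑ μ, ∑ ν, U x μ ν * classD α (Γ α μ ν) x =
      -(∑ ν, classD α (classD ν fun y => U y α ν) x)
        - ∑ μ, ∑ ν, classD α (fun y => U y μ ν) x * Γ α μ ν x := fun α => by
    have h1 : (fun y => ∑ μ, ∑ ν, U y μ ν * Γ α μ ν y) =ᶠ[𝓝 x]
        fun y => -∑ ν, classD ν (fun z => U z α ν) y := by
      filter_upwards [eventually_det_neg hU hx] with y hy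
      rw [sum_mul_christoffelUpper (hs y) (inv_symm (hs y))
        (Matrix.mul_nonsing_inv _ (isUnit_iff_ne_zero.2 hy.ne))]
      simp only [inverseDeriv_invDeriv hU hs hy]
    have h2 := classD_congr h1 α
    have hm : ∀ μ ν, DifferentiableAt ℝ (fun y => U y μ ν * Γ α μ ν y) x := fun μ ν =>
      (hUd μ ν).fun_mul (hΓd α μ ν)
    rw [classD_neg, classD_sum (fun ν _ =>
        (contDiffAt_classD (hU α ν).contDiffAt ν).differentiableAt (by simp)),
      classD_sum (fun μ _ => DifferentiableAt.fun_sum fun ν _ => hm μ ν)] at h2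
    rw [← h2, ← Finset.sum_sub_distrib]
    refine Finset.sum_congr rfl fun μ _ => ?_
    rw [classD_sum (fun ν _ => hm μ ν), ← Finset.sum_sub_distrib]
    refine Finset.sum_congr rfl fun ν _ => ?_
    rw [classD_mul (hUd μ ν) (hΓd α μ ν)]
    ring
  have hΓφ : ∀ β, ∑ α, Γ α α β x = logDeriv (U x) (invDeriv U x) β := fun β => by
    rw [← sum_christoffelUpper_self hUs hLs hUL hls]
    exact Finset.sum_congr rfl fun α _ => christoffelUpper_symm hLs hls _ _ _
  have hΓU : ∀ β, ∑ μ, ∑ ν, U x μ ν * Γ β μ ν x = -∑ ν, classD ν (fun y => U y β ν) x :=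
    fun β => by
      rw [sum_mul_christoffelUpper hUs hLs hUL]
      simp only [inverseDeriv_invDeriv hU hs hx]
  -- The terms $-\partial_\alpha
  -- U^{\mu\nu}\Gamma^\alpha_{\mu\nu}-U^{\mu\nu}\Gamma^\alpha_{\nu\beta}\Gamma^\beta_{\alpha\mu}$
  -- left over from the Ricci tensor are exactly the left side of this identity, once its tensors
  -- $l$ are rewritten through $\partial U$.
  have hquad := christoffel_quadratic hUs hLs hUL hls
  rw [← sum_inverseDeriv_sq hUs hLU, ← sum_inverseDeriv_mul_swap hUs hLs hLU hls,
    ← sum_mul_christoffelUpper_mul hUs hLs hls,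
    ← neg_eq_iff_eq_neg.2 (sum_inverseDeriv_mul_christoffelUpper (L := (U x)⁻¹) hUs)] at hquad
  simp only [inverseDeriv_invDeriv hU hs hx] at hquad
  rw [← hquad, det_metricOfGoldberg hx, scalarCurvature]
  simp only [inv_metricOfGoldberg hx, hric, Matrix.smul_apply, smul_eq_mul]
  have hE : ∑ μ, ∑ ν, U x μ ν * ∑ α, ∑ β, Γ α α β x * Γ β μ ν x =
      -∑ β, ∑ ν, logDeriv (U x) (invDeriv U x) β * classD ν (fun y => U y β ν) x := by
    calc ∑ μ, ∑ ν, U x μ ν * ∑ α, ∑ β, Γ α α β x * Γ β μ ν x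
        = ∑ μ, ∑ ν, ∑ β, (∑ α, Γ α α β x) * (U x μ ν * Γ β μ ν x) := by
          refine Finset.sum_congr rfl fun μ _ => Finset.sum_congr rfl fun ν _ => ?_
          rw [Finset.sum_comm, Finset.mul_sum]
          refine Finset.sum_congr rfl fun β _ => ?_
          rw [Finset.sum_mul, Finset.mul_sum]
          exact Finset.sum_congr rfl fun α _ => by ring
      _ = ∑ β, (∑ α, Γ α α β x) * ∑ μ, ∑ ν, U x μ ν * Γ β μ ν x := by
          rw [sum_front_three]
          simp only [Finset.mul_sum]
      _ = _ := by
          simp only [hΓφ, hΓU, mul_neg, Finset.sum_neg_distrib, Finset.mul_sum]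
  have hA : ∑ μ, ∑ ν, U x μ ν * ∑ α, classD α (Γ α μ ν) x =
      -(∑ α, ∑ ν, classD α (classD ν fun y => U y α ν) x)
        - ∑ α, ∑ μ, ∑ ν, classD α (fun y => U y μ ν) x * Γ α μ ν x := by
    simp only [Finset.mul_sum]
    rw [sum_front_three]
    simp only [hdiv, Finset.sum_sub_distrib, Finset.sum_neg_distrib]
  calc _ = ∑ μ, ∑ ν, (U x μ ν * (∑ α, classD α (Γ α μ ν) x)
        - U x μ ν * (∑ α, classD ν (Γ α μ α) x)
        + U x μ ν * (∑ α, ∑ β, Γ α α β x * Γ β μ ν x)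
        - ∑ α, ∑ β, U x μ ν * (Γ α ν β x * Γ β α μ x)) := by
        rw [Finset.mul_sum]
        refine Finset.sum_congr rfl fun μ _ => ?_
        rw [Finset.mul_sum]
        refine Finset.sum_congr rfl fun ν _ => ?_
        simp only [Finset.sum_add_distrib, Finset.sum_sub_distrib, ← Finset.mul_sum]
        field_simp
        ring
    _ = _ := by
        simp only [Finset.sum_add_distrib, Finset.sum_sub_distrib, hA, hE, htr]
        ring

/-- Differentiating the form $\frac12L\,\partial U$ avoids second derivatives of the inverse matrix.
-/
theorem classD_logDeriv {x : Spacetime} (hU : ∀ μ ν, ContDiff ℝ ∞ fun y => U y μ ν)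
    (hs : ∀ y μ ν, U y μ ν = U y ν μ) (hx : (U x).det < 0) (μ ν : Fin 4) :
    classD ν (fun y => logDeriv (U y) (invDeriv U y) μ) x =
      1 / 2 * ∑ a, ∑ b, ((U x)⁻¹ a b * classD ν (classD μ fun y => U y a b) x
        - (∑ c, ∑ d, (U x)⁻¹ a c * classD ν (fun y => U y c d) x * (U x)⁻¹ d b)
          * classD μ (fun y => U y a b) x) := by
  have hev : (fun y => logDeriv (U y) (invDeriv U y) μ) =ᶠ[𝓝 x]
      fun y => 1 / 2 * ∑ a, ∑ b, (U y)⁻¹ a b * classD μ (fun z => U z a b) y := by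
    filter_upwards [eventually_det_neg hU hx] with y hy
    exact logDeriv_invDeriv hU hs hy μ
  have hL : ∀ a b, DifferentiableAt ℝ (fun y => (U y)⁻¹ a b) x := fun a b =>
    (contDiffAt_inv (fun c d => (hU c d).contDiffAt) hx.ne a b).differentiableAt (by simp)
  have hD : ∀ a b, DifferentiableAt ℝ (classD μ fun y => U y a b) x := fun a b =>
    (contDiffAt_classD (hU a b).contDiffAt μ).differentiableAt (by simp)
  have hm : ∀ a b, DifferentiableAt ℝ (fun y => (U y)⁻¹ a b * classD μ (fun z => U z a b) y) x :=
    fun a b => (hL a b).fun_mul (hD a b)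
  have hm' : ∀ a, DifferentiableAt ℝ
      (fun y => ∑ b, (U y)⁻¹ a b * classD μ (fun z => U z a b) y) x :=
    fun a => DifferentiableAt.fun_sum fun b _ => hm a b
  rw [classD_congr hev, classD_const_mul (DifferentiableAt.fun_sum fun a _ => hm' a),
    classD_sum fun a _ => hm' a]
  congr 1
  refine Finset.sum_congr rfl fun a _ => ?_
  rw [classD_sum fun b _ => hm a b]
  refine Finset.sum_congr rfl fun b _ => ?_
  rw [classD_mul (hL a b) (hD a b), classD_inv (fun c d => (hU c d).contDiffAt) hx.ne]
  ring

end Geometry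

/-! ### Expansions in the coupling constant -/

section Expansion

open Asymptotics Filter

/-- Boundedness of a function of `κ` near `κ = 0`. -/
def BoundedNearZero (r : ℝ → ℝ) : Prop := r =O[𝓝[≠] 0] fun _ => (1 : ℝ)

theorem BoundedNearZero.add {r s : ℝ → ℝ} (hr : BoundedNearZero r) (hs : BoundedNearZero s) :
    BoundedNearZero fun κ => r κ + s κ :=
  IsBigO.add hr hs

theorem BoundedNearZero.mul {r s : ℝ → ℝ} (hr : BoundedNearZero r) (hs : BoundedNearZero s) :
    BoundedNearZero fun κ => r κ * s κ := by
  simpa [BoundedNearZero] using IsBigO.mul hr hs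

theorem BoundedNearZero.neg {r : ℝ → ℝ} (hr : BoundedNearZero r) :
    BoundedNearZero fun κ => -r κ :=
  IsBigO.neg_left hr

theorem BoundedNearZero.sum {ι : Type*} {s : Finset ι} {r : ι → ℝ → ℝ}
    (hr : ∀ i, BoundedNearZero (r i)) : BoundedNearZero fun κ => ∑ i ∈ s, r i κ :=
  IsBigO.fun_sum fun i _ => hr i

theorem boundedNearZero_of_continuousAt {r : ℝ → ℝ} (hr : ContinuousAt r 0) :
    BoundedNearZero r :=
  (hr.tendsto.mono_left nhdsWithin_le_nhds).isBigO_one ℝ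

theorem boundedNearZero_const (c : ℝ) : BoundedNearZero fun _ => c :=
  boundedNearZero_of_continuousAt continuousAt_const

theorem boundedNearZero_id : BoundedNearZero fun κ => κ :=
  boundedNearZero_of_continuousAt continuousAt_id

/-- The expansion `f κ = a + b κ + c κ² + O(κ³)` near `κ = 0`. -/
def HasExpansion (f : ℝ → ℝ) (a b c : ℝ) : Prop :=
  ∃ r : ℝ → ℝ, BoundedNearZero r ∧
    ∀ᶠ κ in 𝓝[≠] (0 : ℝ), f κ = a + b * κ + c * κ ^ 2 + κ ^ 3 * r κ

variable {f g : ℝ → ℝ} {a b c a' b' c' : ℝ}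

theorem hasExpansion_const (a : ℝ) : HasExpansion (fun _ => a) a 0 0 :=
  ⟨fun _ => 0, boundedNearZero_const 0, by simp⟩

theorem HasExpansion.of_eq (hf : HasExpansion f a b c) (ha : a = a') (hb : b = b') (hc : c = c') :
    HasExpansion f a' b' c' := ha ▸ hb ▸ hc ▸ hf

theorem HasExpansion.add (hf : HasExpansion f a b c) (hg : HasExpansion g a' b' c') :
    HasExpansion (fun κ => f κ + g κ) (a + a') (b + b') (c + c') := by
  obtain ⟨r, hr, hfr⟩ := hf
  obtain ⟨s, hs, hgs⟩ := hg
  refine ⟨fun κ => r κ + s κ, hr.add hs, ?_⟩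
  filter_upwards [hfr, hgs] with κ h1 h2
  rw [h1, h2]
  ring

theorem HasExpansion.mul (hf : HasExpansion f a b c) (hg : HasExpansion g a' b' c') :
    HasExpansion (fun κ => f κ * g κ) (a * a') (a * b' + b * a')
      (a * c' + b * b' + c * a') := by
  obtain ⟨r, hr, hfr⟩ := hf
  obtain ⟨s, hs, hgs⟩ := hg
  have hp : ∀ a b c : ℝ, BoundedNearZero fun κ => a + b * κ + c * κ ^ 2 := fun a b c =>
    boundedNearZero_of_continuousAt (by fun_prop)
  have hk : BoundedNearZero fun κ => κ ^ 3 := boundedNearZero_of_continuousAt (by fun_prop)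
  -- The bounded factor collects everything of order at least three in the product, divided by
  -- $\kappa^3$.
  refine ⟨fun κ => b * c' + c * b' + c * c' * κ + 0 * κ ^ 2 + r κ * (a' + b' * κ + c' * κ ^ 2)
    + s κ * (a + b * κ + c * κ ^ 2) + κ ^ 3 * (r κ * s κ),
    (((hp _ _ _).add (hr.mul (hp _ _ _))).add (hs.mul (hp _ _ _))).add (hk.mul (hr.mul hs)), ?_⟩
  filter_upwards [hfr, hgs] with κ h1 h2
  rw [h1, h2]
  ring

theorem HasExpansion.const_mul (hf : HasExpansion f a b c) (k : ℝ) :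
    HasExpansion (fun κ => k * f κ) (k * a) (k * b) (k * c) := by
  refine ((hasExpansion_const k).mul hf).of_eq rfl ?_ ?_ <;> ring

theorem HasExpansion.sum {ι : Type*} {s : Finset ι} {f : ι → ℝ → ℝ} {a b c : ι → ℝ}
    (hf : ∀ i, HasExpansion (f i) (a i) (b i) (c i)) :
    HasExpansion (fun κ => ∑ i ∈ s, f i κ) (∑ i ∈ s, a i) (∑ i ∈ s, b i) (∑ i ∈ s, c i) := by
  choose r hr hfr using hf
  refine ⟨fun κ => ∑ i ∈ s, r i κ, BoundedNearZero.sum hr, ?_⟩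
  have : ∀ᶠ κ in 𝓝[≠] (0 : ℝ), ∀ i ∈ s, f i κ = a i + b i * κ + c i * κ ^ 2 + κ ^ 3 * r i κ :=
    (Finset.eventually_all s).2 fun i _ => hfr i
  filter_upwards [this] with κ h
  rw [Finset.sum_congr rfl h]
  simp only [Finset.sum_add_distrib, Finset.sum_mul, Finset.mul_sum]

end Expansion

/-! ### The Goldberg variables near flat space -/

section Goldberg

open Filter

variable (h : Fin 4 → Fin 4 → Spacetime → ℝ) (x : Spacetime)

theorem mink_mul_self (μ : Fin 4) : mink μ * mink μ = 1 := by
  fin_cases μ <;> simp [mink]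

theorem eta_apply (μ ν : Fin 4) : eta μ ν = if μ = ν then mink μ else 0 := by
  rw [eta, Matrix.diagonal_apply]

theorem goldberg_apply (κ : ℝ) (μ ν : Fin 4) :
    goldberg κ h x μ ν = eta μ ν + κ * (mink μ * mink ν * h μ ν x) := rfl

theorem continuous_goldberg : Continuous fun κ : ℝ => goldberg κ h x := by
  refine continuous_matrix fun μ ν => ?_
  simp only [goldberg_apply]
  fun_prop

theorem det_goldberg_zero : (goldberg 0 h x).det = -1 := by
  have : goldberg 0 h x = eta := by
    ext μ ν
    simp [goldberg_apply]
  rw [this, eta, Matrix.det_diagonal]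
  simp [mink, Fin.prod_univ_four]

theorem eventually_det_goldberg_neg : ∀ᶠ κ in 𝓝 (0 : ℝ), (goldberg κ h x).det < 0 := by
  have hc : ContinuousAt (fun κ : ℝ => (goldberg κ h x).det) 0 :=
    (continuous_goldberg h x).matrix_det.continuousAt
  exact hc.eventually_lt continuousAt_const (by simp [det_goldberg_zero])

/-- Continuity at $\kappa=0$, where the determinant is $-1$. This bound controls the remainder of
the Neumann series below. -/
theorem boundedNearZero_inv_goldberg (a b : Fin 4) :
    BoundedNearZero fun κ => (goldberg κ h x)⁻¹ a b := by
  refine boundedNearZero_of_continuousAt ?_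
  simp only [Matrix.inv_def, Ring.inverse_eq_inv', Matrix.smul_apply, smul_eq_mul]
  refine ContinuousAt.mul (ContinuousAt.inv₀ (continuous_goldberg h x).matrix_det.continuousAt ?_)
    (((continuous_goldberg h x).matrix_adjugate.matrix_elem a b).continuousAt)
  rw [det_goldberg_zero]
  norm_num

theorem hasExpansion_goldberg (μ ν : Fin 4) :
    HasExpansion (fun κ => goldberg κ h x μ ν) (eta μ ν) (mink μ * mink ν * h μ ν x) 0 :=
  ⟨fun _ => 0, boundedNearZero_const 0, .of_forall fun κ => by simp only [goldberg_apply]; ring⟩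

/-- The recursion $L=\eta-\kappa Lh$ behind the Neumann series: $LU=1$ with $U=\eta+\kappa h$,
multiplied by $\eta$. -/
theorem inv_goldberg_eq {κ : ℝ} (hκ : (goldberg κ h x).det < 0) (a c : Fin 4) :
    (goldberg κ h x)⁻¹ a c =
      eta a c - κ * ∑ b, mink b * (goldberg κ h x)⁻¹ a b * h b c x := by
  have h1 := sum_mul_inverse (Matrix.nonsing_inv_mul _ (isUnit_iff_ne_zero.2 hκ.ne)) a c
  simp only [goldberg_apply, mul_add, Finset.sum_add_distrib, eta_apply, mul_ite, mul_zero,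
    Finset.sum_ite_eq', Finset.mem_univ, if_true] at h1
  have h2 : ∑ b, (goldberg κ h x)⁻¹ a b * (κ * (mink b * mink c * h b c x)) =
      mink c * (κ * ∑ b, mink b * (goldberg κ h x)⁻¹ a b * h b c x) := by
    simp only [Finset.mul_sum]
    exact Finset.sum_congr rfl fun b _ => by ring
  rw [h2] at h1
  have h3 : eta a c = mink c * (if a = c then 1 else 0) := by
    rw [eta_apply]
    split_ifs with hac
    · rw [hac, mul_one]
    · rw [mul_zero]
  rw [h3, ← h1]
  linear_combination (-(goldberg κ h x)⁻¹ a c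
    - κ * ∑ b, mink b * (goldberg κ h x)⁻¹ a b * h b c x) * mink_mul_self c

theorem hasExpansion_inv_goldberg (a c : Fin 4) :
    HasExpansion (fun κ => (goldberg κ h x)⁻¹ a c) (eta a c) (-h a c x)
      (∑ b, mink b * h a b x * h b c x) := by
  let next : (ℝ → Fin 4 → Fin 4 → ℝ) → ℝ → Fin 4 → Fin 4 → ℝ := fun R κ a c =>
    ∑ b, mink b * R κ a b * h b c x
  have hn : ∀ R : ℝ → Fin 4 → Fin 4 → ℝ, (∀ a c, BoundedNearZero fun κ => R κ a c) →
      ∀ a c, BoundedNearZero fun κ => next R κ a c := fun R hR a c =>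
    BoundedNearZero.sum fun b => ((boundedNearZero_const _).mul (hR a b)).mul
      (boundedNearZero_const _)
  let L : ℝ → Fin 4 → Fin 4 → ℝ := fun κ a c => (goldberg κ h x)⁻¹ a c
  -- Three uses of the recursion give the terms up to $\kappa^2$ and the exact remainder
  -- $-\kappa^3Lhhh$, bounded because $L$ is.
  refine ⟨fun κ => -next (next (next L)) κ a c,
    (hn _ (hn _ (hn _ (boundedNearZero_inv_goldberg h x))) a c).neg, ?_⟩
  filter_upwards [nhdsWithin_le_nhds (eventually_det_goldberg_neg h x)] with κ hκ
  have h0 : ∀ a c, L κ a c = eta a c - κ * next L κ a c := inv_goldberg_eq h x hκ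
  have h1 : ∀ a c, next L κ a c = h a c x - κ * next (next L) κ a c := fun a c => by
    have : h a c x = ∑ b, mink b * eta a b * h b c x := by
      simp [eta_apply, mink_mul_self]
    rw [this]
    simp only [next, Finset.mul_sum (a := κ), ← Finset.sum_sub_distrib]
    refine Finset.sum_congr rfl fun b _ => ?_
    rw [h0 a b]
    simp only [next]
    ring
  have h2 : ∀ a c, next (next L) κ a c =
      (∑ b, mink b * h a b x * h b c x) - κ * next (next (next L)) κ a c := fun a c => by
    have : ∀ R : ℝ → Fin 4 → Fin 4 → ℝ, next R κ a c = ∑ b, mink b * R κ a b * h b c x :=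
      fun _ => rfl
    rw [this, this (next (next L)), Finset.mul_sum, ← Finset.sum_sub_distrib]
    refine Finset.sum_congr rfl fun b _ => ?_
    rw [h1 a b]
    ring
  change L κ a c = _
  rw [h0, h1, h2]
  ring

end Goldberg

/-! ### Expansion of the volume density -/

section Volume

open Filter

variable {h : Fin 4 → Fin 4 → Spacetime → ℝ}

/-- The left side is $\det(1+\kappa h)$ for the mixed tensor $h^\mu{}_\nu$; Newton's identities
express its elementary symmetric functions by the traces of powers of $h$. -/
theorem det_goldberg (hs : ∀ μ ν, h μ ν = h ν μ) (x : Spacetime) : ∃ e : ℝ, ∀ κ : ℝ,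
    -(goldberg κ h x).det = 1 + tr h x * κ
      + (tr h x ^ 2 - (ctr2 fun μ ν => h μ ν * h μ ν) x) / 2 * κ ^ 2
      + (tr h x ^ 3 - 3 * (tr h x * (ctr2 fun μ ν => h μ ν * h μ ν) x)
        + 2 * (ctr3 fun μ ν ρ => h μ ν * h μ ρ * h ν ρ) x) / 6 * κ ^ 3 + e * κ ^ 4 := by
  -- The fourth elementary symmetric function is the determinant of $h^\mu{}_\nu$; lowering an index
  -- with $\eta$ changes its sign.
  refine ⟨-(Matrix.of fun μ ν => h μ ν x).det, fun κ => ?_⟩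
  have hd : ∀ M : Matrix (Fin 4) (Fin 4) ℝ, M.det =
      M 0 0 * (M 1 1 * (M 2 2 * M 3 3 - M 2 3 * M 3 2) - M 1 2 * (M 2 1 * M 3 3 - M 2 3 * M 3 1)
        + M 1 3 * (M 2 1 * M 3 2 - M 2 2 * M 3 1))
      - M 0 1 * (M 1 0 * (M 2 2 * M 3 3 - M 2 3 * M 3 2) - M 1 2 * (M 2 0 * M 3 3 - M 2 3 * M 3 0)
        + M 1 3 * (M 2 0 * M 3 2 - M 2 2 * M 3 0))
      + M 0 2 * (M 1 0 * (M 2 1 * M 3 3 - M 2 3 * M 3 1) - M 1 1 * (M 2 0 * M 3 3 - M 2 3 * M 3 0)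
        + M 1 3 * (M 2 0 * M 3 1 - M 2 1 * M 3 0))
      - M 0 3 * (M 1 0 * (M 2 1 * M 3 2 - M 2 2 * M 3 1) - M 1 1 * (M 2 0 * M 3 2 - M 2 2 * M 3 0)
        + M 1 2 * (M 2 0 * M 3 1 - M 2 1 * M 3 0)) := fun M => by
    rw [Matrix.det_succ_row_zero]
    simp [Fin.sum_univ_succ, Matrix.det_fin_three, Fin.succAbove]
    ring
  simp only [hd, goldberg_apply, Matrix.of_apply, hs 1 0, hs 2 0, hs 3 0, hs 2 1, hs 3 1, hs 3 2,
    tr, ctr3, ctr2, ctr, Fin.sum_univ_four, Pi.add_apply, Pi.smul_apply, Pi.mul_apply, smul_eq_mul]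
  simp [eta_apply, mink]
  ring

/-- The expansion of the volume density. -/
theorem sqrt_det_goldberg (hs : ∀ μ ν, h μ ν = h ν μ) (x : Spacetime) :
    ∃ a b c : ℝ, ∃ r : ℝ → ℝ, BoundedNearZero r ∧ ∀ᶠ κ in 𝓝[≠] (0 : ℝ),
      √(-(goldberg κ h x).det) = a + b * κ + c * κ ^ 2
        + (tr h x ^ 3 / 48 - tr h x * (ctr2 fun μ ν => h μ ν * h μ ν) x / 8
          + (ctr3 fun μ ν ρ => h μ ν * h μ ρ * h ν ρ) x / 6) * κ ^ 3 + κ ^ 4 * r κ := by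
  obtain ⟨e, he⟩ := det_goldberg hs x
  generalize tr h x = t₁ at he ⊢
  generalize (ctr2 fun μ ν => h μ ν * h μ ν) x = t₂ at he ⊢
  generalize (ctr3 fun μ ν ρ => h μ ν * h μ ρ * h ν ρ) x = t₃ at he ⊢
  set b := t₁ / 2 with hb
  set c := t₁ ^ 2 / 8 - t₂ / 4 with hc
  set d := t₁ ^ 3 / 48 - t₁ * t₂ / 8 + t₃ / 6 with hd
  let P : ℝ → ℝ := fun κ => 1 + b * κ + c * κ ^ 2 + d * κ ^ 3
  have hP : Continuous P := by fun_prop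
  have hS : Continuous fun κ => √(-(goldberg κ h x).det) :=
    (continuous_goldberg h x).matrix_det.neg.sqrt
  -- With $S$ the square root and $P$ its cubic Taylor polynomial, $S-P=(S^2-P^2)/(S+P)$. Here
  -- $S^2-P^2$ is $\kappa^4$ times the stated numerator, and $S+P$ equals $2$ at $\kappa=0$.
  refine ⟨1, b, c, fun κ => (e - (2 * b * d + c ^ 2 + 2 * c * d * κ + d ^ 2 * κ ^ 2)) /
    (√(-(goldberg κ h x).det) + P κ), boundedNearZero_of_continuousAt ?_, ?_⟩
  · refine ContinuousAt.div (by fun_prop) (hS.add hP).continuousAt ?_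
    simp [P, det_goldberg_zero]
  · have hP0 : ∀ᶠ κ in 𝓝 (0 : ℝ), 0 < P κ :=
      continuousAt_const.eventually_lt hP.continuousAt (by simp [P])
    filter_upwards [nhdsWithin_le_nhds (eventually_det_goldberg_neg h x),
      nhdsWithin_le_nhds hP0] with κ hκ hPκ
    have hpos : 0 < √(-(goldberg κ h x).det) := Real.sqrt_pos.2 (by linarith)
    have hsq := Real.mul_self_sqrt (show 0 ≤ -(goldberg κ h x).det by linarith)
    have hne : √(-(goldberg κ h x).det) + P κ ≠ 0 := by positivity
    change _ = P κ + _
    rw [← sub_eq_iff_eq_add', mul_div_assoc', eq_div_iff hne]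
    have : (√(-(goldberg κ h x).det) - P κ) * (√(-(goldberg κ h x).det) + P κ) =
        -(goldberg κ h x).det - P κ ^ 2 := by
      linear_combination hsq
    rw [this, he κ]
    simp only [P, hb, hc, hd]
    ring

end Volume

/-! ### The curvature density in the coupling constant -/

section Curvature

variable {h : Fin 4 → Fin 4 → Spacetime → ℝ}

/-- The derivative `∂_α h^{ab}` with raised indices. -/
def upperD (h : Fin 4 → Fin 4 → Spacetime → ℝ) (x : Spacetime) (α a b : Fin 4) : ℝ :=
  mink a * mink b * classD α (h a b) x

/-- The second derivative `∂_ν ∂_μ h^{ab}` with raised indices. -/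
def upperDD (h : Fin 4 → Fin 4 → Spacetime → ℝ) (x : Spacetime) (ν μ a b : Fin 4) : ℝ :=
  mink a * mink b * classD ν (classD μ (h a b)) x

theorem contDiff_classD {f : Spacetime → ℝ} (hf : ContDiff ℝ ∞ f) (μ : Fin 4) :
    ContDiff ℝ ∞ (classD μ f) :=
  contDiff_iff_contDiffAt.2 fun _ => contDiffAt_classD hf.contDiffAt μ

theorem contDiff_goldberg (hh : ∀ μ ν, ContDiff ℝ ∞ (h μ ν)) (κ : ℝ) (μ ν : Fin 4) :
    ContDiff ℝ ∞ fun y => goldberg κ h y μ ν :=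
  contDiff_const.add (contDiff_const.mul (contDiff_const.mul (hh μ ν)))

theorem goldberg_symm (hs : ∀ μ ν, h μ ν = h ν μ) (κ : ℝ) (y : Spacetime) (μ ν : Fin 4) :
    goldberg κ h y μ ν = goldberg κ h y ν μ := by
  have he : eta μ ν = eta ν μ := by
    rw [eta, ← Matrix.transpose_apply (Matrix.diagonal mink), Matrix.diagonal_transpose]
  rw [goldberg_apply, goldberg_apply, he, hs μ ν, mul_comm (mink μ)]

theorem classD_goldberg (hh : ∀ μ ν, ContDiff ℝ ∞ (h μ ν)) (κ : ℝ) (y : Spacetime)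
    (α μ ν : Fin 4) :
    classD α (fun y => goldberg κ h y μ ν) y = κ * (mink μ * mink ν * classD α (h μ ν) y) := by
  have hd : DifferentiableAt ℝ (h μ ν) y := (hh μ ν).differentiable (by simp) y
  simp only [goldberg_apply]
  rw [classD_add (differentiableAt_const _) ((hd.const_mul _).const_mul _), classD_const, zero_add,
    classD_const_mul (hd.const_mul _), classD_const_mul hd]

theorem classD_classD_goldberg (hh : ∀ μ ν, ContDiff ℝ ∞ (h μ ν)) (κ : ℝ) (x : Spacetime)
    (ν μ a b : Fin 4) :
    classD ν (classD μ fun y => goldberg κ h y a b) x = κ * upperDD h x ν μ a b := by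
  have hd : DifferentiableAt ℝ (classD μ (h a b)) x :=
    (contDiff_classD (hh a b) μ).differentiable (by simp) x
  rw [show (classD μ fun y => goldberg κ h y a b) =
    fun y => κ * (mink a * mink b * classD μ (h a b) y) from
      funext fun y => classD_goldberg hh κ y μ a b, classD_const_mul (hd.const_mul _),
    classD_const_mul hd, upperDD]

/-- Every differentiated factor of $U$ contributes one $\kappa$, which separates second derivatives
from products of first derivatives. The coefficient $\frac14$ is $\frac12-\frac14$, the $\frac12$
coming from $\partial L$ inside $\partial\varphi$; the coefficient $\frac18$ comes from
$\frac12\varphi\varphi$ with $\varphi=\frac12L\,\partial U$. -/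
theorem curvatureDensity_goldberg (hh : ∀ μ ν, ContDiff ℝ ∞ (h μ ν)) (hs : ∀ μ ν, h μ ν = h ν μ)
    {κ : ℝ} {x : Spacetime} (hκ : (goldberg κ h x).det < 0) :
    √(-(metricOfGoldberg (goldberg κ h) x).det)
        * scalarCurvature (metricOfGoldberg (goldberg κ h)) x =
      κ * (-(∑ α, ∑ ν, upperDD h x α ν α ν)
        + -(1 / 2) * ∑ μ, ∑ ν, ∑ a, ∑ b,
          goldberg κ h x μ ν * (goldberg κ h x)⁻¹ a b * upperDD h x ν μ a b)
      + κ ^ 2 * (-(1 / 2) * (∑ β, ∑ ν, ∑ a, ∑ b,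
          (goldberg κ h x)⁻¹ a b * (upperD h x β a b * upperD h x ν β ν))
        + 1 / 8 * (∑ μ, ∑ ν, goldberg κ h x μ ν
          * (∑ a, ∑ b, (goldberg κ h x)⁻¹ a b * upperD h x μ a b)
          * (∑ a, ∑ b, (goldberg κ h x)⁻¹ a b * upperD h x ν a b))
        + 1 / 4 * (∑ μ, ∑ ν, ∑ a, ∑ b, ∑ c, ∑ d, goldberg κ h x μ ν
          * (goldberg κ h x)⁻¹ a c * (goldberg κ h x)⁻¹ b d * (upperD h x μ a b * upperD h x ν c d))
        + 1 / 2 * (∑ μ, ∑ ν, ∑ ρ, ∑ σ,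
          (goldberg κ h x)⁻¹ μ ν * (upperD h x ρ μ σ * upperD h x σ ν ρ))) := by
  have hU := contDiff_goldberg hh κ
  have hsy := goldberg_symm hs κ
  have hD : ∀ α a b, classD α (fun y => goldberg κ h y a b) x = κ * upperD h x α a b :=
    fun α a b => classD_goldberg hh κ x α a b
  rw [sqrt_mul_scalarCurvature hU hsy hκ]
  simp only [classD_logDeriv hU hsy hκ, logDeriv_invDeriv hU hsy hκ, hD,
    classD_classD_goldberg hh]
  have hLs : ∀ a b, (goldberg κ h x)⁻¹ a b = (goldberg κ h x)⁻¹ b a := inv_symm (hsy x)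
  generalize goldberg κ h x = U at hLs ⊢
  generalize upperD h x = p
  generalize upperDD h x = q
  generalize U⁻¹ = L at hLs ⊢
  have h1 : ∑ α, ∑ ν, κ * q α ν α ν = κ * ∑ α, ∑ ν, q α ν α ν := by
    simp only [Finset.mul_sum]
  have h2 : ∑ μ, ∑ ν, U μ ν * (1 / 2 * ∑ a, ∑ b, (L a b * (κ * q ν μ a b)
      - (∑ c, ∑ d, L a c * (κ * p ν c d) * L d b) * (κ * p μ a b))) =
      κ * (1 / 2 * ∑ μ, ∑ ν, ∑ a, ∑ b, U μ ν * L a b * q ν μ a b)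
      - κ ^ 2 * (1 / 2 * ∑ μ, ∑ ν, ∑ a, ∑ b, ∑ c, ∑ d,
        U μ ν * L a c * L b d * (p μ a b * p ν c d)) := by
    simp only [Finset.mul_sum, Finset.sum_mul, ← Finset.sum_sub_distrib]
    refine Finset.sum_congr rfl fun μ _ => Finset.sum_congr rfl fun ν _ =>
      Finset.sum_congr rfl fun a _ => Finset.sum_congr rfl fun b _ => ?_
    rw [mul_sub, mul_sub]
    congr 1
    · ring
    · simp only [Finset.mul_sum]
      exact Finset.sum_congr rfl fun c _ => Finset.sum_congr rfl fun d _ => by rw [hLs d b]; ring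
  have h3 : ∑ β, ∑ ν, 1 / 2 * (∑ a, ∑ b, L a b * (κ * p β a b)) * (κ * p ν β ν) =
      κ ^ 2 * (1 / 2 * ∑ β, ∑ ν, ∑ a, ∑ b, L a b * (p β a b * p ν β ν)) := by
    simp only [Finset.mul_sum, Finset.sum_mul]
    exact Finset.sum_congr rfl fun _ _ => Finset.sum_congr rfl fun _ _ =>
      Finset.sum_congr rfl fun _ _ => Finset.sum_congr rfl fun _ _ => by ring
  have h4 : ∑ μ, ∑ ν, U μ ν * (1 / 2 * ∑ a, ∑ b, L a b * (κ * p μ a b))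
        * (1 / 2 * ∑ a, ∑ b, L a b * (κ * p ν a b)) =
      κ ^ 2 * (1 / 4 * ∑ μ, ∑ ν, U μ ν * (∑ a, ∑ b, L a b * p μ a b)
        * (∑ a, ∑ b, L a b * p ν a b)) := by
    have : ∀ μ, ∑ a, ∑ b, L a b * (κ * p μ a b) = κ * ∑ a, ∑ b, L a b * p μ a b := fun μ => by
      simp only [Finset.mul_sum]
      exact Finset.sum_congr rfl fun _ _ => Finset.sum_congr rfl fun _ _ => by ring
    have key : ∀ φ : Fin 4 → ℝ, ∑ μ, ∑ ν, U μ ν * (1 / 2 * (κ * φ μ)) * (1 / 2 * (κ * φ ν)) =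
        κ ^ 2 * (1 / 4 * ∑ μ, ∑ ν, U μ ν * φ μ * φ ν) := fun φ => by
      simp only [Finset.mul_sum]
      exact Finset.sum_congr rfl fun _ _ => Finset.sum_congr rfl fun _ _ => by ring
    simp only [this]
    exact key _
  have h5 : ∑ μ, ∑ ν, ∑ a, ∑ b, ∑ c, ∑ d, U μ ν * L a c * L b d * (κ * p μ a b) * (κ * p ν c d) =
      κ ^ 2 * ∑ μ, ∑ ν, ∑ a, ∑ b, ∑ c, ∑ d, U μ ν * L a c * L b d * (p μ a b * p ν c d) := by
    simp only [Finset.mul_sum]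
    exact Finset.sum_congr rfl fun _ _ => Finset.sum_congr rfl fun _ _ =>
      Finset.sum_congr rfl fun _ _ => Finset.sum_congr rfl fun _ _ =>
      Finset.sum_congr rfl fun _ _ => Finset.sum_congr rfl fun _ _ => by ring
  have h6 : ∑ μ, ∑ ν, ∑ ρ, ∑ σ, L μ ν * (κ * p ρ μ σ) * (κ * p σ ν ρ) =
      κ ^ 2 * ∑ μ, ∑ ν, ∑ ρ, ∑ σ, L μ ν * (p ρ μ σ * p σ ν ρ) := by
    simp only [Finset.mul_sum]
    exact Finset.sum_congr rfl fun _ _ => Finset.sum_congr rfl fun _ _ =>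
      Finset.sum_congr rfl fun _ _ => Finset.sum_congr rfl fun _ _ => by ring
  rw [h1, h2, h3, h4, h5, h6]
  ring

end Curvature

/-! ### Coefficients of the individual sums in the curvature density -/

section Coefficients

variable {U L : ℝ → Matrix (Fin 4) (Fin 4) ℝ} {H : Fin 4 → Fin 4 → ℝ}
  {D : Fin 4 → Fin 4 → Fin 4 → ℝ}

theorem mink_eq (μ : Fin 4) : mink μ = 1 ∨ mink μ = -1 :=
  mul_self_eq_one_iff.1 (mink_mul_self μ)

theorem sum_eta (f : Fin 4 → Fin 4 → ℝ) : ∑ μ, ∑ ν, eta μ ν * f μ ν = ctr fun μ => f μ μ := by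
  simp [eta_apply, ctr]

/-- Here and below only the coefficient that reaches order $\kappa^3$ of the density is made
explicit. Sums with prefactor $\kappa^2$ are needed to first order, and the one in
`hasExpansion_mul_inv`, with prefactor $\kappa$, to second order. -/
theorem hasExpansion_inv_mul_sq
    (hL : ∀ a b, HasExpansion (fun κ => L κ a b) (eta a b) (-H a b)
      (∑ c, mink c * H a c * H c b)) :
    ∃ a c, HasExpansion (fun κ => ∑ μ, ∑ ν, ∑ ρ, ∑ σ, L κ μ ν
        * (mink μ * mink σ * D ρ μ σ * (mink ν * mink ρ * D σ ν ρ))) a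
      (-ctr4 fun μ ν ρ σ => H μ ν * D ρ μ σ * D σ ν ρ) c := by
  refine ⟨_, _, (HasExpansion.sum fun μ => HasExpansion.sum fun ν => HasExpansion.sum fun ρ =>
    HasExpansion.sum fun σ => (hL μ ν).mul (hasExpansion_const _)).of_eq rfl ?_ rfl⟩
  simp only [ctr4, ctr3, ctr2, ctr, smul_eq_mul, Finset.mul_sum, ← Finset.sum_neg_distrib]
  exact Finset.sum_congr rfl fun μ _ => Finset.sum_congr rfl fun ν _ =>
    Finset.sum_congr rfl fun ρ _ => Finset.sum_congr rfl fun σ _ => by ring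

theorem hasExpansion_inv_mul_div
    (hL : ∀ a b, HasExpansion (fun κ => L κ a b) (eta a b) (-H a b)
      (∑ c, mink c * H a c * H c b)) :
    ∃ a c, HasExpansion (fun κ => ∑ β, ∑ ν, ∑ a, ∑ b, L κ a b
        * (mink a * mink b * D β a b * (mink β * mink ν * D ν β ν))) a
      (-ctr4 fun β ν a b => H a b * D β a b * D ν β ν) c := by
  refine ⟨_, _, (HasExpansion.sum fun μ => HasExpansion.sum fun ν => HasExpansion.sum fun ρ =>
    HasExpansion.sum fun σ => (hL ρ σ).mul (hasExpansion_const _)).of_eq rfl ?_ rfl⟩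
  simp only [ctr4, ctr3, ctr2, ctr, smul_eq_mul, Finset.mul_sum, ← Finset.sum_neg_distrib]
  exact Finset.sum_congr rfl fun μ _ => Finset.sum_congr rfl fun ν _ =>
    Finset.sum_congr rfl fun ρ _ => Finset.sum_congr rfl fun σ _ => by ring

theorem hasExpansion_trace
    (hL : ∀ a b, HasExpansion (fun κ => L κ a b) (eta a b) (-H a b)
      (∑ c, mink c * H a c * H c b)) (μ : Fin 4) :
    ∃ c, HasExpansion (fun κ => ∑ a, ∑ b, L κ a b * (mink a * mink b * D μ a b))
      (ctr fun a => D μ a a) (-ctr2 fun a b => H a b * D μ a b) c := by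
  refine ⟨_, (HasExpansion.sum fun a => HasExpansion.sum fun b =>
    (hL a b).mul (hasExpansion_const _)).of_eq ?_ ?_ rfl⟩
  · rw [sum_eta]
    simp only [mink_mul_self, one_mul]
  · simp only [ctr2, ctr, smul_eq_mul, Finset.mul_sum, ← Finset.sum_neg_distrib]
    exact Finset.sum_congr rfl fun a _ => Finset.sum_congr rfl fun b _ => by ring

/-- The first-order variation of $U$ gives the first contraction; the variations of the two traces
give equal contributions, hence the factor $2$. -/
theorem hasExpansion_mul_trace_sq
    (hU : ∀ μ ν, HasExpansion (fun κ => U κ μ ν) (eta μ ν) (mink μ * mink ν * H μ ν) 0)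
    (hL : ∀ a b, HasExpansion (fun κ => L κ a b) (eta a b) (-H a b)
      (∑ c, mink c * H a c * H c b)) :
    ∃ a c, HasExpansion (fun κ => ∑ μ, ∑ ν, U κ μ ν
        * (∑ a, ∑ b, L κ a b * (mink a * mink b * D μ a b))
        * (∑ a, ∑ b, L κ a b * (mink a * mink b * D ν a b))) a
      ((ctr2 fun μ ν => H μ ν * (ctr fun a => D μ a a) * ctr fun a => D ν a a)
        - 2 * ctr3 fun μ ν ρ => H μ ν * D ρ μ ν * ctr fun a => D ρ a a) c := by
  choose c hc using hasExpansion_trace (D := D) hL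
  refine ⟨_, _, (HasExpansion.sum fun μ => HasExpansion.sum fun ν =>
    ((hU μ ν).mul (hc μ)).mul (hc ν)).of_eq rfl ?_ rfl⟩
  generalize ht : (fun μ => ctr fun a => D μ a a) = t
  have ht' : ∀ μ, (ctr fun a => D μ a a) = t μ := fun μ => by rw [← ht]
  have h3 : (ctr3 fun μ ν ρ => H μ ν * D ρ μ ν * t ρ) =
      ctr fun ρ => (ctr2 fun a b => H a b * D ρ a b) * t ρ := by
    simp only [ctr3, ctr2, ctr, smul_eq_mul, Finset.mul_sum, Finset.sum_mul]
    rw [sum_front_three]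
    exact Finset.sum_congr rfl fun _ _ => Finset.sum_congr rfl fun _ _ =>
      Finset.sum_congr rfl fun _ _ => by ring
  simp only [ht', h3]
  generalize hr : (fun ρ => ctr2 fun a b => H a b * D ρ a b) = r
  have hr' : ∀ ρ, (ctr2 fun a b => H a b * D ρ a b) = r ρ := fun ρ => by rw [← hr]
  simp only [hr']
  simp only [eta_apply, ite_mul, zero_mul, add_mul, Finset.sum_add_distrib, Finset.sum_ite_eq,
    Finset.mem_univ, if_true, ctr2, ctr, smul_eq_mul, Finset.mul_sum]
  have k1 : ∑ μ, mink μ * t μ * -r μ = -∑ μ, mink μ * (r μ * t μ) := by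
    rw [← Finset.sum_neg_distrib]
    exact Finset.sum_congr rfl fun _ _ => by ring
  have k2 : ∑ μ, mink μ * -r μ * t μ = -∑ μ, mink μ * (r μ * t μ) := by
    rw [← Finset.sum_neg_distrib]
    exact Finset.sum_congr rfl fun _ _ => by ring
  have k3 : ∑ μ, ∑ ν, mink μ * mink ν * H μ ν * t μ * t ν =
      ∑ μ, ∑ ν, mink μ * (mink ν * (H μ ν * t μ * t ν)) :=
    Finset.sum_congr rfl fun _ _ => Finset.sum_congr rfl fun _ _ => by ring
  rw [k1, k2, k3, ← Finset.mul_sum]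
  ring

/-- The first-order terms of the two factors `L` contribute equally, because `D` is symmetric in its
last two indices. -/
theorem hasExpansion_mul_inv_inv
    (hU : ∀ μ ν, HasExpansion (fun κ => U κ μ ν) (eta μ ν) (mink μ * mink ν * H μ ν) 0)
    (hL : ∀ a b, HasExpansion (fun κ => L κ a b) (eta a b) (-H a b)
      (∑ c, mink c * H a c * H c b))
    (hD : ∀ α a b, D α a b = D α b a) :
    ∃ a c, HasExpansion (fun κ => ∑ μ, ∑ ν, ∑ a, ∑ b, ∑ c, ∑ d, U κ μ ν * L κ a c * L κ b d
        * (mink a * mink b * D μ a b * (mink c * mink d * D ν c d))) a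
      ((ctr4 fun μ ν ρ σ => H μ ν * D μ ρ σ * D ν ρ σ)
        - 2 * ctr4 fun μ ν ρ σ => H μ ν * D σ μ ρ * D σ ν ρ) c := by
  refine ⟨_, _, (HasExpansion.sum fun μ => HasExpansion.sum fun ν => HasExpansion.sum fun a =>
    HasExpansion.sum fun b => HasExpansion.sum fun c => HasExpansion.sum fun d =>
      (((hU μ ν).mul (hL a c)).mul (hL b d)).mul (hasExpansion_const _)).of_eq rfl ?_ rfl⟩
  simp only [eta_apply, ite_mul, zero_mul, mul_ite, mul_zero, zero_add, add_mul,
    Finset.sum_add_distrib, Finset.sum_ite_irrel, Finset.sum_const_zero, Finset.sum_ite_eq,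
    Finset.mem_univ, if_true]
  have e1 : (ctr4 fun μ ν ρ σ => H μ ν * D σ μ ρ * D σ ν ρ) =
      ∑ σ, ∑ ρ, ∑ μ, ∑ ν, mink μ * mink ν * mink ρ * mink σ * (H μ ν * D σ μ ρ * D σ ν ρ) := by
    simp only [ctr4, ctr3, ctr2, ctr, smul_eq_mul, Finset.mul_sum]
    rw [sum_front_four]
    refine Finset.sum_congr rfl fun σ _ => (sum_front_three _).trans ?_
    exact Finset.sum_congr rfl fun _ _ => Finset.sum_congr rfl fun _ _ =>
      Finset.sum_congr rfl fun _ _ => by ring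
  have e2 : (ctr4 fun μ ν ρ σ => H μ ν * D σ μ ρ * D σ ν ρ) =
      ∑ σ, ∑ μ, ∑ ρ, ∑ ν, mink μ * mink ν * mink ρ * mink σ * (H μ ν * D σ μ ρ * D σ ν ρ) := by
    rw [e1]
    exact Finset.sum_congr rfl fun σ _ => Finset.sum_comm
  rw [two_mul]
  nth_rewrite 1 [e1]
  rw [e2]
  rw [← add_assoc, add_comm, sub_eq_add_neg, neg_add, ← Finset.sum_neg_distrib,
    ← Finset.sum_neg_distrib]
  congr 1
  · simp only [ctr4, ctr3, ctr2, ctr, smul_eq_mul, Finset.mul_sum]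
    refine Finset.sum_congr rfl fun _ _ => Finset.sum_congr rfl fun _ _ =>
      Finset.sum_congr rfl fun a _ => Finset.sum_congr rfl fun b _ => ?_
    rcases mink_eq a with ha | ha <;> rcases mink_eq b with hb | hb <;> rw [ha, hb] <;> ring
  congr 1
  · simp only [← Finset.sum_neg_distrib]
    refine Finset.sum_congr rfl fun _ _ => Finset.sum_congr rfl fun a _ =>
      Finset.sum_congr rfl fun b _ => Finset.sum_congr rfl fun c _ => ?_
    rw [hD _ a b, hD _ a c]
    rcases mink_eq a with ha | ha <;> rw [ha] <;> ring
  · simp only [← Finset.sum_neg_distrib]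
    refine Finset.sum_congr rfl fun _ _ => Finset.sum_congr rfl fun a _ =>
      Finset.sum_congr rfl fun b _ => Finset.sum_congr rfl fun c _ => ?_
    rcases mink_eq b with ha | ha <;> rw [ha] <;> ring

theorem hasExpansion_mul_inv {Q : Fin 4 → Fin 4 → Fin 4 → Fin 4 → ℝ}
    (hU : ∀ μ ν, HasExpansion (fun κ => U κ μ ν) (eta μ ν) (mink μ * mink ν * H μ ν) 0)
    (hL : ∀ a b, HasExpansion (fun κ => L κ a b) (eta a b) (-H a b)
      (∑ c, mink c * H a c * H c b)) :
    ∃ a b, HasExpansion (fun κ => ∑ μ, ∑ ν, ∑ a, ∑ b, U κ μ ν * L κ a b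
        * (mink a * mink b * Q ν μ a b)) a b
      ((ctr4 fun μ a b c => H a c * H c b * Q μ μ a b)
        - ctr4 fun μ ν a b => H μ ν * H a b * Q ν μ a b) := by
  refine ⟨_, _, (HasExpansion.sum fun μ => HasExpansion.sum fun ν => HasExpansion.sum fun a =>
    HasExpansion.sum fun b => ((hU μ ν).mul (hL a b)).mul (hasExpansion_const _)).of_eq
      rfl rfl ?_⟩
  simp only [eta_apply, ite_mul, zero_mul, mul_ite, mul_zero, add_zero, zero_add, add_mul,
    Finset.sum_add_distrib, Finset.sum_ite_irrel, Finset.sum_const_zero, Finset.sum_ite_eq,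
    Finset.mem_univ, if_true, ctr4, ctr3, ctr2, ctr, smul_eq_mul, Finset.mul_sum, Finset.sum_mul]
  rw [sub_eq_add_neg, ← Finset.sum_neg_distrib]
  simp only [← Finset.sum_neg_distrib]
  congr 1
  · exact Finset.sum_congr rfl fun _ _ => Finset.sum_congr rfl fun _ _ =>
      Finset.sum_congr rfl fun _ _ => Finset.sum_congr rfl fun _ _ => by ring
  · exact Finset.sum_congr rfl fun _ _ => Finset.sum_congr rfl fun _ _ =>
      Finset.sum_congr rfl fun _ _ => Finset.sum_congr rfl fun _ _ => by ring

end Coefficients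

/-! ### The graviton coupling on classical fields -/

section Classical

open Filter Asymptotics

variable {h : Fin 4 → Fin 4 → Spacetime → ℝ}

theorem ctr_apply (f : Fin 4 → Spacetime → ℝ) (x : Spacetime) : ctr f x = ctr fun μ => f μ x := by
  simp [ctr]

theorem classD_ctr {f : Fin 4 → Spacetime → ℝ} {x : Spacetime}
    (hf : ∀ μ, DifferentiableAt ℝ (f μ) x) (α : Fin 4) :
    classD α (fun y => ctr fun μ => f μ y) x = ctr fun μ => classD α (f μ) x := by
  simp only [ctr, smul_eq_mul]
  rw [classD_sum fun μ _ => (hf μ).const_mul _]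
  exact Finset.sum_congr rfl fun μ _ => classD_const_mul (hf μ) _ _

theorem differentiableAt_ctr {f : Fin 4 → Spacetime → ℝ} {x : Spacetime}
    (hf : ∀ μ, DifferentiableAt ℝ (f μ) x) : DifferentiableAt ℝ (fun y => ctr fun μ => f μ y) x :=
  DifferentiableAt.fun_sum fun μ _ => (hf μ).const_mul (mink μ)

theorem classD_ctr3_mul {f g k : Fin 4 → Fin 4 → Fin 4 → Spacetime → ℝ} {x : Spacetime}
    (hf : ∀ a b c, DifferentiableAt ℝ (f a b c) x) (hg : ∀ a b c, DifferentiableAt ℝ (g a b c) x)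
    (hk : ∀ a b c, DifferentiableAt ℝ (k a b c) x) (α : Fin 4) :
    classD α (fun y => ctr3 fun a b c => f a b c y * g a b c y * k a b c y) x =
      (ctr3 fun a b c => classD α (f a b c) x * g a b c x * k a b c x)
      + (ctr3 fun a b c => f a b c x * classD α (g a b c) x * k a b c x)
      + ctr3 fun a b c => f a b c x * g a b c x * classD α (k a b c) x := by
  have h3 : ∀ a b c, DifferentiableAt ℝ (fun y => f a b c y * g a b c y * k a b c y) x :=
    fun a b c => ((hf a b c).fun_mul (hg a b c)).fun_mul (hk a b c)
  have h2 : ∀ a b, DifferentiableAt ℝ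
      (fun y => ctr fun c => f a b c y * g a b c y * k a b c y) x :=
    fun a b => differentiableAt_ctr (h3 a b)
  have h1 : ∀ a, DifferentiableAt ℝ
      (fun y => ctr fun b => ctr fun c => f a b c y * g a b c y * k a b c y) x :=
    fun a => differentiableAt_ctr (h2 a)
  simp only [ctr3, ctr2]
  rw [classD_ctr h1, ← ctr_add, ← ctr_add]
  congr 1
  funext a
  rw [classD_ctr (h2 a), ← ctr_add, ← ctr_add]
  congr 1
  funext b
  rw [classD_ctr (h3 a b), ← ctr_add, ← ctr_add]
  congr 1
  funext c
  rw [classD_mul ((hf a b c).fun_mul (hg a b c)) (hk a b c), classD_mul (hf a b c) (hg a b c)]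
  ring

/-- The local polynomials whose divergence relates the Einstein-Hilbert Lagrangian to the
coupling. -/
def boundaryTerm (μ : Fin 4) : LocalPolynomial :=
  -- This is $-8$ times the $\kappa^3$ part of $U^{\mu\nu}\varphi_\nu$, that is of
  -- $\frac12U^{\mu\nu}L_{ab}\partial_\nu U^{ab}$. The first summand uses the second-order term $hh$
  -- of $L$, the other one the first-order terms of $U$ and $L$.
  mink μ • ((-4 : ℝ) • (ctr3 fun a b c => MvPolynomial.X (.inl (a, c)) * MvPolynomial.X (.inl (c, b))
      * MvPolynomial.X (.inr (μ, a, b)))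
    + (4 : ℝ) • (ctr3 fun ν a b => MvPolynomial.X (.inl (μ, ν)) * MvPolynomial.X (.inl (a, b))
      * MvPolynomial.X (.inr (ν, a, b))))

theorem boundaryTerm_on (h : Fin 4 → Fin 4 → Spacetime → ℝ) (μ : Fin 4) :
    (boundaryTerm μ).on h = fun y => mink μ * (
      -4 * (ctr3 fun a b c => h a c y * h c b y * classD μ (h a b) y)
      + 4 * (ctr3 fun ν a b => h μ ν y * h a b y * classD ν (h a b) y)) := by
  funext y
  simp [LocalPolynomial.on, boundaryTerm, ctr3, ctr2, ctr, MvPolynomial.smul_eval]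
  ring

/-- The second derivatives produced here are those that occur at order $\kappa^3$ in the curvature
density; the products of first derivatives beyond $T_{\mathrm{grav}}$ are absorbed as well. -/
theorem sum_classD_boundaryTerm (hh : ∀ μ ν, ContDiff ℝ ∞ (h μ ν)) (hs : ∀ μ ν, h μ ν = h ν μ)
    (x : Spacetime) :
    ∑ μ, classD μ ((boundaryTerm μ).on h) x =
      -4 * (ctr4 fun μ a b c => h a c x * h c b x * classD μ (classD μ (h a b)) x)
      + 4 * (ctr4 fun μ ν a b => h μ ν x * h a b x * classD ν (classD μ (h a b)) x)
      + 4 * (ctr4 fun μ ν ρ σ => h μ ν x * classD μ (h ρ σ) x * classD ν (h ρ σ) x)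
      - 8 * (ctr4 fun μ ν ρ σ => h μ ν x * classD σ (h μ ρ) x * classD σ (h ν ρ) x)
      + 4 * (ctr4 fun β ν a b => h a b x * classD β (h a b) x * classD ν (h β ν) x) := by
  have hd : ∀ a b, DifferentiableAt ℝ (h a b) x := fun a b => (hh a b).differentiable (by simp) x
  have hdd : ∀ α a b, DifferentiableAt ℝ (classD α (h a b)) x := fun α a b =>
    (contDiff_classD (hh a b) α).differentiable (by simp) x
  have h3 : ∀ f : Fin 4 → Fin 4 → Fin 4 → Spacetime → ℝ,
      (∀ a b c, DifferentiableAt ℝ (f a b c) x) →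
      DifferentiableAt ℝ (fun y => ctr3 fun a b c => f a b c y) x := fun f hf =>
    differentiableAt_ctr fun a => differentiableAt_ctr fun b => differentiableAt_ctr fun c =>
      hf a b c
  have key : ∀ μ, classD μ ((boundaryTerm μ).on h) x = mink μ * (-4 *
        ((ctr3 fun a b c => classD μ (h a c) x * h c b x * classD μ (h a b) x)
        + (ctr3 fun a b c => h a c x * classD μ (h c b) x * classD μ (h a b) x)
        + ctr3 fun a b c => h a c x * h c b x * classD μ (classD μ (h a b)) x)
      + 4 * ((ctr3 fun ν a b => classD μ (h μ ν) x * h a b x * classD ν (h a b) x)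
        + (ctr3 fun ν a b => h μ ν x * classD μ (h a b) x * classD ν (h a b) x)
        + ctr3 fun ν a b => h μ ν x * h a b x * classD μ (classD ν (h a b)) x)) := fun μ => by
    have d1 := h3 (fun a b c y => h a c y * h c b y * classD μ (h a b) y) fun a b c =>
      ((hd a c).fun_mul (hd c b)).fun_mul (hdd μ a b)
    have d2 := h3 (fun ν a b y => h μ ν y * h a b y * classD ν (h a b) y) fun ν a b =>
      ((hd μ ν).fun_mul (hd a b)).fun_mul (hdd ν a b)
    rw [boundaryTerm_on, classD_const_mul ((d1.const_mul _).fun_add (d2.const_mul _)),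
      classD_add (d1.const_mul _) (d2.const_mul _), classD_const_mul d1, classD_const_mul d2,
      classD_ctr3_mul (fun a b c => hd a c) (fun a b c => hd c b) (fun a b c => hdd μ a b),
      classD_ctr3_mul (fun ν a b => hd μ ν) (fun ν a b => hd a b) (fun ν a b => hdd ν a b)]
  have hsym : ∀ μ a b, classD μ (h a b) x = classD μ (h b a) x := fun μ a b => by rw [hs a b]
  have e1 : (ctr4 fun μ a b c => classD μ (h a c) x * h c b x * classD μ (h a b) x) =
      ctr4 fun μ ν ρ σ => h μ ν x * classD σ (h μ ρ) x * classD σ (h ν ρ) x := by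
    simp only [ctr4, ctr3, ctr2, ctr, smul_eq_mul, Finset.mul_sum]
    refine Eq.trans ?_ (sum_front_four _).symm
    refine Finset.sum_congr rfl fun σ _ => Eq.trans ?_ (sum_front_three _).symm
    refine Finset.sum_congr rfl fun a _ => Finset.sum_comm.trans ?_
    refine Finset.sum_congr rfl fun c _ => Finset.sum_congr rfl fun b _ => ?_
    rw [hsym σ a c, hsym σ a b]
    ring
  have e2 : (ctr4 fun μ a b c => h a c x * classD μ (h c b) x * classD μ (h a b) x) =
      ctr4 fun μ ν ρ σ => h μ ν x * classD σ (h μ ρ) x * classD σ (h ν ρ) x := by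
    simp only [ctr4, ctr3, ctr2, ctr, smul_eq_mul, Finset.mul_sum]
    refine Eq.trans ?_ (sum_front_four _).symm
    refine Finset.sum_congr rfl fun σ _ => Finset.sum_congr rfl fun a _ => Finset.sum_comm.trans ?_
    refine Finset.sum_congr rfl fun c _ => Finset.sum_congr rfl fun b _ => ?_
    ring
  have e3 : (ctr4 fun μ ν a b => classD μ (h μ ν) x * h a b x * classD ν (h a b) x) =
      ctr4 fun β ν a b => h a b x * classD β (h a b) x * classD ν (h β ν) x := by
    simp only [ctr4, ctr3, ctr2, ctr, smul_eq_mul, Finset.mul_sum]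
    refine Finset.sum_comm.trans ?_
    refine Finset.sum_congr rfl fun ν _ => Finset.sum_congr rfl fun μ _ =>
      Finset.sum_congr rfl fun c _ => Finset.sum_congr rfl fun b _ => ?_
    rw [hsym μ μ ν]
    ring
  have e4 : (ctr4 fun μ ν a b => h μ ν x * h a b x * classD μ (classD ν (h a b)) x) =
      ctr4 fun μ ν a b => h μ ν x * h a b x * classD ν (classD μ (h a b)) x := by
    simp only [ctr4, ctr3, ctr2, ctr, smul_eq_mul, Finset.mul_sum]
    refine Finset.sum_comm.trans ?_
    refine Finset.sum_congr rfl fun ν _ => Finset.sum_congr rfl fun μ _ =>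
      Finset.sum_congr rfl fun c _ => Finset.sum_congr rfl fun b _ => ?_
    rw [hs μ ν]
    ring
  have hsum : ∀ F G : Fin 4 → ℝ, ∑ μ, mink μ * (-4 * F μ + 4 * G μ) = -4 * ctr F + 4 * ctr G :=
    fun F G => by
      simp only [ctr, smul_eq_mul, Finset.mul_sum, ← Finset.sum_add_distrib]
      exact Finset.sum_congr rfl fun _ _ => by ring
  have hadd : ∀ F G K : Fin 4 → ℝ, (ctr fun μ => F μ + G μ + K μ) = ctr F + ctr G + ctr K :=
    fun F G K => by rw [ctr_add, ctr_add]
  rw [Finset.sum_congr rfl fun μ _ => key μ, hsum, hadd, hadd]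
  change -4 * (ctr4 (fun μ a b c => classD μ (h a c) x * h c b x * classD μ (h a b) x)
      + ctr4 (fun μ a b c => h a c x * classD μ (h c b) x * classD μ (h a b) x)
      + ctr4 (fun μ a b c => h a c x * h c b x * classD μ (classD μ (h a b)) x))
    + 4 * (ctr4 (fun μ ν a b => classD μ (h μ ν) x * h a b x * classD ν (h a b) x)
      + ctr4 (fun μ ν a b => h μ ν x * classD μ (h a b) x * classD ν (h a b) x)
      + ctr4 (fun μ ν a b => h μ ν x * h a b x * classD μ (classD ν (h a b)) x)) = _
  rw [e1, e2, e3, e4]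
  ring

/-- Setting the three ghost arguments to zero removes every monomial containing $u$, $\tilde u$ or
$v$. -/
theorem coupling_classical (m : ℝ) (hh : ∀ μ ν, ContDiff ℝ ∞ (h μ ν)) (x : Spacetime) :
    coupling m classD h 0 0 0 x =
      (ctr2 fun μ ν => h μ ν x * (ctr fun a => classD μ (h a a) x)
        * ctr fun a => classD ν (h a a) x)
      - 2 * (ctr4 fun μ ν ρ σ => h μ ν x * classD μ (h ρ σ) x * classD ν (h ρ σ) x)
      - 4 * (ctr4 fun μ ν ρ σ => h μ ν x * classD ρ (h μ σ) x * classD σ (h ν ρ) x)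
      - 2 * (ctr3 fun μ ν ρ => h μ ν x * classD ρ (h μ ν) x * ctr fun a => classD ρ (h a a) x)
      + 4 * (ctr4 fun μ ν ρ σ => h μ ν x * classD σ (h μ ρ) x * classD σ (h ν ρ) x)
      + m ^ 2 * (-(4 / 3) * (ctr3 fun μ ν ρ => h μ ν * h μ ρ * h ν ρ) x
        + tr h x * (ctr2 fun μ ν => h μ ν * h μ ν) x - 1 / 6 * tr h x ^ 3) := by
  have ht : ∀ μ, classD μ (tr h) x = ctr fun a => classD μ (h a a) x := fun μ => by
    rw [← classD_ctr fun a => (hh a a).differentiable (by simp) x]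
    congr 1
  have hz : ∀ μ, classD μ (0 : Spacetime → ℝ) = 0 := fun μ => by
    funext y
    exact classD_const 0 y μ
  have hc : (ctr2 fun μ ν => h μ ν * h μ ν * tr h) x =
      tr h x * (ctr2 fun μ ν => h μ ν * h μ ν) x := by
    simp only [ctr2, ctr_apply, Pi.mul_apply]
    simp only [ctr, smul_eq_mul, Finset.mul_sum]
    exact Finset.sum_congr rfl fun _ _ => Finset.sum_congr rfl fun _ _ => by ring
  have h0 : (ctr fun _ => (0 : ℝ)) = 0 := by simp [ctr]
  simp only [coupling, Pi.add_apply, Pi.sub_apply, Pi.smul_apply, Pi.pow_apply, smul_eq_mul, hc,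
    Pi.zero_apply, hz]
  simp only [ctr4, ctr3, ctr2, ctr_apply, Pi.mul_apply, Pi.zero_apply, ht, mul_zero, h0]
  ring

end Classical

/-! ### Comparison of the Einstein-Hilbert Lagrangian with the graviton coupling -/

section EinsteinHilbert

open Filter Asymptotics

variable {h : Fin 4 → Fin 4 → Spacetime → ℝ}

/-- The shape of the curvature density. The coefficient of $\kappa^3$ involves only the second-order
coefficient of `f` and the first-order one of `g`. -/
theorem HasExpansion.mul_add_sq_mul {f g : ℝ → ℝ} {a b c a' b' c' : ℝ}
    (hf : HasExpansion f a b c) (hg : HasExpansion g a' b' c') :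
    ∃ r : ℝ → ℝ, BoundedNearZero r ∧ ∀ᶠ κ in 𝓝[≠] (0 : ℝ), κ * f κ + κ ^ 2 * g κ =
      a * κ + (b + a') * κ ^ 2 + (c + b') * κ ^ 3 + κ ^ 4 * r κ := by
  obtain ⟨r, hr, hfr⟩ := hf
  obtain ⟨s, hs, hgs⟩ := hg
  refine ⟨fun κ => r κ + c' + κ * s κ,
    (hr.add (boundedNearZero_const c')).add (boundedNearZero_id.mul hs), ?_⟩
  filter_upwards [hfr, hgs] with κ h1 h2
  rw [h1, h2]
  ring

/-- The expansion of the curvature density. -/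
theorem curvatureDensity_expansion (hh : ∀ μ ν, ContDiff ℝ ∞ (h μ ν))
    (hs : ∀ μ ν, h μ ν = h ν μ) (x : Spacetime) :
    ∃ b c d : ℝ, ∃ r : ℝ → ℝ, BoundedNearZero r ∧
      (∀ᶠ κ in 𝓝[≠] (0 : ℝ), √(-(metricOfGoldberg (goldberg κ h) x).det)
          * scalarCurvature (metricOfGoldberg (goldberg κ h)) x =
        b * κ + c * κ ^ 2 + d * κ ^ 3 + κ ^ 4 * r κ) ∧
      8 * d = coupling 0 classD h 0 0 0 x + ∑ μ, classD μ ((boundaryTerm μ).on h) x := by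
  have hU := hasExpansion_goldberg h x
  have hL := hasExpansion_inv_goldberg h x
  obtain ⟨x₀, x₁, hX⟩ := hasExpansion_mul_inv (U := fun κ => goldberg κ h x)
    (L := fun κ => (goldberg κ h x)⁻¹) (H := fun a b => h a b x)
    (Q := fun ν μ a b => classD ν (classD μ (h a b)) x) hU hL
  obtain ⟨y₀, y₂, hY⟩ := hasExpansion_inv_mul_div (L := fun κ => (goldberg κ h x)⁻¹)
    (H := fun a b => h a b x) (D := fun α a b => classD α (h a b) x) hL
  obtain ⟨z₀, z₂, hZ⟩ := hasExpansion_mul_trace_sq (U := fun κ => goldberg κ h x)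
    (L := fun κ => (goldberg κ h x)⁻¹) (H := fun a b => h a b x)
    (D := fun α a b => classD α (h a b) x) hU hL
  obtain ⟨w₀, w₂, hW⟩ := hasExpansion_mul_inv_inv (U := fun κ => goldberg κ h x)
    (L := fun κ => (goldberg κ h x)⁻¹) (H := fun a b => h a b x)
    (D := fun α a b => classD α (h a b) x) hU hL fun α a b => by simp only [hs a b]
  obtain ⟨v₀, v₂, hV⟩ := hasExpansion_inv_mul_sq (L := fun κ => (goldberg κ h x)⁻¹)
    (H := fun a b => h a b x) (D := fun α a b => classD α (h a b) x) hL
  obtain ⟨r, hr, hr'⟩ := ((hasExpansion_const (-(∑ α, ∑ ν, upperDD h x α ν α ν))).add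
    (hX.const_mul (-(1 / 2)))).mul_add_sq_mul
    ((((hY.const_mul (-(1 / 2))).add (hZ.const_mul (1 / 8))).add
      (hW.const_mul (1 / 4))).add (hV.const_mul (1 / 2)))
  have hdet := (eventually_det_goldberg_neg h x).filter_mono (nhdsWithin_le_nhds (s := {0}ᶜ))
  refine ⟨_, _, _, r, hr, (hdet.and hr').mono fun κ hκ =>
    (curvatureDensity_goldberg hh hs hκ.1).trans hκ.2, ?_⟩
  -- The mass is set to zero since curvature yields only the part with derivatives; the mass term
  -- comes from the volume density.
  rw [coupling_classical 0 hh, sum_classD_boundaryTerm hh hs]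
  ring

/-- The Einstein-Hilbert Lagrangian to first order in the coupling constant. -/
theorem einsteinHilbert_expansion (m : ℝ) (hh : ∀ μ ν, ContDiff ℝ ∞ (h μ ν))
    (hs : ∀ μ ν, h μ ν = h ν μ) (x : Spacetime) :
    ∃ a b c d : ℝ,
      (fun κ : ℝ => einsteinHilbert κ (m ^ 2 / 2) (metricOfGoldberg (goldberg κ h)) x
        - (a / κ ^ 2 + b / κ + c + d * κ)) =O[𝓝[≠] 0] (fun κ : ℝ => κ ^ 2) ∧
      -4 * d = coupling m classD h 0 0 0 x + ∑ μ, classD μ ((boundaryTerm μ).on h) x := by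
  obtain ⟨b₁, c₁, d₁, r, hr, hr', hd⟩ := curvatureDensity_expansion hh hs x
  obtain ⟨a₂, b₂, c₂, s, hs₁, hs₂⟩ := sqrt_det_goldberg hs x
  -- With $2\Lambda=m^2$ the Lagrangian is $-2\kappa^{-2}(\sqrt{-g}\,R-m^2\sqrt{-g})$. The curvature
  -- density starts at order $\kappa$, so only the volume contributes to $\kappa^{-2}$.
  refine ⟨2 * m ^ 2 * a₂, -2 * b₁ + 2 * m ^ 2 * b₂, -2 * c₁ + 2 * m ^ 2 * c₂,
    -2 * d₁ + 2 * m ^ 2 * (tr h x ^ 3 / 48 - tr h x * (ctr2 fun μ ν => h μ ν * h μ ν) x / 8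
      + (ctr3 fun μ ν ρ => h μ ν * h μ ρ * h ν ρ) x / 6), ?_, ?_⟩
  · have hw : BoundedNearZero fun κ => -2 * r κ + 2 * m ^ 2 * s κ :=
      ((boundedNearZero_const _).mul hr).add ((boundedNearZero_const _).mul hs₁)
    have hO := (isBigO_refl (fun κ : ℝ => κ ^ 2) (𝓝[≠] 0)).mul hw
    simp only [mul_one] at hO
    refine hO.congr' ?_ EventuallyEq.rfl
    filter_upwards [nhdsWithin_le_nhds (eventually_det_goldberg_neg h x), hr', hs₂,
      self_mem_nhdsWithin] with κ hκ h1 h2 h0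
    have h0' : κ ≠ 0 := h0
    have hE : einsteinHilbert κ (m ^ 2 / 2) (metricOfGoldberg (goldberg κ h)) x =
        -(2 / κ ^ 2) * (√(-(metricOfGoldberg (goldberg κ h) x).det)
          * scalarCurvature (metricOfGoldberg (goldberg κ h)) x
          - m ^ 2 * √(-(goldberg κ h x).det)) := by
      rw [einsteinHilbert, det_metricOfGoldberg hκ]
      ring
    rw [hE, h1, h2]
    field_simp
    ring
  · rw [coupling_classical 0 hh] at hd
    rw [coupling_classical m hh]
    -- Multiplying by $-4$ turns $-2d_1$ into $8d_1$, and $-8$ times the cubic volume coefficient is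
    -- $-\frac43h^{\mu\nu}h_{\mu\rho}h_\nu{}^\rho+h^{\mu\nu}h_{\mu\nu}h-\frac16h^3$, the mass term
    -- of the coupling.
    linear_combination hd

end EinsteinHilbert

end MassiveGravity

end

theorem mainTheorem2 (m : ℝ) :
    -- the change of variables `h_{μν} = H_{μν} + ½ η_{μν} Φ`, with `H` symmetric and traceless
    ((∀ μ ν, hField m μ ν = HField m μ ν + (1 / 2 * eta μ ν) • ΦField m) ∧
      (∀ μ ν, HField m μ ν = HField m ν μ) ∧
      tr (HField m) = 0 ∧
      tr (hField m) = (2 : ℝ) • ΦField m) ∧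
    -- equivalence of the two couplings
    EquivalentCouplings m
      (couplingHΦ m (wickD m) (HField m) (ΦField m) (uField m) (utField m) (vField m))
      (coupling m (wickD m) (hField m) (uField m) (utField m) (vField m)) ∧
    -- first order gauge invariance `d_Q T = i ∂^μ T_μ`
    dQ m (coupling m (wickD m) (hField m) (uField m) (utField m) (vField m)) =
      Complex.I • (ctr fun μ =>
        wickD m μ (current m (wickD m) (hField m) (uField m) (utField m) (vField m) μ)) ∧
    -- the pure graviton part of `T`, evaluated on classical fields, is `-4` times the term of order
    -- `κ` of the Einstein-Hilbert Lagrangian with `Λ = m²/2`, up to the divergence of a polynomial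
    -- in the field and its first derivatives
    ∃ B : Fin 4 → LocalPolynomial,
      ∀ h : Fin 4 → Fin 4 → Spacetime → ℝ, (∀ μ ν, ContDiff ℝ ∞ (h μ ν)) →
        (∀ μ ν, h μ ν = h ν μ) → ∀ x : Spacetime,
          ∃ a b c d : ℝ,
            (fun κ : ℝ => einsteinHilbert κ (m ^ 2 / 2) (metricOfGoldberg (goldberg κ h)) x
              - (a / κ ^ 2 + b / κ + c + d * κ)) =O[𝓝[≠] 0] (fun κ : ℝ => κ ^ 2) ∧
            -4 * d = coupling m classD h 0 0 0 x + ∑ μ, classD μ ((B μ).on h) x := by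
  refine ⟨⟨fun μ ν => ?_, fun μ ν => ?_, tr_HField, ?_⟩, equivalentCouplings, dQ_coupling,
    boundaryTerm, fun h hh hs x => einsteinHilbert_expansion m hh hs x⟩
  · rw [HField, sub_add_cancel]
  · rw [HField_eq, HField_eq, tracelessJet_symm]
  · simp [ΦField, smul_smul]
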